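/- Theorem 5.6. Let $k\ge 3$ be an integer and $0\le\alpha<1$, and let $g$ be a Riemannian metric of class $C^{k,\alpha}$ and of positive sectional curvature on $\mathbb S^3$ (here $C^{k,0}=C^k$, and for $0<\alpha<1$ the class $C^{k,\alpha}$ consists of the $C^k$ objects whose $k$-th derivatives in charts are locally Hölder continuous with exponent $\alpha$). Let $R_{ij}$ denote the Ricci tensor of $g$; indices are raised with $g$, and a semicolon denotes the covariant derivative of the Levi-Civita connection of $g$. Then there is a unique symmetric positive definite twice-covariant tensor field $\chi$ on $\mathbb S^3$ which satisfies the once-contracted Gauss equation $$R_{ij}=(\operatorname{tr}_g\chi)\,\chi_{ij}-\chi_i{}^k\chi_{kj},$$ and $\chi$ is of class $C^{k-2,\alpha}$. The following two statements are equivalent: (a) $(\mathbb S^3,g)$ is $C^{k,\alpha}$ locally isometrically embeddable in $\mathbb R^4$, i.e. every $p\in\mathbb S^3$ has an open neighborhood $U$ with a $C^{k,\alpha}$ isometric embedding $(U,g)\to\mathbb R^4$; (b) $\chi$ satisfies the Codazzi equations $\chi_{ij;k}-\chi_{ik;j}=0$ on $\mathbb S^3$. If (a) holds, then $(\mathbb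 S^3,g)$ is also locally rigid in $\mathbb R^4$: whenever $U\subset\mathbb S^3$ is a connected open set and $X,X'\colon(U,g)\to\mathbb R^4$ are $C^2$ isometric embeddings, then $X'=\Psi\circ X$ on $U$ for an isometry $\Psi$ of $\mathbb R^4$ (a rigid motion, possibly composed with a reflection). -/

import Mathlib

open scoped Manifold ContDiff NNReal Topology

noncomputable section

namespace LocalEmbed

/-! ### Hölder classes `C^{k,α}` -/

/-- `f` is of class `C^{k,α}` on the open set `Ω`: it has `k` continuous derivatives on `Ω`, and its
`k`-th derivative is Hölder continuous with exponent `α` near every point of `Ω`. For `α = 0` the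
second condition is only local boundedness of the `k`-th derivative, so that `C^{k,0} = C^k`. -/
def IsCkAlphaOn {E F : Type*} [NormedAddCommGroup E] [NormedSpace ℝ E]
    [NormedAddCommGroup F] [NormedSpace ℝ F]
    (k : ℕ) (α : ℝ≥0) (f : E → F) (Ω : Set E) : Prop :=
  ContDiffOn ℝ k f Ω ∧
    ∀ y ∈ Ω, ∃ V ∈ 𝓝 y, ∃ C : ℝ≥0, HolderOnWith C α (iteratedFDeriv ℝ k f) V

/-! ### Tensor calculus in a coordinate domain of `ℝⁿ` -/

section Coordinates

variable {n : ℕ}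

/-- The partial derivative `∂ᵢ f`. -/
def pd (i : Fin n) (f : EuclideanSpace ℝ (Fin n) → ℝ) (y : EuclideanSpace ℝ (Fin n)) : ℝ :=
  fderiv ℝ f y (EuclideanSpace.single i 1)

/-- The Christoffel symbol `Γᵏᵢⱼ = ½ gᵏˡ (∂ᵢ gⱼₗ + ∂ⱼ gᵢₗ - ∂ₗ gᵢⱼ)` of the metric with
component matrix `G`. -/
def christoffel (G : EuclideanSpace ℝ (Fin n) → Matrix (Fin n) (Fin n) ℝ) (k i j : Fin n)
    (y : EuclideanSpace ℝ (Fin n)) : ℝ :=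
  (1 / 2) * ∑ l, (G y)⁻¹ k l *
    (pd i (fun z => G z j l) y + pd j (fun z => G z i l) y - pd l (fun z => G z i j) y)

/-- The coefficient of `∂ₗ` in
`R(∂ᵢ, ∂ⱼ) ∂ₖ = ∇ᵢ ∇ⱼ ∂ₖ - ∇ⱼ ∇ᵢ ∂ₖ`, where `∇` is the Levi-Civita connection. -/
def curvatureEnd (G : EuclideanSpace ℝ (Fin n) → Matrix (Fin n) (Fin n) ℝ) (l i j k : Fin n)
    (y : EuclideanSpace ℝ (Fin n)) : ℝ :=
  pd i (christoffel G l j k) y - pd j (christoffel G l i k) y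
    + ∑ m, (christoffel G m j k y * christoffel G l i m y
      - christoffel G m i k y * christoffel G l j m y)

/-- The Riemann curvature tensor `Rᵢⱼₖₗ = g(R(∂ᵢ, ∂ⱼ) ∂ₗ, ∂ₖ)`. With this sign convention
`Rᵢⱼᵢⱼ > 0` on round spheres. -/
def riemann (G : EuclideanSpace ℝ (Fin n) → Matrix (Fin n) (Fin n) ℝ) (i j k l : Fin n)
    (y : EuclideanSpace ℝ (Fin n)) : ℝ :=
  ∑ m, G y k m * curvatureEnd G m i j l y

/-- The Ricci tensor `Rⱼₗ = gⁱᵏ Rᵢⱼₖₗ`. -/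
def ricci (G : EuclideanSpace ℝ (Fin n) → Matrix (Fin n) (Fin n) ℝ) (j l : Fin n)
    (y : EuclideanSpace ℝ (Fin n)) : ℝ :=
  ∑ i, ∑ k, (G y)⁻¹ i k * riemann G i j k l y

/-- The sectional curvature at `y` of the plane spanned by `uⁱ ∂ᵢ` and `vⁱ ∂ᵢ`, for linearly
independent `u` and `v`. -/
def sectionalCurvature (G : EuclideanSpace ℝ (Fin n) → Matrix (Fin n) (Fin n) ℝ)
    (y : EuclideanSpace ℝ (Fin n)) (u v : Fin n → ℝ) : ℝ :=
  (∑ i, ∑ j, ∑ k, ∑ l, riemann G i j k l y * u i * v j * u k * v l) /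
    ((∑ i, ∑ j, G y i j * u i * u j) * (∑ i, ∑ j, G y i j * v i * v j)
      - (∑ i, ∑ j, G y i j * u i * v j) ^ 2)

/-- The covariant derivative `T_{ij;k} = ∂ₖ Tᵢⱼ - Γᵐₖᵢ Tₘⱼ - Γᵐₖⱼ Tᵢₘ` of a twice-covariant
tensor field with component matrix `T`, for the Levi-Civita connection of `G`. -/
def covDeriv (G T : EuclideanSpace ℝ (Fin n) → Matrix (Fin n) (Fin n) ℝ) (i j k : Fin n)
    (y : EuclideanSpace ℝ (Fin n)) : ℝ :=
  pd k (fun z => T z i j) y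
    - ∑ m, christoffel G m k i y * T y m j - ∑ m, christoffel G m k j y * T y i m

end Coordinates

/-! ### Twice-covariant tensors and metrics on manifolds -/

section Manifold

variable {n : ℕ} {M : Type*} [TopologicalSpace M] [ChartedSpace (EuclideanSpace ℝ (Fin n)) M]

variable (n M) in
/-- Twice-covariant tensor fields on `M` (of no particular regularity). -/
abbrev Tensor2 : Type _ :=
  ∀ x : M, TangentSpace (𝓡 n) x →L[ℝ] TangentSpace (𝓡 n) x →L[ℝ] ℝ

variable (n M) in
/-- Riemannian metrics on `M` (of no particular regularity). -/
abbrev RiemMetric : Type _ :=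
  Bundle.RiemannianMetric (fun x : M => TangentSpace (𝓡 n) x)

/-- The components `Tᵢⱼ = T(∂ᵢ, ∂ⱼ)` of `T` in the chart `e`, as functions on `e.target`. -/
def comp (T : Tensor2 n M) (e : OpenPartialHomeomorph M (EuclideanSpace ℝ (Fin n)))
    (y : EuclideanSpace ℝ (Fin n)) : Matrix (Fin n) (Fin n) ℝ :=
  Matrix.of fun i j =>
    T (e.symm y) (mfderiv (𝓡 n) (𝓡 n) e.symm y (EuclideanSpace.single i (1 : ℝ)))
      (mfderiv (𝓡 n) (𝓡 n) e.symm y (EuclideanSpace.single j (1 : ℝ)))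

/-- The tensor field `T` is of class `C^{k,α}`: so are its components in every chart. -/
def IsCkAlphaTensor (k : ℕ) (α : ℝ≥0) (T : Tensor2 n M) : Prop :=
  ∀ e ∈ atlas (EuclideanSpace ℝ (Fin n)) M, ∀ i j : Fin n,
    IsCkAlphaOn k α (fun y => comp T e y i j) e.target

/-- The metric `g` (of class at least `C²`) has positive sectional curvature. -/
def PositiveSectionalCurvature (g : RiemMetric n M) : Prop :=
  ∀ e ∈ atlas (EuclideanSpace ℝ (Fin n)) M, ∀ y ∈ e.target, ∀ u v : Fin n → ℝ,
    LinearIndependent ℝ ![u, v] → 0 < sectionalCurvature (comp g.inner e) y u v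

/-- The once-contracted Gauss equation `Rᵢⱼ = (tr χ) χᵢⱼ - χᵢᵏ χₖⱼ`, indices being raised with
`g`. -/
def ContractedGauss (g : RiemMetric n M) (χ : Tensor2 n M) : Prop :=
  ∀ e ∈ atlas (EuclideanSpace ℝ (Fin n)) M, ∀ y ∈ e.target, ∀ i j : Fin n,
    ricci (comp g.inner e) i j y =
      (∑ k, ∑ l, (comp g.inner e y)⁻¹ k l * comp χ e y k l) * comp χ e y i j
        - ∑ k, ∑ l, (comp g.inner e y)⁻¹ k l * comp χ e y i l * comp χ e y k j

/-- `χ` is a symmetric, positive definite solution of the once-contracted Gauss equation. -/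
structure IsGaussSolution (g : RiemMetric n M) (χ : Tensor2 n M) : Prop where
  symm : ∀ (x : M) (v w : TangentSpace (𝓡 n) x), χ x v w = χ x w v
  pos : ∀ (x : M) (v : TangentSpace (𝓡 n) x), v ≠ 0 → 0 < χ x v v
  contractedGauss : ContractedGauss g χ

/-- The Codazzi equations `χ_{ij;k} - χ_{ik;j} = 0` (for `χ` of class at least `C¹`). -/
def Codazzi (g : RiemMetric n M) (χ : Tensor2 n M) : Prop :=
  ∀ e ∈ atlas (EuclideanSpace ℝ (Fin n)) M, ∀ y ∈ e.target, ∀ i j k : Fin n,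
    covDeriv (comp g.inner e) (comp χ e) i j k y
      - covDeriv (comp g.inner e) (comp χ e) i k j y = 0

/-! ### Local isometric embeddings and local rigidity -/

/-- The map `X` is of class `C^{k,α}` on the open set `U ⊆ M`, i.e. it is so in every chart. -/
def IsCkAlphaMapOn {N : ℕ} (k : ℕ) (α : ℝ≥0) (X : M → EuclideanSpace ℝ (Fin N)) (U : Set M) :
    Prop :=
  ∀ e ∈ atlas (EuclideanSpace ℝ (Fin n)) M,
    IsCkAlphaOn k α (fun y : EuclideanSpace ℝ (Fin n) => X (e.symm y))
      (e.target ∩ e.symm ⁻¹' U)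

/-- The restriction of `X` to `U` is a homeomorphism onto its image, and pulls the Euclidean inner
product back to `g` (so that it is an immersion). Differentiability on `U` is required
separately. -/
structure IsIsometricEmbeddingOn {N : ℕ} (g : RiemMetric n M) (X : M → EuclideanSpace ℝ (Fin N))
    (U : Set M) : Prop where
  isEmbedding : Topology.IsEmbedding (U.domRestrict X)
  isometric : ∀ x ∈ U, ∀ v w : TangentSpace (𝓡 n) x,
    @inner ℝ (EuclideanSpace ℝ (Fin N)) _ (mfderiv (𝓡 n) (𝓡 N) X x v)
      (mfderiv (𝓡 n) (𝓡 N) X x w) = g.inner x v w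

/-- `(M, g)` is `C^{k,α}` locally isometrically embeddable in `ℝᴺ`. -/
def LocallyEmbeddable (k : ℕ) (α : ℝ≥0) (g : RiemMetric n M) (N : ℕ) : Prop :=
  ∀ p : M, ∃ U : Set M, IsOpen U ∧ p ∈ U ∧ ∃ X : M → EuclideanSpace ℝ (Fin N),
    IsCkAlphaMapOn (n := n) k α X U ∧ IsIsometricEmbeddingOn g X U

/-- `(M, g)` is locally rigid in `ℝᴺ`: two `C²` isometric embeddings of the same connected open set
differ by an isometry of `ℝᴺ`, i.e. by a rigid motion possibly composed with a reflection. -/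
def LocallyRigid (g : RiemMetric n M) (N : ℕ) : Prop :=
  ∀ U : Set M, IsOpen U → IsConnected U → ∀ X X' : M → EuclideanSpace ℝ (Fin N),
    ContMDiffOn (𝓡 n) (𝓡 N) 2 X U → IsIsometricEmbeddingOn g X U →
    ContMDiffOn (𝓡 n) (𝓡 N) 2 X' U → IsIsometricEmbeddingOn g X' U →
    ∃ Ψ : EuclideanSpace ℝ (Fin N) ≃ᵃⁱ[ℝ] EuclideanSpace ℝ (Fin N), ∀ x ∈ U, X' x = Ψ (X x)

end Manifold

/-- The unit sphere of `ℝ⁴`, with the smooth structure given by stereographic projections. -/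
abbrev S3 : Type := Metric.sphere (0 : EuclideanSpace ℝ (Fin 4)) 1

end LocalEmbed

end

set_option linter.unusedSectionVars false
set_option linter.unusedSimpArgs false
set_option linter.unusedVariables false
set_option maxSynthPendingDepth 3

noncomputable section

namespace LocalEmbed

/-! ### Calculus of the classes `C^{k,α}` -/

section Holder

variable {E F G H : Type} [NormedAddCommGroup E] [NormedSpace ℝ E]
  [NormedAddCommGroup F] [NormedSpace ℝ F] [NormedAddCommGroup G] [NormedSpace ℝ G]
  [NormedAddCommGroup H] [NormedSpace ℝ H]

/-! Algebra at a point. In dimension three a curvature tensor is encoded by its 3×3 matrix P on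
bivectors, and the right-hand side of the Gauss equation for a symmetric χ has matrix adj χ. So the
Gauss equation reads adj χ = P (`bivectorForm_gaussTensor`). Contraction with g⁻¹ loses nothing
(`CurvLike.bivectorForm_eq_zero`), so the once-contracted equation says the same. Every bivector of
ℝ³ is decomposable, hence positive sectional curvature makes P positive definite, and adj χ = P then
has exactly the solutions ±(det P)^(-1/2) adj P (`eq_adjugateRoot_or`). The positive one is a smooth
function of g and its derivatives up to order two, hence of class C^{k-2,α}; uniqueness makes the
solutions in different charts agree (`chartRoot_transition`).

From embeddings to Codazzi and rigidity. The second fundamental form of a C² isometric immersion X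
satisfies the Gauss equation, so it is ±χ, and the unit normal n can be chosen to give +χ. Then n =
II(u,u)/χ(u,u) is continuous, and in fact differentiable with dn = -dX∘S, where S is χ with an index
raised. Hence (X, dX, n) solves the linear total system dX = W, dW = WΓ + χN, dN = -WS, whose
coefficients depend on g alone. The Codazzi equations come from the symmetry of second derivatives,
in a form which needs no third derivatives of X (`symm_fderiv_form`). Two solutions of the system
that agree at a point agree nearby, so two embeddings differ near each point by an isometry; that
isometry is determined by the embeddings near the point, and connectedness makes it constant.

From Codazzi to embeddings. The Gauss and Codazzi equations make this total system flat. Its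
coefficients are C¹ because k ≥ 3, and `exists_solution_of_flat` solves it by integrating along
rays. The deviation of the Gram matrix of the frame from its expected value solves a homogeneous
linear system, so it stays zero and X induces g (`ShapeData.gram_eventually`). The system itself
raises the regularity of X to C^{k,α}, and the inverse function theorem turns the immersion into a
local embedding. -/

/-- Local Hölder continuity at the points of `Ω`. -/
def LocHolder (α : ℝ≥0) (f : E → F) (Ω : Set E) : Prop :=
  ∀ y ∈ Ω, ∃ V ∈ 𝓝 y, ∃ C : ℝ≥0, HolderOnWith C α f V

theorem LocHolder.comp_lipschitz {α : ℝ≥0} {f : E → F} {Ω : Set E} (hf : LocHolder α f Ω)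
    (hc : ∀ y ∈ Ω, ContinuousAt f y) {Φ : F → G}
    (hΦ : ∀ y ∈ Ω, ∃ K : ℝ≥0, ∃ T ∈ 𝓝 (f y), LipschitzOnWith K Φ T) :
    LocHolder α (fun y => Φ (f y)) Ω := by
  intro y hy
  obtain ⟨V, hV, C, hC⟩ := hf y hy
  obtain ⟨K, T, hT, hK⟩ := hΦ y hy
  -- The exponent 1 on C is the Hölder exponent of the Lipschitz map Φ.
  refine ⟨V ∩ f ⁻¹' T, Filter.inter_mem hV (hc y hy hT), K * C ^ (1 : ℝ), ?_⟩
  have := (holderOnWith_one.2 hK).comp (hC.mono (Set.inter_subset_left (t := f ⁻¹' T)))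
    (fun x hx => hx.2)
  simpa [Function.comp_def] using this

theorem LocHolder.precomp_lipschitz {α : ℝ≥0} {f : E → F} {Ω : Set E} (hf : LocHolder α f Ω)
    {φ : G → E} {Ω' : Set G} (hm : ∀ y ∈ Ω', φ y ∈ Ω) (hc : ∀ y ∈ Ω', ContinuousAt φ y)
    (hφ : ∀ y ∈ Ω', ∃ K : ℝ≥0, ∃ T ∈ 𝓝 y, LipschitzOnWith K φ T) :
    LocHolder α (fun y => f (φ y)) Ω' := by
  intro y hy
  obtain ⟨V, hV, C, hC⟩ := hf _ (hm y hy)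
  obtain ⟨K, T, hT, hK⟩ := hφ y hy
  refine ⟨φ ⁻¹' V ∩ T, Filter.inter_mem (hc y hy hV) hT, C * K ^ (α : ℝ), ?_⟩
  have := hC.comp ((holderOnWith_one.2 hK).mono (Set.inter_subset_right (s := φ ⁻¹' V)))
    (fun x hx => hx.1)
  simpa [Function.comp_def] using this

theorem LocHolder.prodMk {α : ℝ≥0} {f : E → F} {g : E → G} {Ω : Set E} (hf : LocHolder α f Ω)
    (hg : LocHolder α g Ω) : LocHolder α (fun y => (f y, g y)) Ω := by
  intro y hy
  obtain ⟨V, hV, C, hC⟩ := hf y hy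
  obtain ⟨W, hW, D, hD⟩ := hg y hy
  refine ⟨V ∩ W, Filter.inter_mem hV hW, max C D, ?_⟩
  intro a ha b hb
  rw [Prod.edist_eq]
  refine max_le ((hC a ha.1 b hb.1).trans ?_) ((hD a ha.2 b hb.2).trans ?_) <;>
    gcongr <;> simp

/-- On a set of diameter at most 2 a Lipschitz bound implies a Hölder bound of every exponent α ≤ 1,
whence the intersection with a unit ball. -/
theorem LocHolder.of_lipschitz {α : ℝ≥0} (hα : α ≤ 1) {f : E → F} {Ω : Set E}
    (hf : ∀ y ∈ Ω, ∃ K : ℝ≥0, ∃ T ∈ 𝓝 y, LipschitzOnWith K f T) : LocHolder α f Ω := by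
  intro y hy
  obtain ⟨K, T, hT, hK⟩ := hf y hy
  have hb : Metric.ball y 1 ∈ 𝓝 y := Metric.ball_mem_nhds _ one_pos
  refine ⟨T ∩ Metric.ball y 1, Filter.inter_mem hT hb, _, 
    HolderOnWith.of_le (D := 2) (C := K) (s := α) (r := 1) ?_ ?_ hα⟩
  · intro a ha b hb
    rw [edist_nndist]
    have h1 : dist a y < 1 := ha.2
    have h2 : dist b y < 1 := hb.2
    have : dist a b ≤ 2 := by linarith [dist_triangle_right a b y]
    exact_mod_cast this
  · exact (holderOnWith_one.2 hK).mono Set.inter_subset_left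

theorem LocHolder.congr {α : ℝ≥0} {f g : E → F} {Ω : Set E} (hΩ : IsOpen Ω) (hf : LocHolder α f Ω)
    (h : ∀ y ∈ Ω, g y = f y) : LocHolder α g Ω := by
  intro y hy
  obtain ⟨V, hV, C, hC⟩ := hf y hy
  refine ⟨V ∩ Ω, Filter.inter_mem hV (hΩ.mem_nhds hy), C, fun a ha b hb => ?_⟩
  rw [h a ha.2, h b hb.2]
  exact hC a ha.1 b hb.1

theorem isCkAlphaOn_zero {α : ℝ≥0} {f : E → F} {Ω : Set E} :
    IsCkAlphaOn 0 α f Ω ↔ ContinuousOn f Ω ∧ LocHolder α f Ω := by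
  have h : ∀ V C, HolderOnWith C α (iteratedFDeriv ℝ 0 f) V ↔ HolderOnWith C α f V := by
    intro V C
    simp only [HolderOnWith, iteratedFDeriv_zero_eq_comp, Function.comp_apply,
      LinearIsometryEquiv.edist_map]
  simp only [IsCkAlphaOn, LocHolder, h]
  simp [contDiffOn_zero]

/-- Up to a linear isometry, the iterated derivative of order k+1 of `f` is that of order k of
`fderiv ℝ f`. The main calculus rules below are inductions on k through this equivalence, with the
target space generalized because differentiation changes it. -/
theorem isCkAlphaOn_succ {k : ℕ} {α : ℝ≥0} {f : E → F} {Ω : Set E} (hΩ : IsOpen Ω) :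
    IsCkAlphaOn (k + 1) α f Ω ↔
      (∀ y ∈ Ω, DifferentiableAt ℝ f y) ∧ IsCkAlphaOn k α (fderiv ℝ f) Ω := by
  have h : ∀ V C, HolderOnWith C α (iteratedFDeriv ℝ (k + 1) f) V ↔
      HolderOnWith C α (iteratedFDeriv ℝ k (fderiv ℝ f)) V := by
    intro V C
    simp only [HolderOnWith, iteratedFDeriv_succ_eq_comp_right, Function.comp_apply,
      LinearIsometryEquiv.edist_map]
  simp only [IsCkAlphaOn, h]
  have h2 : ContDiffOn ℝ ((k + 1 : ℕ) : ℕ∞ω) f Ω ↔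
      (∀ y ∈ Ω, DifferentiableAt ℝ f y) ∧ ContDiffOn ℝ k (fderiv ℝ f) Ω := by
    push_cast
    rw [contDiffOn_succ_iff_fderiv_of_isOpen hΩ]
    constructor
    · rintro ⟨a, -, b⟩
      exact ⟨fun y hy => (a y hy).differentiableAt (hΩ.mem_nhds hy), b⟩
    · rintro ⟨a, b⟩
      refine ⟨fun y hy => (a y hy).differentiableWithinAt, by simp, b⟩
  rw [h2, and_assoc]

theorem IsCkAlphaOn.contDiffOn {k : ℕ} {α : ℝ≥0} {f : E → F} {Ω : Set E}
    (h : IsCkAlphaOn k α f Ω) : ContDiffOn ℝ k f Ω := h.1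

theorem IsCkAlphaOn.congr {k : ℕ} {α : ℝ≥0} {f g : E → F} {Ω : Set E} (hΩ : IsOpen Ω)
    (hf : IsCkAlphaOn k α f Ω) (h : ∀ y ∈ Ω, g y = f y) : IsCkAlphaOn k α g Ω := by
  refine ⟨hf.1.congr h, LocHolder.congr (f := iteratedFDeriv ℝ k f) hΩ hf.2 fun y hy => ?_⟩
  exact (Filter.EventuallyEq.iteratedFDeriv (𝕜 := ℝ)
    (Filter.eventuallyEq_of_mem (hΩ.mem_nhds hy) h) k).eq_of_nhds

theorem IsCkAlphaOn.mono_set {k : ℕ} {α : ℝ≥0} {f : E → F} {Ω Ω' : Set E}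
    (hf : IsCkAlphaOn k α f Ω) (h : Ω' ⊆ Ω) : IsCkAlphaOn k α f Ω' :=
  ⟨hf.1.mono h, fun y hy => hf.2 y (h hy)⟩

theorem exists_lipschitz_of_contDiffAt {f : E → F} {y : E} {n : ℕ∞ω} (h : ContDiffAt ℝ n f y)
    (hn : n ≠ 0) : ∃ K : ℝ≥0, ∃ T ∈ 𝓝 y, LipschitzOnWith K f T :=
  ((h.of_le (ENat.one_le_iff_ne_zero_withTop.2 hn))).exists_lipschitzOnWith

/-- `C^{k+1} ⊆ C^{k,α}`. -/
theorem isCkAlphaOn_of_contDiffOn {k : ℕ} {α : ℝ≥0} (hα : α ≤ 1) {f : E → F} {Ω : Set E}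
    (hΩ : IsOpen Ω) (hf : ContDiffOn ℝ (k + 1 : ℕ) f Ω) : IsCkAlphaOn k α f Ω := by
  induction k generalizing F with
  | zero =>
    refine isCkAlphaOn_zero.2 ⟨hf.continuousOn, LocHolder.of_lipschitz hα fun y hy => ?_⟩
    exact exists_lipschitz_of_contDiffAt (hf.contDiffAt (hΩ.mem_nhds hy)) (by simp)
  | succ k ih =>
    refine (isCkAlphaOn_succ hΩ).2 ⟨fun y hy => ?_, ih ?_⟩
    · exact (hf.contDiffAt (hΩ.mem_nhds hy)).differentiableAt (by simp)
    · have := (contDiffOn_succ_iff_fderiv_of_isOpen (n := (k + 1 : ℕ)) hΩ).1 (by exact_mod_cast hf)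
      exact this.2.2

theorem IsCkAlphaOn.of_succ {k : ℕ} {α : ℝ≥0} (hα : α ≤ 1) {f : E → F} {Ω : Set E}
    (hΩ : IsOpen Ω) (hf : IsCkAlphaOn (k + 1) α f Ω) : IsCkAlphaOn k α f Ω :=
  isCkAlphaOn_of_contDiffOn hα hΩ hf.1

theorem IsCkAlphaOn.of_le {k m : ℕ} {α : ℝ≥0} (hα : α ≤ 1) {f : E → F} {Ω : Set E}
    (hΩ : IsOpen Ω) (hf : IsCkAlphaOn k α f Ω) (h : m ≤ k) : IsCkAlphaOn m α f Ω := by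
  induction k, h using Nat.le_induction with
  | base => exact hf
  | succ n _ ih => exact ih (hf.of_succ hα hΩ)

theorem IsCkAlphaOn.clm_comp {k : ℕ} {α : ℝ≥0} {f : E → F} {Ω : Set E} (hΩ : IsOpen Ω)
    (hf : IsCkAlphaOn k α f Ω) (l : F →L[ℝ] G) : IsCkAlphaOn k α (fun y => l (f y)) Ω := by
  induction k generalizing F G with
  | zero =>
    rw [isCkAlphaOn_zero] at hf ⊢
    refine ⟨l.continuous.comp_continuousOn hf.1, hf.2.comp_lipschitz
      (fun y hy => hf.1.continuousAt (hΩ.mem_nhds hy)) fun y _ => ?_⟩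
    exact ⟨_, Set.univ, Filter.univ_mem, l.lipschitz.lipschitzOnWith⟩
  | succ k ih =>
    rw [isCkAlphaOn_succ hΩ] at hf ⊢
    refine ⟨fun y hy => l.differentiableAt.comp y (hf.1 y hy), ?_⟩
    refine (ih hf.2 (ContinuousLinearMap.compL ℝ E F G l)).congr hΩ fun y hy => ?_
    exact (l.hasFDerivAt.comp y (hf.1 y hy).hasFDerivAt).fderiv

theorem IsCkAlphaOn.prodMk {k : ℕ} {α : ℝ≥0} {f : E → F} {g : E → G} {Ω : Set E} (hΩ : IsOpen Ω)
    (hf : IsCkAlphaOn k α f Ω) (hg : IsCkAlphaOn k α g Ω) :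
    IsCkAlphaOn k α (fun y => (f y, g y)) Ω := by
  induction k generalizing F G with
  | zero =>
    rw [isCkAlphaOn_zero] at hf hg ⊢
    exact ⟨hf.1.prodMk hg.1, hf.2.prodMk hg.2⟩
  | succ k ih =>
    rw [isCkAlphaOn_succ hΩ] at hf hg ⊢
    refine ⟨fun y hy => (hf.1 y hy).prodMk (hg.1 y hy), ?_⟩
    refine ((ih hf.2 hg.2).clm_comp hΩ
      ((ContinuousLinearMap.prodₗᵢ ℝ (𝕜 := ℝ) (E := E) (F := F) (G := G)).toContinuousLinearEquiv :
        _ →L[ℝ] _)).congr hΩ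
      fun y hy => ?_
    exact ((hf.1 y hy).hasFDerivAt.prodMk (hg.1 y hy).hasFDerivAt).fderiv

theorem _root_.ContinuousLinearMap.exists_lipschitz_bilinear (b : F →L[ℝ] G →L[ℝ] H) (p : F × G) :
    ∃ K : ℝ≥0, ∃ T ∈ 𝓝 p, LipschitzOnWith K (fun q : F × G => b q.1 q.2) T :=
  exists_lipschitz_of_contDiffAt (n := 1) b.isBoundedBilinearMap.contDiff.contDiffAt (by simp)

/-- The product rule writes the derivative as a sum of two pairings of one factor with the
derivative of the other, to which the induction applies. The bound α ≤ 1 keeps the undifferentiated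
factor in the class C^{k,α}. -/
theorem IsCkAlphaOn.bilinear {k : ℕ} {α : ℝ≥0} (hα : α ≤ 1) {f : E → F} {g : E → G} {Ω : Set E}
    (hΩ : IsOpen Ω) (hf : IsCkAlphaOn k α f Ω) (hg : IsCkAlphaOn k α g Ω)
    (b : F →L[ℝ] G →L[ℝ] H) : IsCkAlphaOn k α (fun y => b (f y) (g y)) Ω := by
  induction k generalizing F G H with
  | zero =>
    rw [isCkAlphaOn_zero] at hf hg ⊢
    refine ⟨fun y hy => ?_, LocHolder.comp_lipschitz (hf.2.prodMk hg.2)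
      (fun y hy => ((hf.1.prodMk hg.1).continuousAt (hΩ.mem_nhds hy)))
      (Φ := fun q : F × G => b q.1 q.2) fun y _ => b.exists_lipschitz_bilinear _⟩
    exact (b.continuous.continuousAt.comp_continuousWithinAt (hf.1 y hy)).clm_apply (hg.1 y hy)
  | succ k ih =>
    have hf0 := hf.of_succ hα hΩ
    have hg0 := hg.of_succ hα hΩ
    rw [isCkAlphaOn_succ hΩ] at hf hg ⊢
    refine ⟨fun y hy =>
      (b.hasFDerivAt_of_bilinear (hf.1 y hy).hasFDerivAt (hg.1 y hy).hasFDerivAt).differentiableAt,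
      ?_⟩
    have h1 := ih hf0 hg.2 (b.precompR E)
    have h2 := ih hf.2 hg0 (b.precompL E)
    refine ((h1.prodMk hΩ h2).clm_comp hΩ
      (ContinuousLinearMap.fst ℝ _ _ + ContinuousLinearMap.snd ℝ _ _)).congr hΩ fun y hy => ?_
    exact (b.hasFDerivAt_of_bilinear (hf.1 y hy).hasFDerivAt (hg.1 y hy).hasFDerivAt).fderiv

/-- By the chain rule the derivative is a bilinear pairing of `fderiv ℝ Φ` along `f` with `fderiv ℝ
f`. Smoothness of Φ is asked only at values of `f`, so that Φ may be an inverse or a square root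
away from 0. -/
theorem IsCkAlphaOn.smooth_comp {k : ℕ} {α : ℝ≥0} (hα : α ≤ 1) {f : E → F} {Ω : Set E}
    (hΩ : IsOpen Ω) (hf : IsCkAlphaOn k α f Ω) {Φ : F → G}
    (hΦ : ∀ y ∈ Ω, ContDiffAt ℝ ∞ Φ (f y)) : IsCkAlphaOn k α (fun y => Φ (f y)) Ω := by
  induction k generalizing G with
  | zero =>
    rw [isCkAlphaOn_zero] at hf ⊢
    exact ⟨fun y hy => (hΦ y hy).continuousAt.comp_continuousWithinAt (hf.1 y hy),
      hf.2.comp_lipschitz (fun y hy => hf.1.continuousAt (hΩ.mem_nhds hy))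
      fun y hy => exists_lipschitz_of_contDiffAt (hΦ y hy) (by simp)⟩
  | succ k ih =>
    have hf0 := hf.of_succ hα hΩ
    rw [isCkAlphaOn_succ hΩ] at hf ⊢
    have hd : ∀ y ∈ Ω, DifferentiableAt ℝ Φ (f y) := fun y hy =>
      (hΦ y hy).differentiableAt (by simp)
    refine ⟨fun y hy => (hd y hy).comp y (hf.1 y hy), ?_⟩
    have h1 : IsCkAlphaOn k α (fun y => fderiv ℝ Φ (f y)) Ω :=
      ih hf0 fun y hy => (hΦ y hy).fderiv_right (m := ∞) (by simp)
    refine (h1.bilinear hα hΩ hf.2 (ContinuousLinearMap.compL ℝ E F G)).congr hΩ fun y hy => ?_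
    exact ((hd y hy).hasFDerivAt.comp y (hf.1 y hy).hasFDerivAt).fderiv

theorem IsCkAlphaOn.precomp {k : ℕ} {α : ℝ≥0} (hα : α ≤ 1) {f : E → F} {Ω : Set E}
    (hΩ : IsOpen Ω) (hf : IsCkAlphaOn k α f Ω) {φ : G → E} {Ω' : Set G} (hΩ' : IsOpen Ω')
    (hφ : ContDiffOn ℝ ∞ φ Ω') (hm : ∀ y ∈ Ω', φ y ∈ Ω) :
    IsCkAlphaOn k α (fun y => f (φ y)) Ω' := by
  have hφ' : ∀ y ∈ Ω', ContDiffAt ℝ ∞ φ y := fun y hy => hφ.contDiffAt (hΩ'.mem_nhds hy)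
  induction k generalizing F with
  | zero =>
    rw [isCkAlphaOn_zero] at hf ⊢
    exact ⟨hf.1.comp hφ.continuousOn hm, hf.2.precomp_lipschitz hm
      (fun y hy => (hφ' y hy).continuousAt) fun y hy => exists_lipschitz_of_contDiffAt (hφ' y hy) (by simp)⟩
  | succ k ih =>
    rw [isCkAlphaOn_succ hΩ] at hf
    rw [isCkAlphaOn_succ hΩ']
    have hd : ∀ y ∈ Ω', DifferentiableAt ℝ φ y := fun y hy =>
      (hφ' y hy).differentiableAt (by simp)
    refine ⟨fun y hy => (hf.1 _ (hm y hy)).comp y (hd y hy), ?_⟩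
    have h2 : IsCkAlphaOn k α (fderiv ℝ φ) Ω' := by
      refine isCkAlphaOn_of_contDiffOn hα hΩ' ?_
      exact hφ.fderiv_of_isOpen hΩ' (by exact_mod_cast le_top)
    refine ((ih hf.2).bilinear hα hΩ' h2 (ContinuousLinearMap.compL ℝ G E F)).congr hΩ'
      fun y hy => ?_
    exact ((hf.1 _ (hm y hy)).hasFDerivAt.comp y (hd y hy).hasFDerivAt).fderiv

theorem isCkAlphaOn_const {k : ℕ} {α : ℝ≥0} (hα : α ≤ 1) {Ω : Set E} (hΩ : IsOpen Ω) (c : F) :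
    IsCkAlphaOn k α (fun _ => c) Ω :=
  isCkAlphaOn_of_contDiffOn hα hΩ contDiffOn_const

theorem IsCkAlphaOn.add {k : ℕ} {α : ℝ≥0} {f g : E → F} {Ω : Set E} (hΩ : IsOpen Ω)
    (hf : IsCkAlphaOn k α f Ω) (hg : IsCkAlphaOn k α g Ω) :
    IsCkAlphaOn k α (fun y => f y + g y) Ω :=
  (hf.prodMk hΩ hg).clm_comp hΩ
    (ContinuousLinearMap.fst ℝ _ _ + ContinuousLinearMap.snd ℝ _ _)

theorem IsCkAlphaOn.sub {k : ℕ} {α : ℝ≥0} {f g : E → F} {Ω : Set E} (hΩ : IsOpen Ω)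
    (hf : IsCkAlphaOn k α f Ω) (hg : IsCkAlphaOn k α g Ω) :
    IsCkAlphaOn k α (fun y => f y - g y) Ω :=
  (hf.prodMk hΩ hg).clm_comp hΩ
    (ContinuousLinearMap.fst ℝ _ _ - ContinuousLinearMap.snd ℝ _ _)

theorem IsCkAlphaOn.sum {k : ℕ} {α : ℝ≥0} (hα : α ≤ 1) {ι : Type*} {f : ι → E → F} {Ω : Set E}
    (hΩ : IsOpen Ω) (s : Finset ι) (hf : ∀ i ∈ s, IsCkAlphaOn k α (f i) Ω) :
    IsCkAlphaOn k α (fun y => ∑ i ∈ s, f i y) Ω := by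
  classical
  induction s using Finset.induction_on with
  | empty => simpa using isCkAlphaOn_const hα hΩ (0 : F)
  | insert a s ha ih =>
    simp only [Finset.sum_insert ha]
    exact (hf a (by simp)).add hΩ (ih fun i hi => hf i (by simp [hi]))

theorem IsCkAlphaOn.mul {k : ℕ} {α : ℝ≥0} (hα : α ≤ 1) {f g : E → ℝ} {Ω : Set E} (hΩ : IsOpen Ω)
    (hf : IsCkAlphaOn k α f Ω) (hg : IsCkAlphaOn k α g Ω) :
    IsCkAlphaOn k α (fun y => f y * g y) Ω :=
  hf.bilinear hα hΩ hg (ContinuousLinearMap.mul ℝ ℝ)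

theorem IsCkAlphaOn.inv {k : ℕ} {α : ℝ≥0} (hα : α ≤ 1) {f : E → ℝ} {Ω : Set E} (hΩ : IsOpen Ω)
    (hf : IsCkAlphaOn k α f Ω) (h0 : ∀ y ∈ Ω, f y ≠ 0) :
    IsCkAlphaOn k α (fun y => (f y)⁻¹) Ω :=
  hf.smooth_comp hα hΩ (Φ := fun t => t⁻¹) fun y hy => contDiffAt_inv ℝ (h0 y hy)

theorem IsCkAlphaOn.sqrt {k : ℕ} {α : ℝ≥0} (hα : α ≤ 1) {f : E → ℝ} {Ω : Set E} (hΩ : IsOpen Ω)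
    (hf : IsCkAlphaOn k α f Ω) (h0 : ∀ y ∈ Ω, f y ≠ 0) :
    IsCkAlphaOn k α (fun y => √(f y)) Ω :=
  hf.smooth_comp hα hΩ (Φ := fun t => √t) fun y hy => Real.contDiffAt_sqrt (h0 y hy)

/-- A field of linear maps on a finite-dimensional space is `C^{k,α}` if its values at the vectors
of a fixed basis are. -/
theorem isCkAlphaOn_clm_of_basis {k : ℕ} {α : ℝ≥0} (hα : α ≤ 1) {ι : Type*} [Fintype ι]
    [FiniteDimensional ℝ F] (b : Module.Basis ι ℝ F) {f : E → F →L[ℝ] G} {Ω : Set E}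
    (hΩ : IsOpen Ω) (hf : ∀ i, IsCkAlphaOn k α (fun y => f y (b i)) Ω) : IsCkAlphaOn k α f Ω := by
  have h : f = fun y => ∑ i, ContinuousLinearMap.smulRightL ℝ F G
      (LinearMap.toContinuousLinearMap (b.coord i)) (f y (b i)) := by
    funext y
    ext v
    conv_lhs => rw [← b.sum_repr v, map_sum]
    simp
  rw [h]
  exact IsCkAlphaOn.sum hα hΩ _ fun i _ => (hf i).clm_comp hΩ _

theorem isCkAlphaOn_clm {k : ℕ} {α : ℝ≥0} (hα : α ≤ 1) [FiniteDimensional ℝ F]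
    {f : E → F →L[ℝ] G} {Ω : Set E} (hΩ : IsOpen Ω)
    (hf : ∀ v, IsCkAlphaOn k α (fun y => f y v) Ω) : IsCkAlphaOn k α f Ω :=
  isCkAlphaOn_clm_of_basis hα (Module.finBasis ℝ F) hΩ fun _ => hf _

theorem IsCkAlphaOn.clm_apply_const {k : ℕ} {α : ℝ≥0} {f : E → F →L[ℝ] G} {Ω : Set E}
    (hΩ : IsOpen Ω) (hf : IsCkAlphaOn k α f Ω) (v : F) : IsCkAlphaOn k α (fun y => f y v) Ω :=
  hf.clm_comp hΩ (ContinuousLinearMap.apply ℝ G v)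

theorem IsCkAlphaOn.fderiv {k : ℕ} {α : ℝ≥0} {f : E → F} {Ω : Set E} (hΩ : IsOpen Ω)
    (hf : IsCkAlphaOn (k + 1) α f Ω) : IsCkAlphaOn k α (fderiv ℝ f) Ω :=
  ((isCkAlphaOn_succ hΩ).1 hf).2

end Holder

/-! ### Derivatives of applied fields of multilinear maps -/

section Apply

variable {E F G H K : Type} [NormedAddCommGroup E] [NormedSpace ℝ E]
  [NormedAddCommGroup F] [NormedSpace ℝ F] [NormedAddCommGroup G] [NormedSpace ℝ G]
  [NormedAddCommGroup H] [NormedSpace ℝ H]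

theorem fderiv_field_apply {T : E → F →L[ℝ] G} {f : E → F} {p : E}
    (hT : DifferentiableAt ℝ T p) (hf : DifferentiableAt ℝ f p) (a : E) :
    fderiv ℝ (fun y => T y (f y)) p a = fderiv ℝ T p a (f p) + T p (fderiv ℝ f p a) := by
  rw [(hT.hasFDerivAt.clm_apply hf.hasFDerivAt).fderiv]
  simp [add_comm]

theorem fderiv_field_apply_const {T : E → F →L[ℝ] G} {p : E}
    (hT : DifferentiableAt ℝ T p) (v : F) (a : E) :
    fderiv ℝ (fun y => T y v) p a = fderiv ℝ T p a v := by
  rw [fderiv_field_apply hT (differentiableAt_const v)]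
  simp

theorem fderiv_field_apply₂ {T : E → F →L[ℝ] G →L[ℝ] H} {f : E → F} {g : E → G} {p : E}
    (hT : DifferentiableAt ℝ T p) (hf : DifferentiableAt ℝ f p) (hg : DifferentiableAt ℝ g p)
    (a : E) :
    fderiv ℝ (fun y => T y (f y) (g y)) p a =
      fderiv ℝ T p a (f p) (g p) + T p (fderiv ℝ f p a) (g p) + T p (f p) (fderiv ℝ g p a) := by
  rw [fderiv_field_apply (hT.clm_apply hf) hg, fderiv_field_apply hT hf]
  simp

theorem fderiv_field_apply₂_const {T : E → F →L[ℝ] G →L[ℝ] H} {p : E}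
    (hT : DifferentiableAt ℝ T p) (u : F) (v : G) (a : E) :
    fderiv ℝ (fun y => T y u v) p a = fderiv ℝ T p a u v := by
  rw [fderiv_field_apply₂ hT (differentiableAt_const u) (differentiableAt_const v)]
  simp

/-- A product of a continuous factor and a differentiable factor which vanishes at the point is
differentiable there. -/
theorem hasFDerivAt_apply_of_eq_zero {c : E → F →L[ℝ] G} {w : E → F} {w' : E →L[ℝ] F} {p : E}
    (hc : ContinuousAt c p) (hw : HasFDerivAt w w' p) (h0 : w p = 0) :
    HasFDerivAt (fun y => c y (w y)) ((c p).comp w') p := by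
  have h1 : HasFDerivAt (fun y => c p (w y)) ((c p).comp w') p := (c p).hasFDerivAt.comp p hw
  -- This summand is o(1) · O(y - p).
  have h2 : HasFDerivAt (fun y => (c y - c p) (w y)) (0 : E →L[ℝ] G) p := by
    rw [hasFDerivAt_iff_isLittleO]
    have hO : (fun y => w y) =O[𝓝 p] fun y => y - p := by
      simpa [h0] using hw.isBigO_sub
    have ho : (fun y => c y - c p) =o[𝓝 p] fun _ => (1 : ℝ) := by
      rw [Asymptotics.isLittleO_one_iff]
      simpa [Pi.sub_def] using (hc.sub (continuousAt_const (y := c p))).tendsto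
    have h3 : (fun y => (c y - c p) (w y)) =O[𝓝 p] fun y => ‖c y - c p‖ * ‖w y‖ :=
      Asymptotics.isBigO_of_le _ fun y => by
        simpa using (c y - c p).le_opNorm (w y)
    have h4 : (fun y => ‖c y - c p‖ * ‖w y‖) =o[𝓝 p] fun y => (1 : ℝ) * ‖y - p‖ :=
      ho.norm_left.mul_isBigO hO.norm_norm
    have h5 := h3.trans_isLittleO h4
    simpa [h0] using h5
  simpa using (h1.add h2).congr_of_eventuallyEq (f₁ := fun y => c y (w y))
    (Filter.Eventually.of_forall fun y => by simp)

end Apply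

/-! ### Levi-Civita connections and curvature on an open set of a vector space -/

section LeviCivita

variable {E : Type} [NormedAddCommGroup E] [NormedSpace ℝ E]

/-- The curvature `R(a, b) c` of the connection with Christoffel map `Γ`. -/
def curv (Γ : E → E →L[ℝ] E →L[ℝ] E) (y a b c : E) : E :=
  fderiv ℝ Γ y a b c - fderiv ℝ Γ y b a c + Γ y a (Γ y b c) - Γ y b (Γ y a c)

/-- `Γ` is the Levi-Civita connection of the metric `B` on the open set `Ω`. -/
structure LeviCivita (B : E → E →L[ℝ] E →L[ℝ] ℝ) (Γ : E → E →L[ℝ] E →L[ℝ] E) (Ω : Set E) :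
    Prop where
  isOpen : IsOpen Ω
  contDiffB : ContDiffOn ℝ 2 B Ω
  contDiffΓ : ContDiffOn ℝ 1 Γ Ω
  symm : ∀ y ∈ Ω, ∀ u v, B y u v = B y v u
  pos : ∀ y ∈ Ω, ∀ v, v ≠ 0 → 0 < B y v v
  torsion : ∀ y ∈ Ω, ∀ u v, Γ y u v = Γ y v u
  compat : ∀ y ∈ Ω, ∀ a u v, fderiv ℝ B y a u v = B y (Γ y a u) v + B y u (Γ y a v)

namespace LeviCivita

variable {B : E → E →L[ℝ] E →L[ℝ] ℝ} {Γ : E → E →L[ℝ] E →L[ℝ] E} {Ω : Set E}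

theorem mono (h : LeviCivita B Γ Ω) {Ω' : Set E} (ho : IsOpen Ω') (hs : Ω' ⊆ Ω) :
    LeviCivita B Γ Ω' :=
  ⟨ho, h.contDiffB.mono hs, h.contDiffΓ.mono hs, fun y hy => h.symm y (hs hy),
    fun y hy => h.pos y (hs hy), fun y hy => h.torsion y (hs hy), fun y hy => h.compat y (hs hy)⟩

theorem contDiffAtB (h : LeviCivita B Γ Ω) {y : E} (hy : y ∈ Ω) : ContDiffAt ℝ 2 B y :=
  h.contDiffB.contDiffAt (h.isOpen.mem_nhds hy)

theorem diffB (h : LeviCivita B Γ Ω) {y : E} (hy : y ∈ Ω) : DifferentiableAt ℝ B y :=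
  (h.contDiffAtB hy).differentiableAt (by simp)

theorem diffΓ (h : LeviCivita B Γ Ω) {y : E} (hy : y ∈ Ω) : DifferentiableAt ℝ Γ y :=
  (h.contDiffΓ.contDiffAt (h.isOpen.mem_nhds hy)).differentiableAt (by simp)

theorem eq_zero_of_inner (h : LeviCivita B Γ Ω) {y : E} (hy : y ∈ Ω) {z : E}
    (hz : ∀ w, B y z w = 0) : z = 0 := by
  by_contra hne
  exact (h.pos y hy z hne).ne' (hz z)

/-- Compatibility for the three cyclic arrangements of u, v, w, combined by means of vanishing
torsion. It determines Γ from the first derivatives of B. -/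
theorem koszul (h : LeviCivita B Γ Ω) {y : E} (hy : y ∈ Ω) (u v w : E) :
    2 * B y (Γ y u v) w =
      fderiv ℝ B y u v w + fderiv ℝ B y v u w - fderiv ℝ B y w u v := by
  rw [h.compat y hy, h.compat y hy, h.compat y hy, h.torsion y hy v u, h.torsion y hy w u,
    h.torsion y hy w v, h.symm y hy (Γ y u w) v, h.symm y hy u (Γ y v w)]
  ring

theorem curv_swap (a b c y : E) : curv Γ y b a c = -curv Γ y a b c := by
  simp only [curv]
  abel

/-- With Γ and its derivative symmetric in the two lower slots, the terms of the cyclic sum cancel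
in pairs. -/
theorem bianchi (h : LeviCivita B Γ Ω) {y : E} (hy : y ∈ Ω) (a b c : E) :
    curv Γ y a b c + curv Γ y b c a + curv Γ y c a b = 0 := by
  have hs : ∀ a u v, fderiv ℝ Γ y a u v = fderiv ℝ Γ y a v u := by
    intro a u v
    rw [← fderiv_field_apply₂_const (h.diffΓ hy), ← fderiv_field_apply₂_const (h.diffΓ hy)]
    congr 1
    apply Filter.EventuallyEq.fderiv_eq
    filter_upwards [h.isOpen.mem_nhds hy] with z hz using h.torsion z hz u v
  simp only [curv]
  rw [hs a b c, hs b c a, hs c a b, h.torsion y hy b c, h.torsion y hy a c, h.torsion y hy b a]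
  abel

/-- Differentiating the compatibility identity once more expresses the second derivative of B
through Γ; since second derivatives commute, its antisymmetrization in a and b vanishes, and what
remains is the curvature acting on both slots of B. -/
theorem curv_antisymm (h : LeviCivita B Γ Ω) {y : E} (hy : y ∈ Ω) (a b u v : E) :
    B y (curv Γ y a b u) v = -B y u (curv Γ y a b v) := by
  have hB2 : DifferentiableAt ℝ (fderiv ℝ B) y :=
    ((h.contDiffAtB hy).fderiv_right (m := 1) (by norm_num)).differentiableAt (by simp)
  have key : ∀ a b, fderiv ℝ (fderiv ℝ B) y a b u v =
      B y (Γ y a (Γ y b u)) v + B y (Γ y b u) (Γ y a v) + B y (fderiv ℝ Γ y a b u) v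
      + (B y (Γ y a u) (Γ y b v) + B y u (Γ y a (Γ y b v)) + B y u (fderiv ℝ Γ y a b v)) := by
    intro a b
    have e1 : fderiv ℝ (fderiv ℝ B) y a b u v = fderiv ℝ (fun z => fderiv ℝ B z b u v) y a := by
      rw [fderiv_field_apply_const (T := fun z => fderiv ℝ B z b u) ((hB2.clm_apply
        (differentiableAt_const b)).clm_apply (differentiableAt_const u)),
        fderiv_field_apply₂_const hB2]
    have e2 : (fun z => fderiv ℝ B z b u v) =ᶠ[𝓝 y]
        fun z => B z (Γ z b u) v + B z u (Γ z b v) := by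
      filter_upwards [h.isOpen.mem_nhds hy] with z hz using h.compat z hz b u v
    have d : ∀ w, DifferentiableAt ℝ (fun z => Γ z b w) y := fun w =>
      ((h.diffΓ hy).clm_apply (differentiableAt_const b)).clm_apply (differentiableAt_const w)
    rw [e1, e2.fderiv_eq, fderiv_fun_add
      (((h.diffB hy).clm_apply (d u)).clm_apply (differentiableAt_const v))
      (((h.diffB hy).clm_apply (differentiableAt_const u)).clm_apply (d v))]
    rw [add_apply, fderiv_field_apply₂ (h.diffB hy) (d u) (differentiableAt_const v),
      fderiv_field_apply₂ (h.diffB hy) (differentiableAt_const u) (d v),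
      fderiv_field_apply₂_const (h.diffΓ hy), fderiv_field_apply₂_const (h.diffΓ hy),
      h.compat y hy, h.compat y hy]
    simp
  have hsym : fderiv ℝ (fderiv ℝ B) y a b = fderiv ℝ (fderiv ℝ B) y b a :=
    ((h.contDiffAtB hy).isSymmSndFDerivAt (by simp)) a b
  have h3 := key a b
  rw [hsym, key b a] at h3
  simp only [curv, map_add, map_sub, add_apply, sub_apply]
  linarith

/-- The fully covariant curvature `(a, b, c, d) ↦ g(R(a, b) d, c)` has the pair symmetry. -/
theorem curv_pair (h : LeviCivita B Γ Ω) {y : E} (hy : y ∈ Ω) (a b c d : E) :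
    B y (curv Γ y a b d) c = B y (curv Γ y c d b) a := by
  have an : ∀ a b u v, B y (curv Γ y a b u) v = -B y (curv Γ y a b v) u := fun a b u v => by
    rw [h.curv_antisymm hy, h.symm y hy]
  have sw : ∀ a b u v, B y (curv Γ y a b u) v = -B y (curv Γ y b a u) v := fun a b u v => by
    rw [curv_swap]; simp
  have bi : ∀ a b c v, B y (curv Γ y a b c) v + B y (curv Γ y b c a) v
      + B y (curv Γ y c a b) v = 0 := fun a b c v => by
    have := congrArg (fun z => B y z v) (h.bianchi hy a b c)
    simpa using this
  -- The classical argument: the four cyclic identities for a, b, c, d are combined, and the two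
  -- antisymmetries identify the terms that do not cancel.
  linarith [bi a b c d, bi b c d a, bi c d a b, bi d a b c, an a b c d, an a b d c, sw a b c d,
    sw b c a d, sw c a b d, an b c a d, an c a b d, an c d a b, an d b c a, sw d b c a, sw b d c a,
    sw c d b a, an a c d b, sw a c d b, an d a b c, sw d a b c, an b d a c, sw b d a c,
    an c d b a, an b c d a, an d b a c, an a d b c, an a d c b, sw a d c b, sw b c d a, sw d a c b]

end LeviCivita

/-! ### Change of coordinates -/

section Transform

variable {B B' : E → E →L[ℝ] E →L[ℝ] ℝ} {Γ Γ' : E → E →L[ℝ] E →L[ℝ] E} {Ω Ω' : Set E}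
  {φ : E → E}

theorem LeviCivita.fderiv_injective (h' : LeviCivita B' Γ' Ω')
    (hB : ∀ y ∈ Ω', ∀ u v, B' y u v = B (φ y) (fderiv ℝ φ y u) (fderiv ℝ φ y v)) {y : E}
    (hy : y ∈ Ω') : Function.Injective (fderiv ℝ φ y) := by
  rw [injective_iff_map_eq_zero]
  intro v hv
  apply h'.eq_zero_of_inner hy
  intro w
  rw [hB y hy, hv]
  simp

/-- Both sides have the same product with every vector dφ(w), by the Koszul formulas of the two
metrics and the chain rule for B'. Since dφ is injective, hence onto in finite dimension, these
products suffice. -/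
theorem LeviCivita.transform_christoffel [FiniteDimensional ℝ E] (h : LeviCivita B Γ Ω)
    (h' : LeviCivita B' Γ' Ω')
    (hφ : ContDiffOn ℝ 3 φ Ω') (hm : ∀ y ∈ Ω', φ y ∈ Ω)
    (hB : ∀ y ∈ Ω', ∀ u v, B' y u v = B (φ y) (fderiv ℝ φ y u) (fderiv ℝ φ y v))
    {y : E} (hy : y ∈ Ω') (u v : E) :
    fderiv ℝ φ y (Γ' y u v) =
      Γ (φ y) (fderiv ℝ φ y u) (fderiv ℝ φ y v) + fderiv ℝ (fderiv ℝ φ) y u v := by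
  have hφ2 : ContDiffAt ℝ 3 φ y := hφ.contDiffAt (h'.isOpen.mem_nhds hy)
  have dφ : DifferentiableAt ℝ φ y := hφ2.differentiableAt (by simp)
  have dJ : DifferentiableAt ℝ (fderiv ℝ φ) y :=
    (hφ2.fderiv_right (m := 2) (by norm_num)).differentiableAt (by simp)
  have hsym : ∀ a b, fderiv ℝ (fderiv ℝ φ) y a b = fderiv ℝ (fderiv ℝ φ) y b a :=
    hφ2.isSymmSndFDerivAt (by simp; norm_num)
  have key : ∀ a u v, fderiv ℝ B' y a u v =
      fderiv ℝ B (φ y) (fderiv ℝ φ y a) (fderiv ℝ φ y u) (fderiv ℝ φ y v)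
        + B (φ y) (fderiv ℝ (fderiv ℝ φ) y a u) (fderiv ℝ φ y v)
        + B (φ y) (fderiv ℝ φ y u) (fderiv ℝ (fderiv ℝ φ) y a v) := by
    intro a u v
    rw [← fderiv_field_apply₂_const (h'.diffB hy)]
    have e : (fun z => B' z u v) =ᶠ[𝓝 y]
        fun z => (fun x => B (φ x)) z (fderiv ℝ φ z u) (fderiv ℝ φ z v) := by
      filter_upwards [h'.isOpen.mem_nhds hy] with z hz using hB z hz u v
    have dBφ : HasFDerivAt (fun x => B (φ x)) ((fderiv ℝ B (φ y)).comp (fderiv ℝ φ y)) y :=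
      HasFDerivAt.comp (g := B) (f := φ) y (h.diffB (hm y hy)).hasFDerivAt dφ.hasFDerivAt
    rw [e.fderiv_eq, fderiv_field_apply₂ dBφ.differentiableAt
      (dJ.clm_apply (differentiableAt_const u)) (dJ.clm_apply (differentiableAt_const v)),
      fderiv_field_apply_const dJ, fderiv_field_apply_const dJ, dBφ.fderiv]
    rfl
  have hinj := h'.fderiv_injective hB hy
  have hsurj : Function.Surjective (fderiv ℝ φ y) :=
    (LinearMap.injective_iff_surjective (f := (fderiv ℝ φ y : E →ₗ[ℝ] E))).1 hinj
  rw [← sub_eq_zero]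
  apply h.eq_zero_of_inner (hm y hy)
  intro w
  obtain ⟨w, rfl⟩ := hsurj w
  have k' := h'.koszul hy u v w
  rw [hB y hy, key, key, key, hsym v u, hsym w u, hsym w v] at k'
  have k := h.koszul (hm y hy) (fderiv ℝ φ y u) (fderiv ℝ φ y v) (fderiv ℝ φ y w)
  have s1 := h.symm _ (hm y hy) (fderiv ℝ φ y v) (fderiv ℝ (fderiv ℝ φ) y u w)
  simp only [map_sub, map_add, sub_apply, add_apply]
  linarith [s1]

/-- The transformation law of Γ is differentiated once more. The terms with second and third
derivatives of φ, which are symmetric, cancel on antisymmetrizing in a and b. -/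
theorem LeviCivita.transform_curv [FiniteDimensional ℝ E] (h : LeviCivita B Γ Ω)
    (h' : LeviCivita B' Γ' Ω')
    (hφ : ContDiffOn ℝ 3 φ Ω') (hm : ∀ y ∈ Ω', φ y ∈ Ω)
    (hB : ∀ y ∈ Ω', ∀ u v, B' y u v = B (φ y) (fderiv ℝ φ y u) (fderiv ℝ φ y v))
    {y : E} (hy : y ∈ Ω') (a b c : E) :
    fderiv ℝ φ y (curv Γ' y a b c) =
      curv Γ (φ y) (fderiv ℝ φ y a) (fderiv ℝ φ y b) (fderiv ℝ φ y c) := by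
  have hφ2 : ContDiffAt ℝ 3 φ y := hφ.contDiffAt (h'.isOpen.mem_nhds hy)
  have dφ : DifferentiableAt ℝ φ y := hφ2.differentiableAt (by simp)
  have cJ : ContDiffAt ℝ 2 (fderiv ℝ φ) y := hφ2.fderiv_right (by norm_num)
  have dJ : DifferentiableAt ℝ (fderiv ℝ φ) y := cJ.differentiableAt (by simp)
  have dJ2 : DifferentiableAt ℝ (fderiv ℝ (fderiv ℝ φ)) y :=
    (cJ.fderiv_right (m := 1) (by norm_num)).differentiableAt (by simp)
  have hsym : ∀ a b, fderiv ℝ (fderiv ℝ φ) y a b = fderiv ℝ (fderiv ℝ φ) y b a :=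
    hφ2.isSymmSndFDerivAt (by simp; norm_num)
  have hsym3 : ∀ a b, fderiv ℝ (fderiv ℝ (fderiv ℝ φ)) y a b =
      fderiv ℝ (fderiv ℝ (fderiv ℝ φ)) y b a :=
    cJ.isSymmSndFDerivAt (by simp)
  have t := fun u v => h.transform_christoffel h' hφ hm hB hy u v
  have key : ∀ a b c, fderiv ℝ (fderiv ℝ φ) y a (Γ' y b c)
      + fderiv ℝ φ y (fderiv ℝ Γ' y a b c) =
      fderiv ℝ Γ (φ y) (fderiv ℝ φ y a) (fderiv ℝ φ y b) (fderiv ℝ φ y c)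
        + Γ (φ y) (fderiv ℝ (fderiv ℝ φ) y a b) (fderiv ℝ φ y c)
        + Γ (φ y) (fderiv ℝ φ y b) (fderiv ℝ (fderiv ℝ φ) y a c)
        + fderiv ℝ (fderiv ℝ (fderiv ℝ φ)) y a b c := by
    intro a b c
    have dΓbc : DifferentiableAt ℝ (fun z => Γ' z b c) y :=
      ((h'.diffΓ hy).clm_apply (differentiableAt_const b)).clm_apply (differentiableAt_const c)
    have e : (fun z => fderiv ℝ φ z (Γ' z b c)) =ᶠ[𝓝 y]
        fun z => (fun x => Γ (φ x)) z (fderiv ℝ φ z b) (fderiv ℝ φ z c)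
          + fderiv ℝ (fderiv ℝ φ) z b c := by
      filter_upwards [h'.isOpen.mem_nhds hy] with z hz
        using h.transform_christoffel h' hφ hm hB hz b c
    have dΓφ : HasFDerivAt (fun x => Γ (φ x)) ((fderiv ℝ Γ (φ y)).comp (fderiv ℝ φ y)) y :=
      HasFDerivAt.comp (g := Γ) (f := φ) y (h.diffΓ (hm y hy)).hasFDerivAt dφ.hasFDerivAt
    have l := fderiv_field_apply dJ dΓbc a
    rw [fderiv_field_apply₂_const (h'.diffΓ hy), e.fderiv_eq, fderiv_fun_add
      ((dΓφ.differentiableAt.clm_apply (dJ.clm_apply (differentiableAt_const b))).clm_apply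
        (dJ.clm_apply (differentiableAt_const c)))
      ((dJ2.clm_apply (differentiableAt_const b)).clm_apply (differentiableAt_const c)),
      add_apply, fderiv_field_apply₂ dΓφ.differentiableAt
      (dJ.clm_apply (differentiableAt_const b)) (dJ.clm_apply (differentiableAt_const c)),
      fderiv_field_apply_const dJ, fderiv_field_apply_const dJ, dΓφ.fderiv,
      fderiv_field_apply₂_const dJ2] at l
    rw [← l]
    rfl
  have k1 := eq_sub_of_add_eq' (key a b c)
  have k2 := eq_sub_of_add_eq' (key b a c)
  simp only [curv, map_add, map_sub, k1, k2, t, hsym b a, hsym3 b a, hsym a (Γ' y b c)]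
  simp only [hsym (Γ' y b c) a]
  abel

end Transform

end LeviCivita

/-! ### Hypersurfaces of class `C²` -/

section Immersion

open scoped RealInnerProductSpace

variable {E F : Type} [NormedAddCommGroup E] [NormedSpace ℝ E]
  [NormedAddCommGroup F] [InnerProductSpace ℝ F]

/-- If the `1`-form `η = ⟨du, v⟩` is differentiable at `p`, then `dη = -⟨du ∧ dv⟩` there, even
though `u` need not be twice differentiable. -/
theorem symm_fderiv_form {u v : E → F} {v' : E →L[ℝ] F} {p : E}
    (hu : ∀ᶠ y in 𝓝 p, DifferentiableAt ℝ u y) (hu' : ContinuousAt (fderiv ℝ u) p)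
    (hv : HasFDerivAt v v' p) {η : E → E →L[ℝ] ℝ}
    (hη : ∀ᶠ y in 𝓝 p, ∀ b, η y b = ⟪fderiv ℝ u y b, v y⟫) (hηd : DifferentiableAt ℝ η p)
    (a b : E) :
    fderiv ℝ η p a b - ⟪fderiv ℝ u p b, v' a⟫ = fderiv ℝ η p b a - ⟪fderiv ℝ u p a, v' b⟫ := by
  let c : E → F →L[ℝ] E →L[ℝ] ℝ := fun y =>
    ((ContinuousLinearMap.compL ℝ E F ℝ).flip (fderiv ℝ u y)).comp (innerSL ℝ)
  have hc : ContinuousAt c p :=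
    ((((ContinuousLinearMap.compL ℝ E F ℝ).flip).continuous.continuousAt).comp hu').clm_comp
      continuousAt_const
  have hcv : ∀ y f b, c y f b = ⟪fderiv ℝ u y b, f⟫ := fun y f b => by
    simp [c, real_inner_comm]
  -- Freezing v at p gives the function ⟨u, v p⟩ with derivative η - c (v - v p). The correction is
  -- a continuous factor times one vanishing at p, so it is differentiable at p; thus this function
  -- has a second derivative at p, which is symmetric.
  have hθ := hasFDerivAt_apply_of_eq_zero hc (hv.sub_const (v p)) (sub_self _)
  have hf : ∀ᶠ y in 𝓝 p, HasFDerivAt (fun y => ⟪u y, v p⟫) (η y - c y (v y - v p)) y := by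
    filter_upwards [hu, hη] with y hy hy2
    have := ((innerSL ℝ (v p)).hasFDerivAt).comp y hy.hasFDerivAt
    refine (this.congr_fderiv ?_).congr_of_eventuallyEq (Filter.Eventually.of_forall fun z => ?_)
    · ext b
      simp [hcv, hy2, inner_sub_right, real_inner_comm]
    · simp [real_inner_comm]
  have hs := second_derivative_symmetric_of_eventually hf (hηd.hasFDerivAt.sub hθ) a b
  simpa [hcv] using hs

/-- A continuous unit normal field along a field of hyperplanes inherits differentiability. -/
theorem hasFDerivAt_normal [FiniteDimensional ℝ E] [FiniteDimensional ℝ F] {J : E → E →L[ℝ] F} {J' : E →L[ℝ] E →L[ℝ] F}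
    {n : E → F} {p : E} {S : E →L[ℝ] E} (hJ : HasFDerivAt J J' p) (hn : ContinuousAt n p)
    (hunit : ∀ᶠ y in 𝓝 p, ⟪n y, n y⟫ = 1) (hnorm : ∀ᶠ y in 𝓝 p, ∀ v, ⟪J y v, n y⟫ = 0)
    (hspan : ∀ w, (∀ v, ⟪J p v, w⟫ = 0) → ⟪n p, w⟫ = 0 → w = 0)
    (hS : ∀ a v, ⟪J p (S a), J p v⟫ = ⟪J' a v, n p⟫) :
    HasFDerivAt n (-((J p).comp S)) p := by
  have h1 : ⟪n p, n p⟫ = 1 := hunit.self_of_nhds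
  have h0 : ∀ v, ⟪J p v, n p⟫ = 0 := hnorm.self_of_nhds
  let D : F →ₗ[ℝ] E →L[ℝ] ℝ :=
    { toFun := fun w => (innerSL ℝ w).comp (J p)
      map_add' := fun x y => by ext; simp [inner_add_left]
      map_smul' := fun r x => by ext; simp [inner_smul_left] }
  -- A vector is recovered, through the left inverse M, from its products with the tangent plane at
  -- p and with n p.
  let Λ : F →ₗ[ℝ] (E →L[ℝ] ℝ) × ℝ := D.prod (innerSL ℝ (n p) : F →ₗ[ℝ] ℝ)
  have hΛ : ∀ w, Λ w = ((innerSL ℝ w).comp (J p), ⟪n p, w⟫) := fun w => by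
    simp [Λ, D]
  have hker : LinearMap.ker Λ = ⊥ := by
    rw [LinearMap.ker_eq_bot']
    intro w hw
    rw [hΛ, Prod.mk_eq_zero] at hw
    refine hspan w (fun v => ?_) hw.2
    have := DFunLike.congr_fun hw.1 v
    simpa [real_inner_comm] using this
  obtain ⟨M₀, hM₀⟩ := LinearMap.exists_leftInverse_of_injective Λ hker
  let M : (E →L[ℝ] ℝ) × ℝ →L[ℝ] F := LinearMap.toContinuousLinearMap M₀
  have hM : ∀ w, M (Λ w) = w := fun w => DFunLike.congr_fun hM₀ w
  let c : E → (E →L[ℝ] F) →L[ℝ] E →L[ℝ] ℝ := fun y =>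
    ContinuousLinearMap.compL ℝ E F ℝ (innerSL ℝ (n y))
  have hc : ContinuousAt c p :=
    ((ContinuousLinearMap.compL ℝ E F ℝ).continuous.comp (innerSL ℝ).continuous).continuousAt.comp
      hn
  have hτ := (hasFDerivAt_apply_of_eq_zero hc (hJ.sub_const (J p)) (sub_self _)).neg
  -- The part of n y orthogonal to n p. Its products with the tangent plane at p are -⟨(J y - J p)
  -- v, n y⟩, and here n need only be continuous because J y - J p vanishes at p.
  let w : E → F := fun y => M (-(c y (J y - J p)), 0)
  have hw : HasFDerivAt w _ p :=
    (M.comp (ContinuousLinearMap.inl ℝ (E →L[ℝ] ℝ) ℝ)).hasFDerivAt.comp p hτ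
  have hw0 : w p = 0 := by
    have : (-(c p (J p - J p)), (0 : ℝ)) = 0 := by simp
    simp only [w, this, map_zero]
  have hwn : ∀ᶠ y in 𝓝 p, w y = n y - ⟪n p, n y⟫ • n p := by
    filter_upwards [hnorm] with y hy
    rw [← hM (n y - ⟪n p, n y⟫ • n p), hΛ]
    simp only [w]
    congr 2
    · ext v
      have := hy v
      have h0' := h0 v
      rw [real_inner_comm] at this h0'
      simp [c, inner_sub_right, inner_sub_left, this, inner_smul_left, h0']
    · rw [inner_sub_right, inner_smul_right, h1, mul_one, sub_self]
  -- Unit length gives the remaining component, with the positive root because ⟨n p, n y⟩ is near 1.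
  -- It contributes nothing to the derivative, since w p = 0.
  have hz : ∀ᶠ y in 𝓝 p, ⟪n p, n y⟫ = √(1 - ⟪w y, w y⟫) := by
    have hpos : ∀ᶠ y in 𝓝 p, 0 < ⟪n p, n y⟫ :=
      (((innerSL ℝ (n p)).continuous.continuousAt).comp hn).eventually
        (lt_mem_nhds (by rw [Function.comp_apply, innerSL_apply_apply, h1]; exact one_pos))
    filter_upwards [hwn, hpos, hunit] with y hy hy2 hy3
    rw [eq_comm, Real.sqrt_eq_iff_mul_self_eq_of_pos hy2, hy]
    simp only [inner_sub_left, inner_sub_right, inner_smul_left, inner_smul_right, hy3, h1,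
      real_inner_comm (n p) (n y)]
    simp
  have hq : HasFDerivAt (fun y => √(1 - ⟪w y, w y⟫)) (0 : E →L[ℝ] ℝ) p := by
    have h2 := ((hw.inner ℝ hw).const_sub 1).sqrt (by simp [hw0])
    refine h2.congr_fderiv ?_
    ext a
    simp [hw0]
  have hfin : HasFDerivAt (fun y => w y + √(1 - ⟪w y, w y⟫) • n p) _ p :=
    hw.add (hq.smul_const (n p))
  refine (hfin.congr_of_eventuallyEq ?_).congr_fderiv ?_
  · filter_upwards [hwn, hz] with y hy hy2
    rw [← hy2, hy]
    simp
  · ext a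
    have : -(J p (S a)) = M (Λ (-(J p (S a)))) := (hM _).symm
    simp only [neg_apply, ContinuousLinearMap.comp_apply]
    rw [this, hΛ]
    simp only [add_apply, ContinuousLinearMap.comp_apply, neg_apply, ContinuousLinearMap.inl_apply,
      ContinuousLinearMap.smulRight_apply, zero_apply, zero_smul, add_zero]
    congr 2
    · ext v
      simp [c, inner_neg_left, hS, real_inner_comm]
    · have := h0 (S a)
      rw [real_inner_comm] at this
      simp [this]

variable {B : E → E →L[ℝ] E →L[ℝ] ℝ} {Γ : E → E →L[ℝ] E →L[ℝ] E} {Ω : Set E} {X : E → F}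

/-- `X` is a `C²` immersion inducing the metric `B` on `Ω`. -/
structure IsometricImmersion (B : E → E →L[ℝ] E →L[ℝ] ℝ) (X : E → F) (Ω : Set E) : Prop where
  contDiff : ContDiffOn ℝ 2 X Ω
  isometric : ∀ y ∈ Ω, ∀ u v, ⟪fderiv ℝ X y u, fderiv ℝ X y v⟫ = B y u v

/-- The vector-valued second fundamental form. -/
def secondForm (Γ : E → E →L[ℝ] E →L[ℝ] E) (X : E → F) (y u v : E) : F :=
  fderiv ℝ (fderiv ℝ X) y u v - fderiv ℝ X y (Γ y u v)

namespace IsometricImmersion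

variable (h : LeviCivita B Γ Ω) (hX : IsometricImmersion B X Ω) {y : E} (hy : y ∈ Ω)
include h hX hy

theorem contDiffAt : ContDiffAt ℝ 2 X y := hX.contDiff.contDiffAt (h.isOpen.mem_nhds hy)

theorem contDiffAt_fderiv : ContDiffAt ℝ 1 (fderiv ℝ X) y :=
  (contDiffAt h hX hy).fderiv_right (by norm_num)

theorem diff : DifferentiableAt ℝ X y := (contDiffAt h hX hy).differentiableAt (by simp)

theorem diff_fderiv : DifferentiableAt ℝ (fderiv ℝ X) y :=
  (contDiffAt_fderiv h hX hy).differentiableAt (by simp)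

theorem fderiv2_symm (u v : E) :
    fderiv ℝ (fderiv ℝ X) y u v = fderiv ℝ (fderiv ℝ X) y v u :=
  (contDiffAt h hX hy).isSymmSndFDerivAt (by simp) u v

/-- The tangential part of the Hessian of X is the Levi-Civita connection: differentiating the
induced metric and inserting the result into the Koszul formula leaves one product of a second with
a first derivative. -/
theorem inner_fderiv2 (u v w : E) :
    ⟪fderiv ℝ (fderiv ℝ X) y u v, fderiv ℝ X y w⟫ = B y (Γ y u v) w := by
  have key : ∀ a u v, fderiv ℝ B y a u v =
      ⟪fderiv ℝ (fderiv ℝ X) y a u, fderiv ℝ X y v⟫ +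
        ⟪fderiv ℝ (fderiv ℝ X) y a v, fderiv ℝ X y u⟫ := by
    intro a u v
    rw [← fderiv_field_apply₂_const (h.diffB hy)]
    have e : (fun z => B z u v) =ᶠ[𝓝 y] fun z => ⟪fderiv ℝ X z u, fderiv ℝ X z v⟫ := by
      filter_upwards [h.isOpen.mem_nhds hy] with z hz using (hX.isometric z hz u v).symm
    have d : ∀ u, DifferentiableAt ℝ (fun z => fderiv ℝ X z u) y := fun u =>
      (diff_fderiv h hX hy).clm_apply (differentiableAt_const u)
    rw [e.fderiv_eq, fderiv_inner_apply ℝ (d u) (d v),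
      fderiv_field_apply_const (diff_fderiv h hX hy),
      fderiv_field_apply_const (diff_fderiv h hX hy),
      real_inner_comm (fderiv ℝ X y u), add_comm]
  have k := h.koszul hy u v w
  rw [key, key, key, fderiv2_symm h hX hy v u, fderiv2_symm h hX hy w u,
    fderiv2_symm h hX hy w v] at k
  linarith

theorem inner_secondForm (u v w : E) : ⟪secondForm Γ X y u v, fderiv ℝ X y w⟫ = 0 := by
  rw [secondForm, inner_sub_left, inner_fderiv2 h hX hy, hX.isometric y hy, sub_self]

theorem secondForm_symm (u v : E) : secondForm Γ X y u v = secondForm Γ X y v u := by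
  rw [secondForm, secondForm, fderiv2_symm h hX hy, h.torsion y hy]

theorem fderiv2_eq (u v : E) :
    fderiv ℝ (fderiv ℝ X) y u v = fderiv ℝ X y (Γ y u v) + secondForm Γ X y u v := by
  rw [secondForm]; abel

theorem inner_fderiv2_fderiv2 (a b c d : E) :
    ⟪fderiv ℝ (fderiv ℝ X) y a b, fderiv ℝ (fderiv ℝ X) y c d⟫ =
      B y (Γ y a b) (Γ y c d) + ⟪secondForm Γ X y a b, secondForm Γ X y c d⟫ := by
  conv_lhs => rw [fderiv2_eq h hX hy c d, inner_add_right, inner_fderiv2 h hX hy,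
    fderiv2_eq h hX hy a b, inner_add_left, real_inner_comm, inner_secondForm h hX hy, zero_add]

/-- Prepares the use of `symm_fderiv_form` with u the directional derivative of X along c. -/
theorem fderiv_apply_regular (c : E) :
    (∀ᶠ z in 𝓝 y, DifferentiableAt ℝ (fun z => fderiv ℝ X z c) z) ∧
      (∀ᶠ z in 𝓝 y, fderiv ℝ (fun z => fderiv ℝ X z c) z = (fderiv ℝ (fderiv ℝ X) z).flip c) ∧
      ContinuousAt (fderiv ℝ (fun z => fderiv ℝ X z c)) y := by
  have hu : ∀ᶠ z in 𝓝 y, DifferentiableAt ℝ (fun z => fderiv ℝ X z c) z := by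
    filter_upwards [h.isOpen.mem_nhds hy] with z hz
    exact (diff_fderiv h hX hz).clm_apply (differentiableAt_const c)
  have hue : ∀ᶠ z in 𝓝 y, fderiv ℝ (fun z => fderiv ℝ X z c) z =
      (fderiv ℝ (fderiv ℝ X) z).flip c := by
    filter_upwards [h.isOpen.mem_nhds hy] with z hz
    ext b
    rw [fderiv_field_apply_const (diff_fderiv h hX hz)]
    rfl
  have hu' : ContinuousAt (fderiv ℝ (fun z => fderiv ℝ X z c)) y := by
    have c2 : ContinuousAt (fderiv ℝ (fderiv ℝ X)) y :=
      ((contDiffAt_fderiv h hX hy).fderiv_right (m := 0) (by norm_num)).continuousAt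
    refine ContinuousAt.congr ?_ (Filter.EventuallyEq.symm hue)
    exact ((ContinuousLinearMap.flipₗᵢ ℝ E E F).continuous.continuousAt.comp c2).clm_apply
      continuousAt_const
  exact ⟨hu, hue, hu'⟩

/-- The Gauss equation. -/
theorem gauss (a b c d : E) :
    B y (curv Γ y a b c) d =
      ⟪secondForm Γ X y b c, secondForm Γ X y a d⟫
        - ⟪secondForm Γ X y a c, secondForm Γ X y b d⟫ := by
  have dJ := diff_fderiv h hX hy
  -- η(b) = ⟨∂_b ∂_c X, ∂_d X⟩ is differentiable because it can be written through B and Γ, although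
  -- ∂_b ∂_c X is merely continuous. The Gauss equation is the symmetry statement for u = ∂_c X and
  -- v = ∂_d X.
  let η : E → E →L[ℝ] ℝ := fun z => ((B z).flip d).comp ((Γ z).flip c)
  have hη1 : ∀ z b, η z b = B z (Γ z b c) d := fun z b => rfl
  have hηd : DifferentiableAt ℝ η y := by
    have d1 : DifferentiableAt ℝ (fun z => (B z).flip d) y :=
      (((ContinuousLinearMap.flipₗᵢ ℝ E E ℝ).toContinuousLinearEquiv.differentiableAt.comp y
        (h.diffB hy))).clm_apply (differentiableAt_const d)
    have d2 : DifferentiableAt ℝ (fun z => (Γ z).flip c) y :=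
      (((ContinuousLinearMap.flipₗᵢ ℝ E E E).toContinuousLinearEquiv.differentiableAt.comp y
        (h.diffΓ hy))).clm_apply (differentiableAt_const c)
    exact d1.clm_comp d2
  have hηf : ∀ a b, fderiv ℝ η y a b = B y (Γ y a (Γ y b c)) d + B y (Γ y b c) (Γ y a d)
      + B y (fderiv ℝ Γ y a b c) d := by
    intro a b
    rw [← fderiv_field_apply_const hηd]
    simp only [hη1]
    have d3 : DifferentiableAt ℝ (fun z => Γ z b c) y :=
      ((h.diffΓ hy).clm_apply (differentiableAt_const b)).clm_apply (differentiableAt_const c)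
    rw [fderiv_field_apply₂ (h.diffB hy) d3 (differentiableAt_const d),
      fderiv_field_apply₂_const (h.diffΓ hy), h.compat y hy]
    simp
  obtain ⟨hu, hue, hu'⟩ := fderiv_apply_regular h hX hy c
  have hv : HasFDerivAt (fun z => fderiv ℝ X z d) ((fderiv ℝ (fderiv ℝ X) y).flip d) y := by
    have := (dJ.clm_apply (differentiableAt_const d)).hasFDerivAt
    refine this.congr_fderiv ?_
    ext b
    rw [fderiv_field_apply_const dJ]
    rfl
  have hη : ∀ᶠ z in 𝓝 y, ∀ b, η z b = ⟪fderiv ℝ (fun z => fderiv ℝ X z c) z b, fderiv ℝ X z d⟫ := by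
    filter_upwards [h.isOpen.mem_nhds hy, hue] with z hz hz2 b
    rw [hz2, hη1, ContinuousLinearMap.flip_apply, inner_fderiv2 h hX hz]
  have w := symm_fderiv_form hu hu' hv hη hηd a b
  rw [hue.self_of_nhds, hηf, hηf] at w
  simp only [ContinuousLinearMap.flip_apply, inner_fderiv2_fderiv2 h hX hy] at w
  simp only [curv, map_add, map_sub, add_apply, sub_apply]
  linarith

theorem fderiv_injective : Function.Injective (fderiv ℝ X y) := by
  rw [injective_iff_map_eq_zero]
  intro v hv
  apply h.eq_zero_of_inner hy
  intro w
  rw [← hX.isometric y hy, hv, inner_zero_left]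

/-- The image of dX is a hyperplane, so its orthogonal complement is a line; n is a normalized
generator. -/
theorem exists_normal [FiniteDimensional ℝ E] [FiniteDimensional ℝ F]
    (hd : Module.finrank ℝ F = Module.finrank ℝ E + 1) :
    ∃ n : F, ⟪n, n⟫ = 1 ∧ (∀ v, ⟪fderiv ℝ X y v, n⟫ = 0) ∧
      ∀ w, (∀ v, ⟪fderiv ℝ X y v, w⟫ = 0) → w = ⟪n, w⟫ • n := by
  let R : Submodule ℝ F := LinearMap.range (fderiv ℝ X y : E →ₗ[ℝ] F)
  have hR : Module.finrank ℝ R = Module.finrank ℝ E :=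
    LinearMap.finrank_range_of_inj (fderiv_injective h hX hy)
  have h1 : Module.finrank ℝ Rᗮ = 1 := by
    have := R.finrank_add_finrank_orthogonal
    omega
  have hmem : ∀ w, w ∈ Rᗮ ↔ ∀ v, ⟪fderiv ℝ X y v, w⟫ = 0 := by
    intro w
    rw [Submodule.mem_orthogonal]
    constructor
    · intro hw v
      exact hw _ ⟨v, rfl⟩
    · rintro hw _ ⟨v, rfl⟩
      exact hw v
  obtain ⟨m, hm0, hm⟩ := finrank_eq_one_iff'.1 h1
  have hm0' : (m : F) ≠ 0 := by simpa using hm0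
  have hmn : ‖(m : F)‖ ≠ 0 := norm_ne_zero_iff.2 hm0'
  refine ⟨‖(m : F)‖⁻¹ • (m : F), ?_, fun v => ?_, fun w hw => ?_⟩
  · rw [inner_smul_left, inner_smul_right, real_inner_self_eq_norm_sq]
    simp only [conj_trivial]
    field_simp
  · rw [inner_smul_right, (hmem _).1 m.2 v, mul_zero]
  · obtain ⟨t, ht⟩ := hm ⟨w, (hmem w).2 hw⟩
    have ht' : t • (m : F) = w := congrArg Subtype.val ht
    rw [← ht', inner_smul_left, inner_smul_right, real_inner_self_eq_norm_sq, smul_smul]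
    simp only [conj_trivial]
    congr 1
    field_simp

end IsometricImmersion

end Immersion

/-! ### The frame system of a hypersurface -/

section Frame

open scoped RealInnerProductSpace

variable {E F V : Type} [NormedAddCommGroup E] [NormedSpace ℝ E]
  [NormedAddCommGroup F] [InnerProductSpace ℝ F] [NormedAddCommGroup V] [NormedSpace ℝ V]

/-- A solution of a linear total differential system which vanishes at a point vanishes nearby. -/
theorem eventually_eq_zero_of_linear_system {A : E → E →L[ℝ] V →L[ℝ] V} {Z : E → V} {p : E}
    (hA : ContinuousAt A p) (hZ : ∀ᶠ y in 𝓝 p, HasFDerivAt Z ((A y).flip (Z y)) y)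
    (h0 : Z p = 0) : ∀ᶠ y in 𝓝 p, Z y = 0 := by
  have hb : ∀ᶠ y in 𝓝 p, ‖A y‖ < ‖A p‖ + 1 :=
    hA.norm.eventually (gt_mem_nhds (lt_add_one _))
  obtain ⟨r, hr, hball⟩ := Metric.eventually_nhds_iff_ball.1 (hb.and hZ)
  filter_upwards [Metric.ball_mem_nhds p hr] with y hy
  have hmem : ∀ t ∈ Set.Icc (0 : ℝ) 1, p + t • (y - p) ∈ Metric.ball p r := by
    intro t ht
    rw [mem_ball_iff_norm, add_sub_cancel_left, norm_smul, Real.norm_of_nonneg ht.1]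
    rw [mem_ball_iff_norm] at hy
    nlinarith [norm_nonneg (y - p), ht.2]
  have hd : ∀ t ∈ Set.Icc (0 : ℝ) 1, HasDerivAt (fun t : ℝ => Z (p + t • (y - p)))
      (A (p + t • (y - p)) (y - p) (Z (p + t • (y - p)))) t := by
    intro t ht
    have h1 : HasDerivAt (fun t : ℝ => p + t • (y - p)) (y - p) t := by
      simpa using ((hasDerivAt_id t).smul_const (y - p)).const_add p
    have := (hball _ (hmem t ht)).2.comp_hasDerivAt t h1
    simpa [Function.comp_def] using this
  -- Along the segment from p to y the system is a linear ODE with zero initial value; K bounds its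
  -- coefficient.
  have hz := eq_zero_of_abs_deriv_le_mul_abs_self_of_eq_zero_right
    (f := fun t : ℝ => Z (p + t • (y - p))) (a := 0) (b := 1) (K := (‖A p‖ + 1) * ‖y - p‖)
    (fun t ht => (hd t ht).continuousAt.continuousWithinAt)
    (fun t ht => (hd t ⟨ht.1, ht.2.le⟩).hasDerivWithinAt) (by simpa using h0) (fun t ht => by
      refine ((A _ _).le_opNorm _).trans ?_
      gcongr
      refine ((A _).le_opNorm _).trans ?_
      gcongr
      exact (hball _ (hmem t ⟨ht.1, ht.2.le⟩)).1.le)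
  simpa using hz 1 ⟨zero_le_one, le_rfl⟩

variable (F) in
/-- The system `dX = W`, `dW = W Γ + χ N`, `dN = -W S` for a map `X`, its differential `W` and a
unit normal `N`. -/
def frameMap [FiniteDimensional ℝ E] [FiniteDimensional ℝ F] (γ : E →L[ℝ] E →L[ℝ] E)
    (χ : E →L[ℝ] E →L[ℝ] ℝ) (S : E →L[ℝ] E) :
    E →L[ℝ] (F × (E →L[ℝ] F) × F) →L[ℝ] (F × (E →L[ℝ] F) × F) :=
  LinearMap.toContinuousBilinearMap <| LinearMap.mk₂ ℝ
    (fun a Z => (Z.2.1 a, Z.2.1.comp (γ a) + (χ a).smulRight Z.2.2, -Z.2.1 (S a)))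
    (fun a a' Z => by
      ext <;> simp [add_smul]
      all_goals abel)
    (fun c a Z => by ext <;> simp [mul_smul])
    (fun a Z Z' => by
      ext <;> simp [smul_add]
      all_goals abel)
    (fun c a Z => by ext <;> simp [smul_comm c])

@[simp] theorem frameMap_apply [FiniteDimensional ℝ E] [FiniteDimensional ℝ F]
    (γ : E →L[ℝ] E →L[ℝ] E) (χ : E →L[ℝ] E →L[ℝ] ℝ) (S : E →L[ℝ] E) (a : E)
    (Z : F × (E →L[ℝ] F) × F) :
    frameMap F γ χ S a Z =
      (Z.2.1 a, Z.2.1.comp (γ a) + (χ a).smulRight Z.2.2, -Z.2.1 (S a)) := rfl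

/-- A metric with its connection, a positive definite form `χ` and its shape operator `S`. -/
structure ShapeData (B : E → E →L[ℝ] E →L[ℝ] ℝ) (Γ : E → E →L[ℝ] E →L[ℝ] E)
    (χ : E → E →L[ℝ] E →L[ℝ] ℝ) (S : E → E →L[ℝ] E) (Ω : Set E) : Prop
    extends LeviCivita B Γ Ω where
  contDiffχ : ContDiffOn ℝ 1 χ Ω
  contDiffS : ContDiffOn ℝ 1 S Ω
  symmχ : ∀ y ∈ Ω, ∀ u v, χ y u v = χ y v u
  posχ : ∀ y ∈ Ω, ∀ v, v ≠ 0 → 0 < χ y v v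
  shape : ∀ y ∈ Ω, ∀ a v, B y (S y a) v = χ y a v

variable {B : E → E →L[ℝ] E →L[ℝ] ℝ} {Γ : E → E →L[ℝ] E →L[ℝ] E}
  {χ : E → E →L[ℝ] E →L[ℝ] ℝ} {S : E → E →L[ℝ] E} {Ω : Set E} {X X' : E → F}

/-- The Gauss equation for `χ`. -/
def GaussEq (B : E → E →L[ℝ] E →L[ℝ] ℝ) (Γ : E → E →L[ℝ] E →L[ℝ] E)
    (χ : E → E →L[ℝ] E →L[ℝ] ℝ) (Ω : Set E) : Prop :=
  ∀ y ∈ Ω, ∀ a b c d, B y (curv Γ y a b c) d = χ y b c * χ y a d - χ y a c * χ y b d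

/-- `χ` is, up to sign, the only solution of the Gauss equation. -/
def GaussRigid (B : E → E →L[ℝ] E →L[ℝ] ℝ) (Γ : E → E →L[ℝ] E →L[ℝ] E)
    (χ : E → E →L[ℝ] E →L[ℝ] ℝ) (Ω : Set E) : Prop :=
  ∀ y ∈ Ω, ∀ h : E → E → ℝ, (∀ u v, h u v = h v u) →
    (∀ (r : ℝ) u v w, h (r • u + v) w = r * h u w + h v w) →
    (∀ a b c d, B y (curv Γ y a b c) d = h b c * h a d - h a c * h b d) →
    (∀ u v, h u v = χ y u v) ∨ (∀ u v, h u v = -χ y u v)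

/-- The Codazzi equation for `χ`. -/
def CodazziEq (Γ : E → E →L[ℝ] E →L[ℝ] E) (χ : E → E →L[ℝ] E →L[ℝ] ℝ) (Ω : Set E) : Prop :=
  ∀ y ∈ Ω, ∀ a b c, fderiv ℝ χ y a b c - χ y b (Γ y a c) = fderiv ℝ χ y b a c - χ y a (Γ y b c)

/-- `n` is a unit normal of `X` for which the second fundamental form is `χ`. -/
structure AdaptedNormal (Γ : E → E →L[ℝ] E →L[ℝ] E) (χ : E → E →L[ℝ] E →L[ℝ] ℝ) (X : E → F)
    (n : E → F) (Ω : Set E) : Prop where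
  unit : ∀ y ∈ Ω, ⟪n y, n y⟫ = 1
  normal : ∀ y ∈ Ω, ∀ v, ⟪fderiv ℝ X y v, n y⟫ = 0
  span : ∀ y ∈ Ω, ∀ w, (∀ v, ⟪fderiv ℝ X y v, w⟫ = 0) → w = ⟪n y, w⟫ • n y
  second : ∀ y ∈ Ω, ∀ u v, secondForm Γ X y u v = χ y u v • n y

variable [FiniteDimensional ℝ E] [FiniteDimensional ℝ F]

/-- The second fundamental form along any unit normal solves the Gauss equation, hence is ±χ, and
reversing the normal where the sign is - leaves +χ. The choice is made point by point; continuity of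
n is a consequence found later. -/
theorem exists_adaptedNormal (h : ShapeData B Γ χ S Ω) (hr : GaussRigid B Γ χ Ω)
    (hX : IsometricImmersion B X Ω) (hd : Module.finrank ℝ F = Module.finrank ℝ E + 1) :
    ∃ n : E → F, AdaptedNormal Γ χ X n Ω := by
  have hL := h.toLeviCivita
  have key : ∀ y, ∃ n : F, y ∈ Ω → ⟪n, n⟫ = 1 ∧ (∀ v, ⟪fderiv ℝ X y v, n⟫ = 0) ∧
      (∀ w, (∀ v, ⟪fderiv ℝ X y v, w⟫ = 0) → w = ⟪n, w⟫ • n) ∧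
      ∀ u v, secondForm Γ X y u v = χ y u v • n := by
    intro y
    by_cases hy : y ∈ Ω
    swap
    · exact ⟨0, fun h => absurd h hy⟩
    obtain ⟨n, h1, h2, h3⟩ := hX.exists_normal hL hy hd
    have hII : ∀ u v, secondForm Γ X y u v = ⟪n, secondForm Γ X y u v⟫ • n := fun u v =>
      h3 _ fun w => by rw [real_inner_comm, hX.inner_secondForm hL hy]
    have hc := hr y hy (fun u v => ⟪n, secondForm Γ X y u v⟫)
      (fun u v => by rw [hX.secondForm_symm hL hy])
      (fun r u v w => by
        simp only [secondForm, map_add, map_smul, add_apply, smul_apply, inner_sub_right,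
          inner_add_right, inner_smul_right]
        ring)
      (fun a b c d => by
        have i : ∀ u v w z, ⟪secondForm Γ X y u v, secondForm Γ X y w z⟫ =
            ⟪n, secondForm Γ X y u v⟫ * ⟪n, secondForm Γ X y w z⟫ := fun u v w z => by
          conv_lhs => rw [hII u v, inner_smul_left]
          rfl
        rw [hX.gauss hL hy, i, i])
    rcases hc with hc | hc
    · exact ⟨n, fun _ => ⟨h1, h2, h3, fun u v => by rw [← hc]; exact hII u v⟩⟩
    · refine ⟨-n, fun _ => ⟨by simpa using h1, fun v => by simp [h2], fun w hw => ?_,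
        fun u v => ?_⟩⟩
      · simpa using h3 w hw
      · conv_lhs => rw [hII u v, hc]
        simp
  choose n hn using key
  exact ⟨n, fun y hy => (hn y hy).1, fun y hy => (hn y hy).2.1, fun y hy => (hn y hy).2.2.1,
    fun y hy => (hn y hy).2.2.2⟩

/-- The Weingarten equation. Continuity of n comes first: n is II(u,u) divided by χ(u,u), which is
positive for a fixed u ≠ 0. Then `hasFDerivAt_normal` applies. -/
theorem AdaptedNormal.hasFDerivAt [Nontrivial E] {n : E → F} (hn : AdaptedNormal Γ χ X n Ω)
    (h : ShapeData B Γ χ S Ω) (hX : IsometricImmersion B X Ω) {y : E} (hy : y ∈ Ω) :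
    HasFDerivAt n (-((fderiv ℝ X y).comp (S y))) y := by
  have hL := h.toLeviCivita
  have hmem := h.isOpen.mem_nhds hy
  obtain ⟨u, hu⟩ := exists_ne (0 : E)
  have hcont : ContinuousAt n y := by
    have e : ∀ᶠ z in 𝓝 y, (χ z u u)⁻¹ • secondForm Γ X z u u = n z := by
      filter_upwards [hmem] with z hz
      rw [hn.second z hz, smul_smul, inv_mul_cancel₀ (h.posχ z hz u hu).ne', one_smul]
    refine ContinuousAt.congr ?_ e
    have c1 : ContinuousAt χ y := h.contDiffχ.continuousOn.continuousAt hmem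
    have c2 : ContinuousAt Γ y := (hL.diffΓ hy).continuousAt
    have c3 : ContinuousAt (fderiv ℝ X) y := (hX.contDiffAt_fderiv hL hy).continuousAt
    have c4 : ContinuousAt (fderiv ℝ (fderiv ℝ X)) y :=
      ((hX.contDiffAt_fderiv hL hy).fderiv_right (m := 0) (by norm_num)).continuousAt
    refine (((c1.clm_apply continuousAt_const).clm_apply continuousAt_const).inv₀
      (h.posχ y hy u hu).ne').smul ?_
    exact ((c4.clm_apply continuousAt_const).clm_apply continuousAt_const).sub
      (c3.clm_apply ((c2.clm_apply continuousAt_const).clm_apply continuousAt_const))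
  refine hasFDerivAt_normal (hX.diff_fderiv hL hy).hasFDerivAt hcont
    (Filter.eventually_of_mem hmem hn.unit) (Filter.eventually_of_mem hmem hn.normal)
    (fun w hw hw2 => ?_) fun a v => ?_
  · rw [hn.span y hy w hw, hw2, zero_smul]
  · rw [hX.isometric y hy, h.shape y hy, hX.fderiv2_eq hL hy, inner_add_left, hn.normal y hy,
      hn.second y hy, inner_smul_left, hn.unit y hy]
    simp

/-- This is `symm_fderiv_form` for u = ∂_c X, v = n and η = χ(·, c) = ⟨∂∂_c X, n⟩, with the
derivative of n taken from the Weingarten equation; no third derivative of X occurs. -/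
theorem AdaptedNormal.codazziEq [Nontrivial E] {n : E → F} (hn : AdaptedNormal Γ χ X n Ω)
    (h : ShapeData B Γ χ S Ω) (hX : IsometricImmersion B X Ω) : CodazziEq Γ χ Ω := by
  intro y hy a b c
  have hL := h.toLeviCivita
  have hmem := h.isOpen.mem_nhds hy
  have dχ : DifferentiableAt ℝ χ y := (h.contDiffχ.contDiffAt hmem).differentiableAt (by simp)
  have hηd : DifferentiableAt ℝ (fun z => (χ z).flip c) y :=
    ((ContinuousLinearMap.flipₗᵢ ℝ E E ℝ).toContinuousLinearEquiv.differentiableAt.comp y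
      dχ).clm_apply (differentiableAt_const c)
  have hηf : ∀ a b, fderiv ℝ (fun z => (χ z).flip c) y a b = fderiv ℝ χ y a b c := by
    intro a b
    rw [← fderiv_field_apply_const hηd, ← fderiv_field_apply₂_const dχ]
    rfl
  have hi : ∀ z ∈ Ω, ∀ u v, ⟪fderiv ℝ (fderiv ℝ X) z u v, n z⟫ = χ z u v := by
    intro z hz u v
    rw [hX.fderiv2_eq hL hz, inner_add_left, hn.normal z hz, hn.second z hz, inner_smul_left,
      hn.unit z hz]
    simp
  obtain ⟨hu, hue, hu'⟩ := hX.fderiv_apply_regular hL hy c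
  have hη : ∀ᶠ z in 𝓝 y, ∀ b, (χ z).flip c b = ⟪fderiv ℝ (fun z => fderiv ℝ X z c) z b, n z⟫ := by
    filter_upwards [hmem, hue] with z hz hz2 b
    rw [hz2, ContinuousLinearMap.flip_apply, ContinuousLinearMap.flip_apply, hi z hz]
  have w := symm_fderiv_form hu hu' (hn.hasFDerivAt h hX hy) hη hηd a b
  rw [hue.self_of_nhds, hηf, hηf] at w
  simp only [ContinuousLinearMap.flip_apply, neg_apply, ContinuousLinearMap.comp_apply,
    inner_neg_right, hX.inner_fderiv2 hL hy] at w
  rw [h.symm y hy _ (S y a), h.symm y hy _ (S y b), h.shape y hy, h.shape y hy] at w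
  linarith

theorem AdaptedNormal.hasFDerivAt_frame [Nontrivial E] {n : E → F} (hn : AdaptedNormal Γ χ X n Ω)
    (h : ShapeData B Γ χ S Ω) (hX : IsometricImmersion B X Ω) {y : E} (hy : y ∈ Ω) :
    HasFDerivAt (fun z => (X z, fderiv ℝ X z, n z))
      ((frameMap F (Γ y) (χ y) (S y)).flip (X y, fderiv ℝ X y, n y)) y := by
  have hL := h.toLeviCivita
  refine ((hX.diff hL hy).hasFDerivAt.prodMk ((hX.diff_fderiv hL hy).hasFDerivAt.prodMk
    (hn.hasFDerivAt h hX hy))).congr_fderiv ?_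
  ext a
  · simp
  · simp [hX.fderiv2_eq hL hy, hn.second y hy]
  · simp

theorem ShapeData.contDiffOn_frameMap (h : ShapeData B Γ χ S Ω) :
    ContDiffOn ℝ 1 (fun y => frameMap F (Γ y) (χ y) (S y)) Ω := by
  rw [contDiffOn_clm_apply]
  intro a
  rw [contDiffOn_clm_apply]
  rintro ⟨x, W, N⟩
  simp only [frameMap_apply]
  refine contDiffOn_const.prodMk (ContDiffOn.prodMk ?_ ?_)
  · have h1 : ContDiffOn ℝ 1 (fun y => Γ y a) Ω := h.contDiffΓ.clm_apply contDiffOn_const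
    have h2 : ContDiffOn ℝ 1 (fun y => χ y a) Ω := h.contDiffχ.clm_apply contDiffOn_const
    exact (contDiffOn_const.clm_comp h1).add (h2.smulRight contDiffOn_const)
  · exact (contDiffOn_const.clm_apply (h.contDiffS.clm_apply contDiffOn_const)).neg

/-- The affine isometries carrying one of two `C²` immersions to the other near a point. -/
theorem AdaptedNormal.exists_isometry [Nontrivial E] {n n' : E → F}
    (hd : Module.finrank ℝ F = Module.finrank ℝ E + 1)
    (hn : AdaptedNormal Γ χ X n Ω) (hn' : AdaptedNormal Γ χ X' n' Ω)
    (h : ShapeData B Γ χ S Ω) (hX : IsometricImmersion B X Ω) (hX' : IsometricImmersion B X' Ω)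
    {p : E} (hp : p ∈ Ω) : ∃ Ψ : F ≃ᵃⁱ[ℝ] F, ∀ᶠ y in 𝓝 p, X' y = Ψ (X y) := by
  have hL := h.toLeviCivita
  have frame : ∀ (X : E → F) (n : E → F), AdaptedNormal Γ χ X n Ω → IsometricImmersion B X Ω →
      ∃ Φ : (E × ℝ) ≃ₗ[ℝ] F, (∀ v s, Φ (v, s) = fderiv ℝ X p v + s • n p) ∧
        ∀ v s, ⟪Φ (v, s), Φ (v, s)⟫ = B p v v + s * s := by
    intro X n hn hX
    let Φ₀ : (E × ℝ) →ₗ[ℝ] F :=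
      (fderiv ℝ X p : E →ₗ[ℝ] F).coprod (LinearMap.toSpanSingleton ℝ F (n p))
    have h1 : ∀ v s, Φ₀ (v, s) = fderiv ℝ X p v + s • n p := fun v s => by
      simp [Φ₀]
    have h2 : ∀ v s, ⟪Φ₀ (v, s), Φ₀ (v, s)⟫ = B p v v + s * s := fun v s => by
      rw [h1, inner_add_left, inner_add_right, inner_add_right, hX.isometric p hp,
        inner_smul_left, inner_smul_right, inner_smul_right, inner_smul_left, hn.unit p hp,
        hn.normal p hp, real_inner_comm, hn.normal p hp]
      simp
    have hinj : Function.Injective Φ₀ := by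
      rw [injective_iff_map_eq_zero]
      rintro ⟨v, s⟩ h0
      have h3 := h2 v s
      rw [h0, inner_zero_left] at h3
      have hv : v = 0 := by
        by_contra hv
        nlinarith [h.pos p hp v hv, mul_self_nonneg s]
      subst hv
      have : s = 0 := by
        simp only [map_zero, zero_add] at h3
        exact mul_self_eq_zero.1 h3.symm
      rw [this]; rfl
    refine ⟨LinearMap.linearEquivOfInjective Φ₀ hinj (by simp [hd]), fun v s => ?_, fun v s => ?_⟩
    · simpa using h1 v s
    · simpa using h2 v s
  obtain ⟨Φ, hΦ1, hΦ2⟩ := frame X n hn hX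
  obtain ⟨Φ', hΦ1', hΦ2'⟩ := frame X' n' hn' hX'
  -- Q carries the frame (dX, n) at p to (dX', n') at p. It is isometric because both frames have
  -- the same Gram form B(v,v) + s².
  let Q : F ≃ₗᵢ[ℝ] F := ⟨Φ.symm.trans Φ', fun x => by
    obtain ⟨⟨v, s⟩, rfl⟩ := Φ.surjective x
    simp only [LinearEquiv.trans_apply, LinearEquiv.symm_apply_apply]
    rw [← sq_eq_sq₀ (norm_nonneg _) (norm_nonneg _), ← real_inner_self_eq_norm_sq,
      ← real_inner_self_eq_norm_sq, hΦ2, hΦ2']⟩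
  have hQ : ∀ v s, Q (fderiv ℝ X p v + s • n p) = fderiv ℝ X' p v + s • n' p := fun v s => by
    rw [← hΦ1, ← hΦ1']
    exact congrArg Φ' (Φ.symm_apply_apply _)
  let Qc : F →L[ℝ] F := (Q.toContinuousLinearEquiv : F →L[ℝ] F)
  have hQc : ∀ x, Qc x = Q x := fun x => rfl
  let c : F := X' p - Q (X p)
  refine ⟨Q.toAffineIsometryEquiv.trans (AffineIsometryEquiv.constVAdd ℝ F c), ?_⟩
  -- Applying Q to all the vectors commutes with the frame system, and the translation c enters only
  -- the X component, which is absent from the right-hand side. So the difference Z of the moved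
  -- first frame and the second solves the same system, and it vanishes at p.
  let 𝓛 : F × (E →L[ℝ] F) × F →L[ℝ] F × (E →L[ℝ] F) × F :=
    Qc.prodMap (((ContinuousLinearMap.compL ℝ E F F) Qc).prodMap Qc)
  let Z : E → F × (E →L[ℝ] F) × F := fun y =>
    (𝓛 (X y, fderiv ℝ X y, n y) + (c, 0, 0)) - (X' y, fderiv ℝ X' y, n' y)
  have hZd : ∀ᶠ y in 𝓝 p,
      HasFDerivAt Z ((frameMap F (Γ y) (χ y) (S y)).flip (Z y)) y := by
    filter_upwards [h.isOpen.mem_nhds hp] with y hy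
    refine (((𝓛.hasFDerivAt.comp y (hn.hasFDerivAt_frame h hX hy)).add_const (c, 0, 0)).sub
      (hn'.hasFDerivAt_frame h hX' hy)).congr_fderiv ?_
    ext a
    · simp [Z, 𝓛]
    · simp [Z, 𝓛, smul_sub]
      abel
    · simp [Z, 𝓛]
      abel
  have hZ0 : Z p = 0 := by
    have e1 : fderiv ℝ X' p = Qc.comp (fderiv ℝ X p) := by
      ext v
      simpa [hQc] using (hQ v 0).symm
    have e2 : n' p = Q (n p) := by
      simpa using (hQ 0 1).symm
    simp [Z, 𝓛, e1, e2, c, hQc]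
  have hA : ContinuousAt (fun y => frameMap F (Γ y) (χ y) (S y)) p :=
    (h.contDiffOn_frameMap (F := F)).continuousOn.continuousAt (h.isOpen.mem_nhds hp)
  filter_upwards [eventually_eq_zero_of_linear_system hA hZd hZ0] with y hy
  have := congrArg Prod.fst hy
  simp only [Z, 𝓛, Prod.fst_sub, Prod.fst_add, Prod.fst_zero] at this
  have := sub_eq_zero.1 this
  rw [← this]
  simp [hQc, add_comm]

/-- Differentiating the identity once shows that the linear parts agree on the tangent plane,
differentiating twice that they agree on χ(u,u) n and hence on n. These span F, and the value at one
point fixes the translation. -/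
theorem AdaptedNormal.isometry_unique [Nontrivial E] {n : E → F}
    (hn : AdaptedNormal Γ χ X n Ω)
    (h : ShapeData B Γ χ S Ω) (hX : IsometricImmersion B X Ω)
    {p : E} (hp : p ∈ Ω) {Ψ Ψ' : F ≃ᵃⁱ[ℝ] F} (he : ∀ᶠ y in 𝓝 p, Ψ (X y) = Ψ' (X y)) :
    Ψ = Ψ' := by
  have hL := h.toLeviCivita
  let L : (F ≃ᵃⁱ[ℝ] F) → F →L[ℝ] F := fun Ψ => Ψ.linearIsometryEquiv.toContinuousLinearEquiv
  have hL' : ∀ (Ψ : F ≃ᵃⁱ[ℝ] F) x y, Ψ x - Ψ y = L Ψ (x - y) := fun Ψ x y => by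
    have := Ψ.map_vsub x y
    simpa [L] using this.symm
  have hx : ∀ (Ψ : F ≃ᵃⁱ[ℝ] F) x, Ψ x = L Ψ x + Ψ 0 := fun Ψ x => by
    have := hL' Ψ x 0
    rw [sub_zero] at this
    rw [← this]; abel
  have hDx : ∀ (Ψ : F ≃ᵃⁱ[ℝ] F), ∀ y ∈ Ω,
      HasFDerivAt (fun z => Ψ (X z)) ((L Ψ).comp (fderiv ℝ X y)) y := fun Ψ y hy => by
    have := ((L Ψ).hasFDerivAt.comp y (hX.diff hL hy).hasFDerivAt).add_const (Ψ 0)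
    exact this.congr_of_eventuallyEq (Filter.Eventually.of_forall fun z => hx Ψ _)
  have h1 : ∀ᶠ y in 𝓝 p, (L Ψ).comp (fderiv ℝ X y) = (L Ψ').comp (fderiv ℝ X y) := by
    filter_upwards [he.eventually_nhds, h.isOpen.mem_nhds hp] with y hy hyΩ
    rw [← (hDx Ψ y hyΩ).fderiv, ← (hDx Ψ' y hyΩ).fderiv]
    exact Filter.EventuallyEq.fderiv_eq hy
  have hDD : ∀ (Ψ : F ≃ᵃⁱ[ℝ] F), HasFDerivAt (fun z => (L Ψ).comp (fderiv ℝ X z))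
      ((ContinuousLinearMap.compL ℝ E F F (L Ψ)).comp (fderiv ℝ (fderiv ℝ X) p)) p := fun Ψ =>
    (ContinuousLinearMap.compL ℝ E F F (L Ψ)).hasFDerivAt.comp p
      (hX.diff_fderiv hL hp).hasFDerivAt
  have h2 : ∀ u v, L Ψ (fderiv ℝ (fderiv ℝ X) p u v) = L Ψ' (fderiv ℝ (fderiv ℝ X) p u v) := by
    intro u v
    have := (hDD Ψ).fderiv.symm.trans ((Filter.EventuallyEq.fderiv_eq h1).trans (hDD Ψ').fderiv)
    exact DFunLike.congr_fun (DFunLike.congr_fun this u) v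
  have h3 : ∀ v, L Ψ (fderiv ℝ X p v) = L Ψ' (fderiv ℝ X p v) := fun v =>
    DFunLike.congr_fun h1.self_of_nhds v
  have h4 : L Ψ (n p) = L Ψ' (n p) := by
    obtain ⟨u, hu⟩ := exists_ne (0 : E)
    have := h2 u u
    rw [hX.fderiv2_eq hL hp, map_add, map_add, h3, add_left_cancel_iff, hn.second p hp, map_smul,
      map_smul] at this
    exact smul_right_injective F (h.posχ p hp u hu).ne' this
  have h5 : ∀ w, L Ψ w = L Ψ' w := by
    intro w
    have hdec : ∃ v, ∀ u, ⟪fderiv ℝ X p u, w - fderiv ℝ X p v⟫ = 0 := by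
      let R : Submodule ℝ F := LinearMap.range (fderiv ℝ X p : E →ₗ[ℝ] F)
      obtain ⟨_, ⟨v, rfl⟩, z, hz, hw⟩ := R.exists_add_mem_mem_orthogonal w
      refine ⟨v, fun u => ?_⟩
      rw [hw]
      simpa using hz _ ⟨u, rfl⟩
    obtain ⟨v, hv⟩ := hdec
    have := hn.span p hp _ hv
    rw [← sub_add_cancel w (fderiv ℝ X p v), map_add, map_add, h3, this, map_smul, map_smul, h4]
  have h6 : Ψ 0 = Ψ' 0 := by
    have := he.self_of_nhds
    rw [hx Ψ, hx Ψ', h5, add_left_cancel_iff] at this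
    exact this
  ext x
  rw [hx Ψ, hx Ψ', h5, h6]

end Frame

/-! ### Integrability of flat linear total differential systems -/

section Frobenius

open Set

variable {E V : Type} [NormedAddCommGroup E] [NormedSpace ℝ E]
  [NormedAddCommGroup V] [NormedSpace ℝ V]

theorem norm_le_of_norm_deriv_le {f f' : ℝ → V} {δ ε : ℝ} (hδ : 0 ≤ δ) (hε : 0 ≤ ε)
    (hf : ∀ t ∈ Icc (0 : ℝ) 1, HasDerivWithinAt f (f' t) (Icc 0 1) t) (h0 : ‖f 0‖ ≤ δ)
    (hb : ∀ t ∈ Icc (0 : ℝ) 1, ‖f' t‖ ≤ ‖f t‖ + ε) {t : ℝ} (ht : t ∈ Icc (0 : ℝ) 1) :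
    ‖f t‖ ≤ (δ + ε) * Real.exp 1 := by
  have h := norm_le_gronwallBound_of_norm_deriv_right_le (K := 1) (δ := δ) (ε := ε)
    (fun t ht => (hf t ht).continuousWithinAt)
    (fun t ht => (hf t ⟨ht.1, ht.2.le⟩).mono_of_mem_nhdsWithin (Icc_mem_nhdsGE_of_mem ht)) h0
    (fun t ht => by simpa using hb t ⟨ht.1, ht.2.le⟩) t ht
  rw [gronwallBound_of_K_ne_0 one_ne_zero] at h
  have e1 : Real.exp (1 * (t - 0)) ≤ Real.exp 1 := Real.exp_le_exp.2 (by linarith [ht.2])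
  have e2 : δ * Real.exp (1 * (t - 0)) ≤ δ * Real.exp 1 := by gcongr
  have e3 : ε / 1 * (Real.exp (1 * (t - 0)) - 1) ≤ ε * Real.exp 1 := by
    rw [div_one]; gcongr; linarith
  linarith

/-- One application of Picard–Lindelöf on the ball of radius ‖z‖ about z: there ‖x‖ ≤ 2‖z‖, so the
bound 1/2 keeps the speed at most ‖z‖ and the solution stays in the ball up to time 1. -/
theorem exists_linear_ode [CompleteSpace V] {A : ℝ → V →L[ℝ] V} (hA : ContinuousOn A (Icc 0 1))
    (hb : ∀ t ∈ Icc (0 : ℝ) 1, ‖A t‖ ≤ 1 / 2) (z : V) :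
    ∃ w : ℝ → V, w 0 = z ∧ ∀ t ∈ Icc (0 : ℝ) 1, HasDerivWithinAt w (A t (w t)) (Icc 0 1) t := by
  have hpl : IsPicardLindelof (fun t => A t) (⟨0, by simp⟩ : Icc (0 : ℝ) 1) z ‖z‖₊ 0 ‖z‖₊ 1 := by
    refine ⟨fun t ht => ?_, fun x _ => hA.clm_apply continuousOn_const, fun t ht x hx => ?_, ?_⟩
    · refine ((A t).lipschitz.weaken ?_).lipschitzOnWith
      have := hb t ht
      rw [← NNReal.coe_le_coe]
      simp only [coe_nnnorm, NNReal.coe_one]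
      linarith
    · have h1 : ‖x‖ ≤ 2 * ‖z‖ := by
        have := norm_sub_norm_le x z
        have h2 : ‖x - z‖ ≤ ‖z‖ := by simpa [dist_eq_norm] using hx
        linarith
      calc ‖A t x‖ ≤ ‖A t‖ * ‖x‖ := (A t).le_opNorm x
        _ ≤ 1 / 2 * (2 * ‖z‖) := by gcongr; exact hb t ht
        _ = _ := by simp
    · simp
  exact hpl.exists_eq_forall_mem_Icc_hasDerivWithinAt₀

/-- The system is integrated along each ray: w x t solves the linear ODE on t ↦ p + t x, and Z y = w
(y - p) 1. To see that dZ = A Z, the increment w y - w x is compared with t A(p + t x)(y - x)(w x).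
Flatness cancels the first-order part of the source in the ODE for the error, and Grönwall makes the
error o(‖y - x‖). Only C¹ coefficients are needed. -/
theorem exists_solution_of_flat [CompleteSpace V] [FiniteDimensional ℝ E]
    {A : E → E →L[ℝ] V →L[ℝ] V} {Ω : Set E} (hΩ : IsOpen Ω) (hA : ContDiffOn ℝ 1 A Ω)
    (flat : ∀ y ∈ Ω, ∀ a b z, fderiv ℝ A y a b z + A y b (A y a z)
      = fderiv ℝ A y b a z + A y a (A y b z)) {p : E} (hp : p ∈ Ω) (z₀ : V) :
    ∃ Z : E → V, Z p = z₀ ∧ ∀ᶠ y in 𝓝 p, HasFDerivAt Z ((A y).flip (Z y)) y := by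
  have dA : ∀ y ∈ Ω, DifferentiableAt ℝ A y := fun y hy =>
    (hA.contDiffAt (hΩ.mem_nhds hy)).differentiableAt (by simp)
  have cA : ContinuousOn (fderiv ℝ A) Ω := hA.continuousOn_fderiv_of_isOpen hΩ le_rfl
  obtain ⟨r₀, hr₀, hball⟩ := Metric.nhds_basis_closedBall.mem_iff.1 (hΩ.mem_nhds hp)
  have hK : IsCompact (Metric.closedBall p r₀) := isCompact_closedBall p r₀
  obtain ⟨K, hKb⟩ := hK.exists_bound_of_continuousOn (hA.continuousOn.mono hball)
  obtain ⟨L, hLb⟩ := hK.exists_bound_of_continuousOn (cA.mono hball)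
  have hK0 : 0 ≤ K := (norm_nonneg _).trans (hKb p (Metric.mem_closedBall_self hr₀.le))
  have hL0 : 0 ≤ L := (norm_nonneg _).trans (hLb p (Metric.mem_closedBall_self hr₀.le))
  have huc := hK.uniformContinuousOn_of_continuous (cA.mono hball)
  -- K r ≤ 1/2 makes the ray equations admissible for `exists_linear_ode`; r ≤ 1 simplifies later
  -- estimates.
  obtain ⟨r, hr, hrr, hr1, hrK⟩ : ∃ r : ℝ, 0 < r ∧ r ≤ r₀ ∧ r ≤ 1 ∧ K * r ≤ 1 / 2 := by
    refine ⟨min r₀ (min 1 (1 / (2 * (K + 1)))), by positivity, min_le_left _ _,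
      (min_le_right _ _).trans (min_le_left _ _), ?_⟩
    calc K * min r₀ (min 1 (1 / (2 * (K + 1)))) ≤ (K + 1) * (1 / (2 * (K + 1))) := by
          gcongr
          · linarith
          · exact (min_le_right _ _).trans (min_le_right _ _)
      _ = 1 / 2 := by field_simp
  have hsub : Metric.ball p r ⊆ Metric.closedBall p r₀ :=
    Metric.ball_subset_closedBall.trans (Metric.closedBall_subset_closedBall hrr)
  have hray : ∀ x : E, ‖x‖ < r → ∀ t ∈ Icc (0 : ℝ) 1, p + t • x ∈ Metric.ball p r := by
    intro x hx t ht
    rw [mem_ball_iff_norm, add_sub_cancel_left, norm_smul, Real.norm_of_nonneg ht.1]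
    nlinarith [norm_nonneg x, ht.2]
  have hAx : ∀ x : E, ‖x‖ < r → ∀ t ∈ Icc (0 : ℝ) 1, ‖A (p + t • x) x‖ ≤ 1 / 2 := by
    intro x hx t ht
    calc ‖A (p + t • x) x‖ ≤ ‖A (p + t • x)‖ * ‖x‖ := (A _).le_opNorm x
      _ ≤ K * r := by gcongr; exact hKb _ (hsub (hray x hx t ht))
      _ ≤ 1 / 2 := hrK
  have hline : ∀ (x : E) t, HasDerivAt (fun t : ℝ => p + t • x) x t := fun x t => by
    simpa using ((hasDerivAt_id t).smul_const x).const_add p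
  have hAt : ∀ x : E, ‖x‖ < r → ∀ t ∈ Icc (0 : ℝ) 1,
      HasDerivAt (fun t : ℝ => A (p + t • x)) (fderiv ℝ A (p + t • x) x) t := fun x hx t ht =>
    (dA _ (hball (hsub (hray x hx t ht)))).hasFDerivAt.comp_hasDerivAt t (hline x t)
  have hex : ∀ x : E, ∃ w : ℝ → V, ‖x‖ < r → w 0 = z₀ ∧ ∀ t ∈ Icc (0 : ℝ) 1,
      HasDerivWithinAt w (A (p + t • x) x (w t)) (Icc 0 1) t := by
    intro x
    by_cases hx : ‖x‖ < r
    · obtain ⟨w, hw⟩ := exists_linear_ode (A := fun t => A (p + t • x) x)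
        (fun t ht => ((hAt x hx t ht).continuousAt.clm_apply
          continuousAt_const).continuousWithinAt) (hAx x hx) z₀
      exact ⟨w, fun _ => hw⟩
    · exact ⟨0, fun h => absurd h hx⟩
  choose w hw using hex
  set e := Real.exp 1
  have he : 0 < e := Real.exp_pos 1
  have hbd : ∀ x : E, ‖x‖ < r → ∀ t ∈ Icc (0 : ℝ) 1, ‖w x t‖ ≤ ‖z₀‖ * e := by
    intro x hx t ht
    have := norm_le_of_norm_deriv_le (norm_nonneg z₀) le_rfl (hw x hx).2
      (by rw [(hw x hx).1]) (fun t ht => by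
        have h1 := (A (p + t • x) x).le_opNorm (w x t)
        have h2 := hAx x hx t ht
        nlinarith [norm_nonneg (w x t)]) ht
    simpa using this
  set M := ‖z₀‖ * e
  have hM : 0 ≤ M := by positivity
  have hLip : ∀ u ∈ Metric.ball p r, ∀ v ∈ Metric.ball p r, ‖A v - A u‖ ≤ L * ‖v - u‖ :=
    fun u hu v hv => (convex_ball p r).norm_image_sub_le_of_norm_fderiv_le
      (fun z hz => dA z (hball (hsub hz))) (fun z hz => hLb z (hsub hz)) hu hv
  -- the coefficients along two neighbouring rays
  have hco : ∀ x y : E, ‖x‖ < r → ‖y‖ < r → ∀ t ∈ Icc (0 : ℝ) 1,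
      ‖A (p + t • y) y - A (p + t • x) x‖ ≤ (L + K) * ‖y - x‖ := by
    intro x y hx hy t ht
    have e1 : A (p + t • y) y - A (p + t • x) x =
        (A (p + t • y) - A (p + t • x)) y + A (p + t • x) (y - x) := by
      simp
    have e2 := hLip _ (hray x hx t ht) _ (hray y hy t ht)
    have e3 : ‖p + t • y - (p + t • x)‖ ≤ ‖y - x‖ := by
      rw [add_sub_add_left_eq_sub, ← smul_sub, norm_smul, Real.norm_of_nonneg ht.1]
      nlinarith [norm_nonneg (y - x), ht.2]
    rw [e1]
    refine (norm_add_le _ _).trans ?_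
    rw [add_mul]
    refine add_le_add ?_ ?_
    · refine ((A _ - A _).le_opNorm y).trans ?_
      calc _ ≤ (L * ‖y - x‖) * 1 := by
            gcongr
            · exact e2.trans (by gcongr)
            · linarith
        _ = _ := mul_one _
    · exact ((A _).le_opNorm _).trans (by gcongr; exact hKb _ (hsub (hray x hx t ht)))
  -- Lipschitz constant of the ray solutions in the direction of the ray: coefficient variation L +
  -- K, bound M on the solutions, Grönwall factor e.
  set C := (L + K) * M * e
  have hC : 0 ≤ C := by positivity
  have hdiff : ∀ x y : E, ‖x‖ < r → ‖y‖ < r → ∀ t ∈ Icc (0 : ℝ) 1,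
      ‖w y t - w x t‖ ≤ C * ‖y - x‖ := by
    intro x y hx hy t ht
    have h1 := norm_le_of_norm_deriv_le (f := fun t => w y t - w x t) (δ := 0)
      (ε := (L + K) * ‖y - x‖ * M) le_rfl (by positivity)
      (fun t ht => ((hw y hy).2 t ht).sub ((hw x hx).2 t ht))
      (by rw [(hw x hx).1, (hw y hy).1]; simp) (fun t ht => by
        have e1 : A (p + t • y) y (w y t) - A (p + t • x) x (w x t) =
            A (p + t • y) y (w y t - w x t) + (A (p + t • y) y - A (p + t • x) x) (w x t) := by
          simp
        rw [e1]
        refine (norm_add_le _ _).trans (add_le_add ?_ ?_)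
        · have h1 := (A (p + t • y) y).le_opNorm (w y t - w x t)
          have h2 := hAx y hy t ht
          nlinarith [norm_nonneg (w y t - w x t)]
        · refine ((_ : V →L[ℝ] V).le_opNorm _).trans ?_
          gcongr
          · exact hco x y hx hy t ht
          · exact hbd x hx t ht) ht
    calc _ ≤ _ := h1
      _ = C * ‖y - x‖ := by simp only [C]; ring
  -- second order Taylor expansion of the coefficients, uniformly along the rays
  have htay : ∀ ε > 0, ∃ δ > 0, ∀ x y : E, ‖x‖ < r → ‖y‖ < r → ‖y - x‖ < δ →
      ∀ t ∈ Icc (0 : ℝ) 1,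
      ‖A (p + t • y) - A (p + t • x) - fderiv ℝ A (p + t • x) (t • (y - x))‖ ≤ ε * ‖y - x‖ := by
    intro ε hε
    obtain ⟨δ, hδ, hδu⟩ := Metric.uniformContinuousOn_iff.1 huc ε hε
    refine ⟨δ, hδ, fun x y hx hy hxy t ht => ?_⟩
    have e3 : p + t • y - (p + t • x) = t • (y - x) := by
      rw [add_sub_add_left_eq_sub, ← smul_sub]
    have e4 : ‖t • (y - x)‖ ≤ ‖y - x‖ := by
      rw [norm_smul, Real.norm_of_nonneg ht.1]
      nlinarith [norm_nonneg (y - x), ht.2]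
    have hu := hray x hx t ht
    have hv := hray y hy t ht
    have hs : Convex ℝ (Metric.ball p r ∩ Metric.ball (p + t • x) δ) :=
      (convex_ball _ _).inter (convex_ball _ _)
    have := hs.norm_image_sub_le_of_norm_fderiv_le' (f := A) (φ := fderiv ℝ A (p + t • x)) (C := ε)
      (fun z hz => dA z (hball (hsub hz.1))) (fun z hz => by
        have := hδu z (hsub hz.1) _ (hsub hu) hz.2
        rw [dist_eq_norm] at this
        exact this.le) ⟨hu, Metric.mem_ball_self hδ⟩
        (⟨hv, by rw [mem_ball_iff_norm, e3]; exact e4.trans_lt hxy⟩ :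
          p + t • y ∈ Metric.ball p r ∩ Metric.ball (p + t • x) δ)
    rw [e3] at this
    exact this.trans (by gcongr)
  have hmain : ∀ ε > 0, ∃ δ > 0, ∀ x y : E, ‖x‖ < r → ‖y‖ < r → ‖y - x‖ < δ →
      ‖w y 1 - w x 1 - A (p + x) (y - x) (w x 1)‖ ≤
        (((L + K) * C + L * M) * ‖y - x‖ + ε * M) * e * ‖y - x‖ := by
    intro ε hε
    obtain ⟨δ, hδ, hδt⟩ := htay ε hε
    refine ⟨δ, hδ, fun x y hx hy hxy => ?_⟩
    have hder : ∀ t ∈ Icc (0 : ℝ) 1, HasDerivWithinAt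
        (fun t => w y t - w x t - t • A (p + t • x) (y - x) (w x t))
        (A (p + t • y) y (w y t) - A (p + t • x) x (w x t)
          - (t • (fderiv ℝ A (p + t • x) x (y - x) (w x t)
              + A (p + t • x) (y - x) (A (p + t • x) x (w x t)))
            + (1 : ℝ) • A (p + t • x) (y - x) (w x t))) (Icc 0 1) t := by
      intro t ht
      have h1 : HasDerivWithinAt (fun t : ℝ => A (p + t • x) (y - x))
          (fderiv ℝ A (p + t • x) x (y - x)) (Icc 0 1) t := by
        simpa using ((hAt x hx t ht).clm_apply (hasDerivAt_const t (y - x))).hasDerivWithinAt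
      have h2 := h1.clm_apply ((hw x hx).2 t ht)
      exact (((hw y hy).2 t ht).sub ((hw x hx).2 t ht)).sub
        ((hasDerivWithinAt_id t (Icc (0 : ℝ) 1)).smul h2)
    have h1 := norm_le_of_norm_deriv_le
      (f := fun t => w y t - w x t - t • A (p + t • x) (y - x) (w x t)) (δ := 0)
      (ε := (((L + K) * C + L * M) * ‖y - x‖ + ε * M) * ‖y - x‖) le_rfl (by positivity) hder
      (by rw [(hw x hx).1, (hw y hy).1]; simp) (fun t ht => by
        have hΩt := hball (hsub (hray x hx t ht))
        have hfl := flat _ hΩt x (y - x) (w x t)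
        -- After flatness exchanges x and y - x in the bracket, the derivative of the error is the
        -- ray coefficient applied to the error plus three sources: two quadratic in ‖y - x‖ and one
        -- Taylor remainder of A.
        have e1 : A (p + t • y) y (w y t) - A (p + t • x) x (w x t)
          - (t • (fderiv ℝ A (p + t • x) x (y - x) (w x t)
              + A (p + t • x) (y - x) (A (p + t • x) x (w x t)))
            + (1 : ℝ) • A (p + t • x) (y - x) (w x t)) =
            A (p + t • x) x (w y t - w x t - t • A (p + t • x) (y - x) (w x t))
            + (A (p + t • y) y - A (p + t • x) x) (w y t - w x t)
            + (A (p + t • y) - A (p + t • x)) (y - x) (w x t)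
            + (A (p + t • y) - A (p + t • x) - fderiv ℝ A (p + t • x) (t • (y - x))) x
                (w x t) := by
          rw [hfl]
          simp only [map_sub, map_smul, sub_apply, smul_apply, smul_add, smul_sub, one_smul]
          abel
        have e3 : ‖p + t • y - (p + t • x)‖ ≤ ‖y - x‖ := by
          rw [add_sub_add_left_eq_sub, ← smul_sub, norm_smul, Real.norm_of_nonneg ht.1]
          nlinarith [norm_nonneg (y - x), ht.2]
        rw [e1]
        have b1 := (A (p + t • x) x).le_opNorm
          (w y t - w x t - t • A (p + t • x) (y - x) (w x t))
        have b1' := hAx x hx t ht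
        have b2 : ‖(A (p + t • y) y - A (p + t • x) x) (w y t - w x t)‖ ≤
            ((L + K) * ‖y - x‖) * (C * ‖y - x‖) := by
          refine ((_ : V →L[ℝ] V).le_opNorm _).trans ?_
          gcongr
          · exact hco x y hx hy t ht
          · exact hdiff x y hx hy t ht
        have b3 : ‖(A (p + t • y) - A (p + t • x)) (y - x) (w x t)‖ ≤
            L * ‖y - x‖ * ‖y - x‖ * M := by
          refine ((_ : V →L[ℝ] V).le_opNorm _).trans ?_
          gcongr
          · refine ((A _ - A _).le_opNorm _).trans ?_
            gcongr
            exact (hLip _ (hray x hx t ht) _ (hray y hy t ht)).trans (by gcongr)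
          · exact hbd x hx t ht
        have b4 : ‖(A (p + t • y) - A (p + t • x) - fderiv ℝ A (p + t • x) (t • (y - x))) x
            (w x t)‖ ≤ ε * ‖y - x‖ * 1 * M := by
          refine ((_ : V →L[ℝ] V).le_opNorm _).trans ?_
          gcongr
          · refine ((_ : E →L[ℝ] V →L[ℝ] V).le_opNorm _).trans ?_
            gcongr
            · exact hδt x y hx hy hxy t ht
            · linarith
          · exact hbd x hx t ht
        refine (norm_add_le _ _).trans ?_
        have n1 := norm_add_le (A (p + t • x) x (w y t - w x t - t • A (p + t • x) (y - x) (w x t))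
            + (A (p + t • y) y - A (p + t • x) x) (w y t - w x t))
            ((A (p + t • y) - A (p + t • x)) (y - x) (w x t))
        have n2 := norm_add_le (A (p + t • x) x
          (w y t - w x t - t • A (p + t • x) (y - x) (w x t)))
            ((A (p + t • y) y - A (p + t • x) x) (w y t - w x t))
        have n3 : ‖A (p + t • x) x‖ * ‖w y t - w x t - t • A (p + t • x) (y - x) (w x t)‖ ≤
            1 * ‖w y t - w x t - t • A (p + t • x) (y - x) (w x t)‖ := by
          gcongr; linarith
        linarith) (t := 1) ⟨zero_le_one, le_rfl⟩
    simp only [one_smul, zero_add] at h1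
    refine h1.trans (le_of_eq ?_)
    ring
  refine ⟨fun y => w (y - p) 1, ?_, ?_⟩
  · have h0 := hw 0 (by simpa using hr)
    -- The ray with direction 0 has zero velocity, so w 0 stays at z₀.
    have hconst := norm_le_of_norm_deriv_le (f := fun t => w 0 t - z₀) (f' := fun _ => 0) (δ := 0)
      (ε := 0) le_rfl le_rfl (fun t ht => by simpa using (h0.2 t ht).sub_const z₀)
      (by simp [h0.1]) (fun t _ => by simp) (t := 1) ⟨zero_le_one, le_rfl⟩
    simp only [add_zero, zero_mul] at hconst
    change w (p - p) 1 = z₀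
    rw [sub_self]
    exact sub_eq_zero.1 (norm_le_zero_iff.1 hconst)
  · filter_upwards [Metric.ball_mem_nhds p hr] with y hy
    have hy' : ‖y - p‖ < r := mem_ball_iff_norm.1 hy
    rw [hasFDerivAt_iff_isLittleO, Asymptotics.isLittleO_iff]
    intro c hc
    -- With this ε the Taylor part ε M e is at most c/2; nearness of z to y bounds the quadratic
    -- part by the other c/2.
    obtain ⟨δ, hδ, hδm⟩ := hmain (c / (2 * (M * e + 1))) (by positivity)
    have hlim : Filter.Tendsto (fun z => ((L + K) * C + L * M) * ‖z - y‖ * e) (𝓝 y) (𝓝 0) := by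
      have : Continuous fun z => ((L + K) * C + L * M) * ‖z - y‖ * e := by fun_prop
      simpa using this.tendsto y
    filter_upwards [Metric.ball_mem_nhds y hδ, Metric.isOpen_ball.mem_nhds hy,
      hlim.eventually (gt_mem_nhds (half_pos hc))] with z hz hz2 hz3
    have hz' : ‖z - y‖ < δ := mem_ball_iff_norm.1 hz
    have hz2' : ‖z - p‖ < r := mem_ball_iff_norm.1 hz2
    have := hδm (y - p) (z - p) hy' hz2' (by simpa using hz')
    simp only [sub_sub_sub_cancel_right, add_sub_cancel] at this
    refine this.trans ?_
    gcongr
    have h5 : c / (2 * (M * e + 1)) * M * e ≤ c / 2 := by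
      have : c / (2 * (M * e + 1)) * M * e = c / 2 * (M * e / (M * e + 1)) := by
        field_simp
      rw [this]
      refine mul_le_of_le_one_right (by positivity) ?_
      rw [div_le_one (by positivity)]
      linarith
    linarith

end Frobenius

/-! ### The local existence theorem for hypersurfaces -/

section Bonnet

open scoped RealInnerProductSpace

variable {E F V : Type} [NormedAddCommGroup E] [NormedSpace ℝ E]
  [NormedAddCommGroup F] [InnerProductSpace ℝ F] [NormedAddCommGroup V] [NormedSpace ℝ V]
  {B : E → E →L[ℝ] E →L[ℝ] ℝ} {Γ : E → E →L[ℝ] E →L[ℝ] E}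
  {χ : E → E →L[ℝ] E →L[ℝ] ℝ} {S : E → E →L[ℝ] E} {Ω : Set E}
  [FiniteDimensional ℝ E] [FiniteDimensional ℝ F]

/-- Bootstrapping dZ = A Z: Z is C¹ to begin with, and each regularity that Z shares with A passes
to dZ, until Z is one order better than A. -/
theorem isCkAlphaOn_of_linear_system {A : E → E →L[ℝ] V →L[ℝ] V} {Z : E → V} {m : ℕ} {α : ℝ≥0}
    (hα : α ≤ 1) (hΩ : IsOpen Ω) (hA : IsCkAlphaOn m α A Ω)
    (hZ : ∀ y ∈ Ω, HasFDerivAt Z ((A y).flip (Z y)) y) : IsCkAlphaOn (m + 1) α Z Ω := by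
  have hd : ∀ y ∈ Ω, DifferentiableAt ℝ Z y := fun y hy => (hZ y hy).differentiableAt
  have step : ∀ j ≤ m, IsCkAlphaOn j α Z Ω → IsCkAlphaOn (j + 1) α Z Ω := by
    intro j hj h
    refine (isCkAlphaOn_succ hΩ).2 ⟨hd, ?_⟩
    have hA' := (hA.of_le hα hΩ hj).clm_comp hΩ
      ((ContinuousLinearMap.flipₗᵢ ℝ E V V).toContinuousLinearEquiv :
        (E →L[ℝ] V →L[ℝ] V) →L[ℝ] V →L[ℝ] E →L[ℝ] V)
    exact (hA'.bilinear hα hΩ h (ContinuousLinearMap.id ℝ (V →L[ℝ] E →L[ℝ] V))).congr hΩ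
      fun y hy => (hZ y hy).fderiv
  have h0 : IsCkAlphaOn 0 α Z Ω := by
    refine isCkAlphaOn_of_contDiffOn hα hΩ ?_
    have hc : ContinuousOn Z Ω := fun y hy => (hd y hy).continuousAt.continuousWithinAt
    have hAc : ContinuousOn (fun y => (A y).flip) Ω :=
      (ContinuousLinearMap.flipₗᵢ ℝ E V V).continuous.comp_continuousOn hA.1.continuousOn
    rw [Nat.cast_add, Nat.cast_one, contDiffOn_succ_iff_fderiv_of_isOpen hΩ]
    refine ⟨fun y hy => (hd y hy).differentiableWithinAt, by simp, ?_⟩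
    rw [Nat.cast_zero, contDiffOn_zero]
    exact (hAc.clm_apply hc).congr fun y hy => (hZ y hy).fderiv
  have : ∀ j ≤ m, IsCkAlphaOn (j + 1) α Z Ω := by
    intro j
    induction j with
    | zero => exact fun h => step 0 h h0
    | succ j ih => exact fun h => step _ h (ih (by omega))
  exact this m le_rfl

variable (F) in
theorem isCkAlphaOn_frameMap {m : ℕ} {α : ℝ≥0} (hα : α ≤ 1) (hΩ : IsOpen Ω)
    (hΓ : IsCkAlphaOn m α Γ Ω) (hχ : IsCkAlphaOn m α χ Ω) (hS : IsCkAlphaOn m α S Ω) :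
    IsCkAlphaOn m α (fun y => frameMap F (Γ y) (χ y) (S y)) Ω := by
  refine isCkAlphaOn_clm hα hΩ fun a => isCkAlphaOn_clm hα hΩ ?_
  rintro ⟨x, W, N⟩
  simp only [frameMap_apply]
  refine (isCkAlphaOn_const hα hΩ _).prodMk hΩ (IsCkAlphaOn.prodMk hΩ (IsCkAlphaOn.add hΩ ?_ ?_) ?_)
  · exact (hΓ.clm_apply_const hΩ a).clm_comp hΩ (ContinuousLinearMap.compL ℝ E E F W)
  · exact (hχ.clm_apply_const hΩ a).clm_comp hΩ
      ((ContinuousLinearMap.smulRightL ℝ E F).flip N)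
  · exact (hS.clm_apply_const hΩ a).clm_comp hΩ (-W)

namespace ShapeData

variable (h : ShapeData B Γ χ S Ω) {y : E} (hy : y ∈ Ω)
include h hy

theorem diffχ : DifferentiableAt ℝ χ y :=
  (h.contDiffχ.contDiffAt (h.isOpen.mem_nhds hy)).differentiableAt (by simp)

theorem diffS : DifferentiableAt ℝ S y :=
  (h.contDiffS.contDiffAt (h.isOpen.mem_nhds hy)).differentiableAt (by simp)

theorem curv_eq (hG : GaussEq B Γ χ Ω) (a b c : E) :
    curv Γ y a b c = χ y b c • S y a - χ y a c • S y b := by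
  rw [← sub_eq_zero]
  apply h.eq_zero_of_inner hy
  intro d
  simp only [map_sub, map_smul, sub_apply, smul_apply, hG y hy, h.shape y hy, smul_eq_mul]
  ring

/-- The covariant derivatives of S and of χ correspond under lowering an index, so Codazzi for χ can
be read as Codazzi for S. -/
theorem fderiv_shape (a b v : E) :
    B y (Γ y a (S y b) + fderiv ℝ S y a b) v = fderiv ℝ χ y a b v - χ y b (Γ y a v) := by
  have e : (fun z => B z (S z b) v) =ᶠ[𝓝 y] fun z => χ z b v := by
    filter_upwards [h.isOpen.mem_nhds hy] with z hz using h.shape z hz b v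
  have d : DifferentiableAt ℝ (fun z => S z b) y :=
    (h.diffS hy).clm_apply (differentiableAt_const b)
  have h1 := fderiv_field_apply₂ (h.toLeviCivita.diffB hy) d (differentiableAt_const v) a
  rw [e.fderiv_eq, fderiv_field_apply₂_const (h.diffχ hy), fderiv_field_apply_const (h.diffS hy),
    h.compat y hy, h.shape y hy] at h1
  simp at h1
  simp only [map_add, add_apply]
  linarith

theorem codazzi_shape (hC : CodazziEq Γ χ Ω) (a b : E) :
    Γ y a (S y b) + fderiv ℝ S y a b = Γ y b (S y a) + fderiv ℝ S y b a := by
  rw [← sub_eq_zero]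
  apply h.eq_zero_of_inner hy
  intro v
  rw [map_sub, sub_apply, h.fderiv_shape hy, h.fderiv_shape hy, hC y hy a b v, sub_self]

variable (F) in
-- The X component uses vanishing torsion and symmetry of χ. In the W component the terms in W are
-- the Gauss equation and those in N the Codazzi equation. In the N component Codazzi for S handles
-- the terms in W, and the terms in N cancel because χ(a, S b) = B(S a, S b) is symmetric.
theorem flat_frameMap (hG : GaussEq B Γ χ Ω) (hC : CodazziEq Γ χ Ω) (a b : E)
    (Z : F × (E →L[ℝ] F) × F) :
    fderiv ℝ (fun y => frameMap F (Γ y) (χ y) (S y)) y a b Z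
        + frameMap F (Γ y) (χ y) (S y) b (frameMap F (Γ y) (χ y) (S y) a Z) =
      fderiv ℝ (fun y => frameMap F (Γ y) (χ y) (S y)) y b a Z
        + frameMap F (Γ y) (χ y) (S y) a (frameMap F (Γ y) (χ y) (S y) b Z) := by
  obtain ⟨x, W, N⟩ := Z
  have dA : DifferentiableAt ℝ (fun y => frameMap F (Γ y) (χ y) (S y)) y :=
    ((h.contDiffOn_frameMap (F := F)).contDiffAt (h.isOpen.mem_nhds hy)).differentiableAt (by simp)
  have key : ∀ a b, fderiv ℝ (fun y => frameMap F (Γ y) (χ y) (S y)) y a b (x, W, N) =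
      (0, W.comp (fderiv ℝ Γ y a b) + (fderiv ℝ χ y a b).smulRight N,
        -W (fderiv ℝ S y a b)) := by
    intro a b
    rw [← fderiv_field_apply₂_const dA]
    simp only [frameMap_apply]
    have d1 : HasFDerivAt (fun z => W.comp (Γ z b))
        ((ContinuousLinearMap.compL ℝ E E F W).comp ((fderiv ℝ Γ y).flip b)) y :=
      (ContinuousLinearMap.compL ℝ E E F W).hasFDerivAt.comp y
        (by simpa using (h.toLeviCivita.diffΓ hy).hasFDerivAt.clm_apply (hasFDerivAt_const b y))
    have d2 : HasFDerivAt (fun z => (χ z b).smulRight N)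
        (((ContinuousLinearMap.smulRightL ℝ E F).flip N).comp ((fderiv ℝ χ y).flip b)) y :=
      ((ContinuousLinearMap.smulRightL ℝ E F).flip N).hasFDerivAt.comp y
        (by simpa using (h.diffχ hy).hasFDerivAt.clm_apply (hasFDerivAt_const b y))
    have d3 : HasFDerivAt (fun z => W (S z b)) (W.comp ((fderiv ℝ S y).flip b)) y :=
      W.hasFDerivAt.comp y
        (by simpa using (h.diffS hy).hasFDerivAt.clm_apply (hasFDerivAt_const b y))
    have d := (hasFDerivAt_const (W b) y).prodMk ((d1.add d2).prodMk d3.neg)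
    refine (DFunLike.congr_fun d.fderiv a).trans ?_
    rfl
  rw [key, key]
  have hc := fun c => congrArg W (h.curv_eq hy hG a b c)
  have hs := congrArg W (h.codazzi_shape hy hC a b)
  have hx : χ y a (S y b) = χ y b (S y a) := by
    rw [← h.shape y hy, ← h.shape y hy, h.symm y hy]
  simp only [curv, map_add, map_sub, map_smul] at hc hs
  refine Prod.ext ?_ (Prod.ext ?_ ?_)
  · simp [h.torsion y hy a b, h.symmχ y hy a b]
  · ext c
    have hcod : (fderiv ℝ χ y a b c + χ y a (Γ y b c)) • N =
        (fderiv ℝ χ y b a c + χ y b (Γ y a c)) • N := by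
      congr 1
      linarith [hC y hy a b c]
    have h1 := hc c
    simp only [add_smul] at hcod
    simp only [Prod.fst_add, Prod.snd_add, add_apply, ContinuousLinearMap.comp_apply,
      ContinuousLinearMap.smulRight_apply, frameMap_apply, smul_neg]
    rw [← sub_eq_zero] at h1 hcod ⊢
    rw [← add_zero (0 : F)]
    nth_rewrite 1 [← h1]
    rw [← hcod]
    abel
  · simp only [Prod.snd_add, frameMap_apply, add_apply, ContinuousLinearMap.comp_apply,
      ContinuousLinearMap.smulRight_apply, hx]
    rw [← sub_eq_zero] at hs ⊢
    rw [← neg_eq_zero, ← hs]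
    abel

end ShapeData

variable (E) in
/-- The linear system satisfied by the deviation of the Gram matrix of a solution of the frame
system from its expected value. -/
def gramMap (γ : E →L[ℝ] E →L[ℝ] E) (c : E →L[ℝ] E →L[ℝ] ℝ) (s : E →L[ℝ] E) :
    E →L[ℝ] ((E →L[ℝ] E →L[ℝ] ℝ) × (E →L[ℝ] ℝ) × ℝ) →L[ℝ]
      ((E →L[ℝ] E →L[ℝ] ℝ) × (E →L[ℝ] ℝ) × ℝ) :=
  LinearMap.toContinuousBilinearMap <| LinearMap.mk₂ ℝ
    (fun a P => (P.1.comp (γ a) + (P.1.flip.comp (γ a)).flip + (c a).smulRight P.2.1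
        + ((c a).smulRight P.2.1).flip,
      P.2.1.comp (γ a) + P.2.2 • c a - P.1.flip (s a), -(2 * P.2.1 (s a))))
    (fun a a' P => by
      ext <;> simp [add_smul]
      all_goals ring)
    (fun r a P => by
      ext <;> simp [mul_smul]
      all_goals ring)
    (fun a P P' => by
      ext <;> simp [smul_add]
      all_goals ring)
    (fun r a P => by
      ext <;> simp
      all_goals ring)

theorem gramMap_apply (γ : E →L[ℝ] E →L[ℝ] E) (c : E →L[ℝ] E →L[ℝ] ℝ) (s : E →L[ℝ] E) (a : E)
    (P : (E →L[ℝ] E →L[ℝ] ℝ) × (E →L[ℝ] ℝ) × ℝ) :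
    gramMap E γ c s a P = (P.1.comp (γ a) + (P.1.flip.comp (γ a)).flip + (c a).smulRight P.2.1
        + ((c a).smulRight P.2.1).flip,
      P.2.1.comp (γ a) + P.2.2 • c a - P.1.flip (s a), -(2 * P.2.1 (s a))) := rfl

theorem ShapeData.continuousOn_gramMap (h : ShapeData B Γ χ S Ω) :
    ContinuousOn (fun y => gramMap E (Γ y) (χ y) (S y)) Ω := by
  have hΓ := h.contDiffΓ.continuousOn
  have hχ := h.contDiffχ.continuousOn
  have hS := h.contDiffS.continuousOn
  rw [continuousOn_clm_apply]
  intro a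
  rw [continuousOn_clm_apply]
  rintro ⟨P, Q, R⟩
  have h1 : ContinuousOn (fun y => Γ y a) Ω := hΓ.clm_apply continuousOn_const
  have h2 : ContinuousOn (fun y => χ y a) Ω := hχ.clm_apply continuousOn_const
  have h3 : ContinuousOn (fun y => S y a) Ω := hS.clm_apply continuousOn_const
  have h4 : ContinuousOn (fun y => (χ y a).smulRight Q) Ω :=
    ((ContinuousLinearMap.smulRightL ℝ E (E →L[ℝ] ℝ)).flip Q).continuous.comp_continuousOn h2
  have fl : Continuous fun b : E →L[ℝ] E →L[ℝ] ℝ => b.flip :=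
    (ContinuousLinearMap.flipₗᵢ ℝ E E ℝ).continuous
  simp only [gramMap_apply]
  refine ContinuousOn.prodMk ?_ (ContinuousOn.prodMk ?_ ?_)
  · exact (((continuousOn_const.clm_comp h1).add
      (fl.comp_continuousOn (continuousOn_const.clm_comp h1))).add h4).add
      (fl.comp_continuousOn h4)
  · exact ((continuousOn_const.clm_comp h1).add (h2.const_smul R)).sub
      (P.flip.continuous.comp_continuousOn h3)
  · exact (continuousOn_const.mul (Q.continuous.comp_continuousOn h3)).neg

/-- P collects ⟨W,W⟩ - B, ⟨N,W⟩ and ⟨N,N⟩ - 1. By the frame system, compatibility of B and B(S a, v)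
= χ(a, v), it satisfies the homogeneous linear system of `gramMap`; vanishing at p, it vanishes
nearby. -/
theorem ShapeData.gram_eventually (h : ShapeData B Γ χ S Ω) {p : E} (hp : p ∈ Ω)
    {Z : E → F × (E →L[ℝ] F) × F}
    (hZ : ∀ᶠ y in 𝓝 p, HasFDerivAt Z ((frameMap F (Γ y) (χ y) (S y)).flip (Z y)) y)
    (h1 : ∀ u v, ⟪(Z p).2.1 u, (Z p).2.1 v⟫ = B p u v) (h2 : ∀ u, ⟪(Z p).2.1 u, (Z p).2.2⟫ = 0)
    (h3 : ⟪(Z p).2.2, (Z p).2.2⟫ = 1) :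
    ∀ᶠ y in 𝓝 p, ∀ u v, ⟪(Z y).2.1 u, (Z y).2.1 v⟫ = B y u v := by
  let ip : F →L[ℝ] F →L[ℝ] ℝ := innerSL ℝ
  let P : E → (E →L[ℝ] E →L[ℝ] ℝ) × (E →L[ℝ] ℝ) × ℝ := fun y =>
    (((ContinuousLinearMap.compL ℝ E F ℝ).flip (Z y).2.1).comp (ip.comp (Z y).2.1) - B y,
      (innerSL ℝ (Z y).2.2).comp (Z y).2.1, ⟪(Z y).2.2, (Z y).2.2⟫ - 1)
  have hP1 : ∀ y u v, (P y).1 u v = ⟪(Z y).2.1 u, (Z y).2.1 v⟫ - B y u v := fun y u v => rfl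
  have hP2 : ∀ y u, (P y).2.1 u = ⟪(Z y).2.2, (Z y).2.1 u⟫ := fun y u => rfl
  have hP3 : ∀ y, (P y).2.2 = ⟪(Z y).2.2, (Z y).2.2⟫ - 1 := fun y => rfl
  have hP0 : P p = 0 := by
    refine Prod.ext ?_ (Prod.ext ?_ ?_)
    · ext u v
      simp [hP1, h1]
    · ext u
      rw [hP2, real_inner_comm, h2]
      rfl
    · rw [hP3, h3, sub_self]
      rfl
  have hPd : ∀ᶠ y in 𝓝 p, HasFDerivAt P ((gramMap E (Γ y) (χ y) (S y)).flip (P y)) y := by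
    filter_upwards [hZ, h.isOpen.mem_nhds hp] with y hy hyΩ
    have hW : HasFDerivAt (fun z => (Z z).2.1) _ y := hy.snd.fst
    have hN : HasFDerivAt (fun z => (Z z).2.2) _ y := hy.snd.snd
    have hWa : ∀ a u, fderiv ℝ (fun z => (Z z).2.1 u) y a =
        (Z y).2.1 (Γ y a u) + χ y a u • (Z y).2.2 := by
      intro a u
      rw [fderiv_field_apply_const hW.differentiableAt, hW.fderiv]
      rfl
    have hNa : ∀ a, fderiv ℝ (fun z => (Z z).2.2) y a = -(Z y).2.1 (S y a) := by
      intro a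
      rw [hN.fderiv]
      rfl
    have dW : ∀ u, DifferentiableAt ℝ (fun z => (Z z).2.1 u) y := fun u =>
      hW.differentiableAt.clm_apply (differentiableAt_const u)
    have dN := hN.differentiableAt
    have dB := h.toLeviCivita.diffB hyΩ
    have d1 : DifferentiableAt ℝ (fun z => (P z).1) y := by
      refine DifferentiableAt.sub ?_ dB
      exact ((((ContinuousLinearMap.compL ℝ E F ℝ).flip).differentiableAt.comp y
        hW.differentiableAt).clm_comp
        ((differentiableAt_const ip).clm_comp hW.differentiableAt))
    have d2 : DifferentiableAt ℝ (fun z => (P z).2.1) y :=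
      (((innerSL ℝ).differentiableAt.comp y dN)).clm_comp hW.differentiableAt
    have d3 : DifferentiableAt ℝ (fun z => (P z).2.2) y := (dN.inner ℝ dN).sub_const 1
    refine (d1.hasFDerivAt.prodMk (d2.hasFDerivAt.prodMk d3.hasFDerivAt)).congr_fderiv ?_
    ext a u v
    · change fderiv ℝ (fun z => (P z).1) y a u v = _
      rw [← fderiv_field_apply₂_const d1]
      simp only [hP1]
      rw [fderiv_fun_sub ((dW u).inner ℝ (dW v)) ((dB.clm_apply (differentiableAt_const u)).clm_apply
        (differentiableAt_const v)), sub_apply, fderiv_inner_apply ℝ (dW u) (dW v), hWa, hWa,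
        fderiv_field_apply₂_const dB, h.compat y hyΩ]
      simp only [ContinuousLinearMap.flip_apply, gramMap_apply, add_apply,
        ContinuousLinearMap.comp_apply, ContinuousLinearMap.smulRight_apply, hP1, hP2,
        inner_add_left, inner_add_right, inner_smul_left, inner_smul_right, smul_apply,
        smul_eq_mul, conj_trivial]
      rw [real_inner_comm ((Z y).2.1 u) (Z y).2.2]
      ring
    · change fderiv ℝ (fun z => (P z).2.1) y a u = _
      rw [← fderiv_field_apply_const d2]
      simp only [hP2]
      rw [fderiv_inner_apply ℝ dN (dW u), hWa, hNa]
      simp only [ContinuousLinearMap.flip_apply, gramMap_apply, add_apply, sub_apply,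
        ContinuousLinearMap.comp_apply, hP1, hP2, hP3, inner_add_left, inner_add_right,
        inner_neg_left, inner_smul_right, smul_apply, smul_eq_mul]
      rw [real_inner_comm ((Z y).2.1 u) ((Z y).2.1 (S y a)), h.symm y hyΩ u, h.shape y hyΩ]
      ring
    · change fderiv ℝ (fun z => (P z).2.2) y a = _
      simp only [hP3]
      rw [fderiv_sub_const, fderiv_inner_apply ℝ dN dN, hNa]
      simp only [ContinuousLinearMap.flip_apply, gramMap_apply, hP2, inner_neg_left,
        inner_neg_right]
      rw [real_inner_comm (Z y).2.2 ((Z y).2.1 (S y a))]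
      ring
  have hA := h.continuousOn_gramMap.continuousAt (h.isOpen.mem_nhds hp)
  filter_upwards [eventually_eq_zero_of_linear_system hA hPd hP0] with y hy u v
  have := hP1 y u v
  rw [hy] at this
  simp at this
  linarith

/-- Local existence of a hypersurface with prescribed first and second fundamental forms. -/
theorem ShapeData.exists_immersion (h : ShapeData B Γ χ S Ω) (hG : GaussEq B Γ χ Ω)
    (hC : CodazziEq Γ χ Ω) {p : E} (hp : p ∈ Ω) {W₀ : E →L[ℝ] F} {n₀ : F}
    (h1 : ∀ u v, ⟪W₀ u, W₀ v⟫ = B p u v) (h2 : ∀ u, ⟪W₀ u, n₀⟫ = 0) (h3 : ⟪n₀, n₀⟫ = 1)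
    {m : ℕ} {α : ℝ≥0} (hα : α ≤ 1) (hΓ : IsCkAlphaOn m α Γ Ω) (hχ : IsCkAlphaOn m α χ Ω)
    (hS : IsCkAlphaOn m α S Ω) :
    ∃ X : E → F, ∃ Ω' ⊆ Ω, IsOpen Ω' ∧ p ∈ Ω' ∧ IsCkAlphaOn (m + 2) α X Ω' ∧
      ∀ y ∈ Ω', ∀ u v, ⟪fderiv ℝ X y u, fderiv ℝ X y v⟫ = B y u v := by
  obtain ⟨Z, hZ0, hZ⟩ := exists_solution_of_flat h.isOpen (h.contDiffOn_frameMap (F := F))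
    (fun y hy a b z => h.flat_frameMap F hy hG hC a b z) hp ((0 : F), W₀, n₀)
  have hgram := h.gram_eventually hp hZ (by simpa [hZ0] using h1) (by simpa [hZ0] using h2)
    (by simpa [hZ0] using h3)
  obtain ⟨O, hO, hOo, hpO⟩ := mem_nhds_iff.1
    ((hZ.and hgram).and (h.isOpen.mem_nhds hp) : ∀ᶠ y in 𝓝 p, _)
  have hOΩ : O ⊆ Ω := fun y hy => (hO hy).2
  have hZO : ∀ y ∈ O, HasFDerivAt Z ((frameMap F (Γ y) (χ y) (S y)).flip (Z y)) y := fun y hy =>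
    (hO hy).1.1
  -- Coefficients of class m give Z of class m + 1; since W is the derivative of X, the component X
  -- is then of class m + 2.
  have hreg : IsCkAlphaOn (m + 1) α Z O :=
    isCkAlphaOn_of_linear_system hα hOo
      (isCkAlphaOn_frameMap F hα hOo (hΓ.mono_set hOΩ) (hχ.mono_set hOΩ) (hS.mono_set hOΩ)) hZO
  have hX : ∀ y ∈ O, HasFDerivAt (fun z => (Z z).1) (Z y).2.1 y := fun y hy =>
    ((hZO y hy).fst).congr_fderiv (by ext; rfl)
  refine ⟨fun y => (Z y).1, O, hOΩ, hOo, hpO, (isCkAlphaOn_succ hOo).2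
    ⟨fun y hy => (hX y hy).differentiableAt, ?_⟩, fun y hy u v => ?_⟩
  · exact (hreg.clm_comp hOo ((ContinuousLinearMap.fst ℝ _ _).comp
      (ContinuousLinearMap.snd ℝ _ _))).congr hOo fun y hy => (hX y hy).fderiv
  · rw [(hX y hy).fderiv]
    exact (hO hy).1.2 u v

end Bonnet

/-! ### Curvature tensors in dimension three -/

section Algebra

open Matrix

/-- The algebraic symmetries of the Riemann tensor used in dimension three. -/
structure CurvLike (R : Fin 3 → Fin 3 → Fin 3 → Fin 3 → ℝ) : Prop where
  left : ∀ i j k l, R i j k l = -R j i k l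
  right : ∀ i j k l, R i j k l = -R i j l k

/-- The bilinear form on bivectors, in the basis `e₁ ∧ e₂, e₂ ∧ e₀, e₀ ∧ e₁`. -/
def bivectorForm (R : Fin 3 → Fin 3 → Fin 3 → Fin 3 → ℝ) : Matrix (Fin 3) (Fin 3) ℝ :=
  Matrix.of fun p q => R (p + 1) (p + 2) (q + 1) (q + 2)

theorem fin_three_pair (i j : Fin 3) :
    i = j ∨ ∃ p : Fin 3, (i = p + 1 ∧ j = p + 2) ∨ (i = p + 2 ∧ j = p + 1) := by
  revert i j; decide

theorem CurvLike.eq_of_bivectorForm {R T : Fin 3 → Fin 3 → Fin 3 → Fin 3 → ℝ} (hR : CurvLike R)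
    (hT : CurvLike T) (h : bivectorForm R = bivectorForm T) (i j k l : Fin 3) :
    R i j k l = T i j k l := by
  have h0 : ∀ p q, R (p + 1) (p + 2) (q + 1) (q + 2) = T (p + 1) (p + 2) (q + 1) (q + 2) :=
    fun p q => congrFun (congrFun h p) q
  have d1 : ∀ {R : Fin 3 → Fin 3 → Fin 3 → Fin 3 → ℝ}, CurvLike R → ∀ i k l, R i i k l = 0 :=
    fun hR i k l => by linarith [hR.left i i k l]
  have d2 : ∀ {R : Fin 3 → Fin 3 → Fin 3 → Fin 3 → ℝ}, CurvLike R → ∀ i j k, R i j k k = 0 :=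
    fun hR i j k => by linarith [hR.right i j k k]
  have h1 : ∀ p k l, R (p + 1) (p + 2) k l = T (p + 1) (p + 2) k l := by
    intro p k l
    rcases fin_three_pair k l with rfl | ⟨q, ⟨rfl, rfl⟩ | ⟨rfl, rfl⟩⟩
    · rw [d2 hR, d2 hT]
    · exact h0 p q
    · rw [hR.right, hT.right, h0]
  rcases fin_three_pair i j with rfl | ⟨p, ⟨rfl, rfl⟩ | ⟨rfl, rfl⟩⟩
  · rw [d1 hR, d1 hT]
  · exact h1 p k l
  · rw [hR.left, hT.left, h1]

/-- The contraction of a curvature tensor with a symmetric form, through its form on bivectors. -/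
theorem CurvLike.contraction {R : Fin 3 → Fin 3 → Fin 3 → Fin 3 → ℝ} (hR : CurvLike R)
    {H : Matrix (Fin 3) (Fin 3) ℝ} (hH : H.IsSymm) :
    H.det • (Matrix.of fun j l => ∑ i, ∑ k, H i k * R i j k l) =
      (H.adjugate * bivectorForm R).trace • H.adjugate
        - H.adjugate * (bivectorForm R)ᵀ * H.adjugate := by
  have d1 : ∀ i k l, R i i k l = 0 := fun i k l => by linarith [hR.left i i k l]
  have d2 : ∀ i j k, R i j k k = 0 := fun i j k => by linarith [hR.right i j k k]
  have s1 := hH.apply 0 1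
  have s2 := hH.apply 0 2
  have s3 := hH.apply 1 2
  have a1 : ∀ k l, R 1 0 k l = -R 0 1 k l := fun k l => hR.left 1 0 k l
  have a2 : ∀ k l, R 2 1 k l = -R 1 2 k l := fun k l => hR.left 2 1 k l
  have a3 : ∀ k l, R 0 2 k l = -R 2 0 k l := fun k l => hR.left 0 2 k l
  have b1 : ∀ k l, R k l 1 0 = -R k l 0 1 := fun k l => hR.right k l 1 0
  have b2 : ∀ k l, R k l 2 1 = -R k l 1 2 := fun k l => hR.right k l 2 1
  have b3 : ∀ k l, R k l 0 2 = -R k l 2 0 := fun k l => hR.right k l 0 2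
  have f00 : bivectorForm R 0 0 = R 1 2 1 2 := rfl
  have f01 : bivectorForm R 0 1 = R 1 2 2 0 := rfl
  have f02 : bivectorForm R 0 2 = R 1 2 0 1 := rfl
  have f10 : bivectorForm R 1 0 = R 2 0 1 2 := rfl
  have f11 : bivectorForm R 1 1 = R 2 0 2 0 := rfl
  have f12 : bivectorForm R 1 2 = R 2 0 0 1 := rfl
  have f20 : bivectorForm R 2 0 = R 0 1 1 2 := rfl
  have f21 : bivectorForm R 2 1 = R 0 1 2 0 := rfl
  have f22 : bivectorForm R 2 2 = R 0 1 0 1 := rfl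
  have hf := fun p q => congrFun (congrFun (Matrix.adjugate_fin_three H) p) q
  have g00 := hf 0 0
  have g01 := hf 0 1
  have g02 := hf 0 2
  have g10 := hf 1 0
  have g11 := hf 1 1
  have g12 := hf 1 2
  have g20 := hf 2 0
  have g21 := hf 2 1
  have g22 := hf 2 2
  simp at g00 g01 g02 g10 g11 g12 g20 g21 g22
  ext j l
  simp only [Matrix.smul_apply, Matrix.sub_apply, Matrix.mul_apply, Matrix.of_apply,
    Matrix.transpose_apply, Matrix.trace, Matrix.diag_apply, Fin.sum_univ_three, smul_eq_mul,
    Matrix.det_fin_three]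
  fin_cases j <;> fin_cases l <;>
    simp only [Fin.zero_eta, Fin.mk_one, Fin.reduceFinMk, g00, g01, g02, g10, g11, g12, g20, g21,
      g22, f00, f01, f02, f10, f11, f12, f20, f21, f22, d1, d2, a1, a2, a3, b1, b2, b3, s1, s2,
      s3] <;>
    ring

/-- In dimension three the Ricci tensor determines the Riemann tensor. With A = adj H, P the
bivector matrix and t = tr(A P), a vanishing contraction reads t A = A Pᵀ A. Cancelling A gives t 1
= A Pᵀ; taking traces, 3t = t, so t = 0 and P = 0. -/
theorem CurvLike.bivectorForm_eq_zero {R : Fin 3 → Fin 3 → Fin 3 → Fin 3 → ℝ} (hR : CurvLike R)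
    {H : Matrix (Fin 3) (Fin 3) ℝ} (hH : H.IsSymm) (hd : H.det ≠ 0)
    (h0 : ∀ j l, ∑ i, ∑ k, H i k * R i j k l = 0) : bivectorForm R = 0 := by
  have h1 := hR.contraction hH
  have h2 : (Matrix.of fun j l => ∑ i, ∑ k, H i k * R i j k l) = 0 := by
    ext j l
    exact h0 j l
  rw [h2, smul_zero, eq_comm, sub_eq_zero] at h1
  set t := (H.adjugate * bivectorForm R).trace with ht
  have h3 : t • (1 : Matrix (Fin 3) (Fin 3) ℝ) = H.adjugate * (bivectorForm R)ᵀ := by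
    have := congrArg (· * H) h1
    simp only [smul_mul_assoc, Matrix.mul_assoc, Matrix.adjugate_mul, mul_smul_comm,
      Matrix.mul_one] at this
    rw [smul_comm] at this
    exact smul_right_injective _ hd this
  have h4 : t = 0 := by
    have h5 : (H.adjugate * (bivectorForm R)ᵀ).trace = t := by
      have : H.adjugateᵀ = H.adjugate := by rw [Matrix.adjugate_transpose, hH]
      rw [← Matrix.trace_transpose, Matrix.transpose_mul, Matrix.transpose_transpose, this,
        Matrix.trace_mul_comm]
    have h6 := congrArg Matrix.trace h3
    rw [h5, Matrix.trace_smul, Matrix.trace_one] at h6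
    simp at h6
    linarith
  rw [h4, zero_smul] at h3
  have h7 := congrArg (H * ·) h3.symm
  simp only [← Matrix.mul_assoc, Matrix.mul_adjugate, Matrix.mul_zero, smul_mul_assoc,
    Matrix.one_mul] at h7
  have h8 : (bivectorForm R)ᵀ = 0 := by
    rcases smul_eq_zero.1 h7 with h | h
    · exact absurd h hd
    · exact h
  simpa using congrArg Matrix.transpose h8

/-- The right-hand side of the Gauss equation. -/
def gaussTensor (h : Matrix (Fin 3) (Fin 3) ℝ) (i j k l : Fin 3) : ℝ :=
  h i k * h j l - h i l * h j k

theorem curvLike_gaussTensor (h : Matrix (Fin 3) (Fin 3) ℝ) : CurvLike (gaussTensor h) :=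
  ⟨fun i j k l => by simp only [gaussTensor]; ring, fun i j k l => by simp only [gaussTensor]; ring⟩

/-- On bivectors the Gauss tensor consists of the 2×2 minors of h, and the cyclic basis absorbs the
cofactor signs. This turns the Gauss equation into an equation for the adjugate. -/
theorem bivectorForm_gaussTensor {h : Matrix (Fin 3) (Fin 3) ℝ} (hs : h.IsSymm) :
    bivectorForm (gaussTensor h) = h.adjugate := by
  have s1 := hs.apply 0 1
  have s2 := hs.apply 0 2
  have s3 := hs.apply 1 2
  have e1 : (1 : Fin 3) + 1 = 2 := rfl
  have e2 : (1 : Fin 3) + 2 = 0 := rfl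
  have e3 : (2 : Fin 3) + 1 = 0 := rfl
  have e4 : (2 : Fin 3) + 2 = 1 := rfl
  ext p q
  fin_cases p <;> fin_cases q <;>
    simp [bivectorForm, gaussTensor, Matrix.adjugate_fin_three, e1, e2, e3, e4, s1, s2, s3] <;> ring

/-- In dimension three the once-contracted Gauss equation is equivalent to the Gauss equation. -/
theorem CurvLike.contracted_gauss_iff {R : Fin 3 → Fin 3 → Fin 3 → Fin 3 → ℝ} (hR : CurvLike R)
    {H h : Matrix (Fin 3) (Fin 3) ℝ} (hH : H.IsSymm) (hd : H.det ≠ 0) :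
    (∀ j l, ∑ i, ∑ k, H i k * R i j k l =
      (∑ i, ∑ k, H i k * h i k) * h j l - ∑ i, ∑ k, H i k * h j k * h i l) ↔
      ∀ i j k l, R i j k l = gaussTensor h i j k l := by
  have hG := curvLike_gaussTensor h
  have hc : ∀ j l, ∑ i, ∑ k, H i k * gaussTensor h i j k l =
      (∑ i, ∑ k, H i k * h i k) * h j l - ∑ i, ∑ k, H i k * h j k * h i l := by
    intro j l
    simp only [Finset.sum_mul, ← Finset.sum_sub_distrib, gaussTensor]
    refine Finset.sum_congr rfl fun i _ => Finset.sum_congr rfl fun k _ => ?_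
    ring
  constructor
  · intro h1 i j k l
    have hD : CurvLike fun i j k l => R i j k l - gaussTensor h i j k l :=
      ⟨fun i j k l => by rw [hR.left i j, hG.left i j]; ring,
        fun i j k l => by rw [hR.right i j, hG.right i j]; ring⟩
    have := hD.bivectorForm_eq_zero hH hd fun j l => by
      simp only [mul_sub, Finset.sum_sub_distrib]
      rw [h1 j l, ← hc j l, sub_self]
    refine hR.eq_of_bivectorForm hG ?_ i j k l
    ext p q
    exact sub_eq_zero.1 (congrFun (congrFun this p) q)
  · intro h1 j l
    simp only [h1]
    exact hc j l

theorem CurvLike.gauss_iff {R : Fin 3 → Fin 3 → Fin 3 → Fin 3 → ℝ} (hR : CurvLike R)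
    {h : Matrix (Fin 3) (Fin 3) ℝ} (hs : h.IsSymm) :
    (∀ i j k l, R i j k l = gaussTensor h i j k l) ↔ bivectorForm R = h.adjugate := by
  rw [← bivectorForm_gaussTensor hs]
  constructor
  · intro h1
    ext p q
    exact h1 _ _ _ _
  · exact fun h1 => hR.eq_of_bivectorForm (curvLike_gaussTensor h) h1

/-! ### Inverting the adjugate on positive definite matrices -/

/-- The positive definite matrix with adjugate `P`. -/
def adjugateRoot (P : Matrix (Fin 3) (Fin 3) ℝ) : Matrix (Fin 3) (Fin 3) ℝ :=
  (√P.det)⁻¹ • P.adjugate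

theorem adjugate_adjugate_three (P : Matrix (Fin 3) (Fin 3) ℝ) :
    P.adjugate.adjugate = P.det • P := by
  rw [Matrix.adjugate_adjugate _ (by simp)]
  simp

/-- For 3×3 matrices adj is quadratic and adj (adj P) = (det P) P; the factor (det P)^(-1/2) enters
squared and cancels det P. -/
theorem adjugate_adjugateRoot {P : Matrix (Fin 3) (Fin 3) ℝ} (hP : P.PosDef) :
    (adjugateRoot P).adjugate = P := by
  have hd := hP.det_pos
  rw [adjugateRoot, Matrix.adjugate_smul, adjugate_adjugate_three, smul_smul]
  have : (√P.det)⁻¹ ^ (Fintype.card (Fin 3) - 1) * P.det = 1 := by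
    simp only [Fintype.card_fin, Nat.add_one_sub_one, inv_pow]
    rw [Real.sq_sqrt hd.le, inv_mul_cancel₀ hd.ne']
  rw [this, one_smul]

theorem posDef_adjugate {P : Matrix (Fin 3) (Fin 3) ℝ} (hP : P.PosDef) : P.adjugate.PosDef := by
  have hd := hP.det_pos
  have : P.adjugate = P.det • P⁻¹ := by
    rw [Matrix.inv_def, smul_smul, Ring.mul_inverse_cancel _ (isUnit_iff_ne_zero.2 hd.ne'),
      one_smul]
  rw [this]
  exact hP.inv.smul hd

theorem posDef_adjugateRoot {P : Matrix (Fin 3) (Fin 3) ℝ} (hP : P.PosDef) :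
    (adjugateRoot P).PosDef :=
  (posDef_adjugate hP).smul (inv_pos.2 (Real.sqrt_pos.2 hP.det_pos))

/-- From adj h = P follow adj P = (det h) h and det P = (det h)². So det h = ±√(det P), and its sign
is the only freedom. -/
theorem eq_adjugateRoot_or {P h : Matrix (Fin 3) (Fin 3) ℝ} (hP : P.PosDef)
    (hh : h.adjugate = P) : h = adjugateRoot P ∨ h = -adjugateRoot P := by
  have hd := hP.det_pos
  have h1 : P.adjugate = h.det • h := by rw [← hh, adjugate_adjugate_three]
  have h2 : P.det = h.det ^ 2 := by
    rw [← hh, Matrix.det_adjugate]; simp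
  have h3 : h.det ≠ 0 := by
    intro h0
    rw [h2, h0] at hd
    simp at hd
  rw [adjugateRoot, h1, h2, Real.sqrt_sq_eq_abs, smul_smul]
  rcases lt_or_gt_of_ne h3 with hn | hp
  · right
    rw [abs_of_neg hn, inv_neg, neg_mul, inv_mul_cancel₀ h3]
    simp
  · left
    rw [abs_of_pos hp, inv_mul_cancel₀ h3, one_smul]

/-- The cross product lists the components of u ∧ v in the basis used for `bivectorForm`. -/
theorem CurvLike.sum_eq_crossProduct {R : Fin 3 → Fin 3 → Fin 3 → Fin 3 → ℝ} (hR : CurvLike R)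
    (u v : Fin 3 → ℝ) :
    ∑ i, ∑ j, ∑ k, ∑ l, R i j k l * u i * v j * u k * v l =
      (u ⨯₃ v) ⬝ᵥ (bivectorForm R *ᵥ (u ⨯₃ v)) := by
  have d1 : ∀ i k l, R i i k l = 0 := fun i k l => by linarith [hR.left i i k l]
  have d2 : ∀ i j k, R i j k k = 0 := fun i j k => by linarith [hR.right i j k k]
  have a1 : ∀ k l, R 1 0 k l = -R 0 1 k l := fun k l => hR.left 1 0 k l
  have a2 : ∀ k l, R 2 1 k l = -R 1 2 k l := fun k l => hR.left 2 1 k l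
  have a3 : ∀ k l, R 0 2 k l = -R 2 0 k l := fun k l => hR.left 0 2 k l
  have b1 : ∀ k l, R k l 1 0 = -R k l 0 1 := fun k l => hR.right k l 1 0
  have b2 : ∀ k l, R k l 2 1 = -R k l 1 2 := fun k l => hR.right k l 2 1
  have b3 : ∀ k l, R k l 0 2 = -R k l 2 0 := fun k l => hR.right k l 0 2
  have e1 : (1 : Fin 3) + 1 = 2 := rfl
  have e2 : (1 : Fin 3) + 2 = 0 := rfl
  have e3 : (2 : Fin 3) + 1 = 0 := rfl
  have e4 : (2 : Fin 3) + 2 = 1 := rfl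
  simp only [Fin.sum_univ_three, d1, d2, a1, a2, a3, b1, b2, b3]
  simp [cross_apply, Matrix.vecHead, Matrix.vecTail, dotProduct, Matrix.mulVec,
    Fin.sum_univ_three, bivectorForm, e1, e2, e3, e4]
  ring

/-- Every bivector of ℝ³ is decomposable: for u ≠ 0 orthogonal to w, the double cross product u × (w
× u) equals (u·u) w. -/
theorem exists_crossProduct_eq (w : Fin 3 → ℝ) : ∃ u v : Fin 3 → ℝ, u ⨯₃ v = w := by
  obtain ⟨u, hu0, hu⟩ : ∃ u : Fin 3 → ℝ, u ⬝ᵥ u ≠ 0 ∧ u ⬝ᵥ w = 0 := by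
    by_cases h : w 0 = 0 ∧ w 1 = 0
    · exact ⟨![1, 0, 0], by simp [dotProduct, Fin.sum_univ_three],
        by simp [dotProduct, Fin.sum_univ_three, h.1]⟩
    · refine ⟨![-w 1, w 0, 0], ?_, ?_⟩
      · simp only [dotProduct, Fin.sum_univ_three]
        simp
        intro h0
        apply h
        constructor <;> nlinarith [mul_self_nonneg (w 0), mul_self_nonneg (w 1)]
      · simp [dotProduct, Fin.sum_univ_three]
        ring
  refine ⟨u, (u ⬝ᵥ u)⁻¹ • (w ⨯₃ u), ?_⟩
  have h1 : u ⨯₃ (w ⨯₃ u) = (u ⬝ᵥ u) • w - (u ⬝ᵥ w) • u := by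
    ext i
    fin_cases i <;> simp [cross_apply, dotProduct, Fin.sum_univ_three] <;> ring
  rw [map_smul, h1, hu, zero_smul, sub_zero, smul_smul, inv_mul_cancel₀ hu0, one_smul]

/-- Strict Cauchy–Schwarz: for a = ⟨u,u⟩ and b = ⟨u,v⟩, the square of a v - b u is a times the Gram
determinant. -/
theorem gram_det_pos {G : Matrix (Fin 3) (Fin 3) ℝ} (hG : G.PosDef) {u v : Fin 3 → ℝ}
    (h : LinearIndependent ℝ ![u, v]) :
    0 < (∑ i, ∑ j, G i j * u i * u j) * (∑ i, ∑ j, G i j * v i * v j)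
      - (∑ i, ∑ j, G i j * u i * v j) ^ 2 := by
  have hf : ∀ u v : Fin 3 → ℝ, ∑ i, ∑ j, G i j * u i * v j = u ⬝ᵥ (G *ᵥ v) := by
    intro u v
    simp only [dotProduct, Matrix.mulVec, Finset.mul_sum]
    refine Finset.sum_congr rfl fun i _ => Finset.sum_congr rfl fun j _ => ?_
    ring
  have hpos : ∀ w : Fin 3 → ℝ, w ≠ 0 → 0 < w ⬝ᵥ (G *ᵥ w) := fun w hw => by
    simpa using hG.dotProduct_mulVec_pos hw
  have hsymm : v ⬝ᵥ (G *ᵥ u) = u ⬝ᵥ (G *ᵥ v) := by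
    have : Gᵀ = G := by simpa using hG.isHermitian.eq
    rw [Matrix.dotProduct_mulVec, ← Matrix.mulVec_transpose, this, dotProduct_comm]
  rw [hf, hf, hf]
  have hu : u ≠ 0 := by simpa using h.ne_zero 0
  set a := u ⬝ᵥ (G *ᵥ u) with ha
  set b := u ⬝ᵥ (G *ᵥ v) with hb
  have ha0 : 0 < a := hpos u hu
  have hw : a • v - b • u ≠ 0 := by
    intro h0
    have := (LinearIndependent.pair_iff.1 h) (-b) a (by rw [← h0, neg_smul]; abel)
    exact ha0.ne' this.2
  have h1 := hpos _ hw
  have h2 : (a • v - b • u) ⬝ᵥ (G *ᵥ (a • v - b • u)) = a * (a * (v ⬝ᵥ (G *ᵥ v)) - b ^ 2) := by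
    simp only [Matrix.mulVec_sub, Matrix.mulVec_smul, dotProduct_sub, sub_dotProduct,
      dotProduct_smul, smul_dotProduct, smul_eq_mul, hsymm, ← ha, ← hb]
    ring
  rw [h2] at h1
  exact pos_of_mul_pos_right h1 ha0.le

/-- Positive sectional curvature means that the curvature form on bivectors is positive definite. -/
theorem CurvLike.posDef_bivectorForm {R : Fin 3 → Fin 3 → Fin 3 → Fin 3 → ℝ} (hR : CurvLike R)
    (hp : ∀ i j k l, R i j k l = R k l i j) {G : Matrix (Fin 3) (Fin 3) ℝ} (hG : G.PosDef)
    (h : ∀ u v : Fin 3 → ℝ, LinearIndependent ℝ ![u, v] →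
      0 < (∑ i, ∑ j, ∑ k, ∑ l, R i j k l * u i * v j * u k * v l) /
        ((∑ i, ∑ j, G i j * u i * u j) * (∑ i, ∑ j, G i j * v i * v j)
          - (∑ i, ∑ j, G i j * u i * v j) ^ 2)) : (bivectorForm R).PosDef := by
  refine Matrix.PosDef.of_dotProduct_mulVec_pos ?_ fun w hw => ?_
  · ext p q
    exact (hp _ _ _ _)
  · obtain ⟨u, v, rfl⟩ := exists_crossProduct_eq w
    have hli := crossProduct_ne_zero_iff_linearIndependent.1 hw
    have := (div_pos_iff_of_pos_right (gram_det_pos hG hli)).1 (h u v hli)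
    rw [hR.sum_eq_crossProduct] at this
    simpa using this

end Algebra

/-! ### Components in a coordinate domain of `ℝ³` -/

section Components

/-- Euclidean three-space. -/
abbrev E3 : Type := EuclideanSpace ℝ (Fin 3)

/-- The standard basis vectors. -/
abbrev ee (i : Fin 3) : E3 := EuclideanSpace.single i (1 : ℝ)

variable {F : Type} [NormedAddCommGroup F] [NormedSpace ℝ F]

theorem sum_smul_ee (v : E3) : ∑ i, v i • ee i = v := by
  simpa using (EuclideanSpace.basisFun (Fin 3) ℝ).sum_repr v

theorem clm_eq_sum (T : E3 →L[ℝ] F) (v : E3) : T v = ∑ i, v i • T (ee i) := by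
  conv_lhs => rw [← sum_smul_ee v, map_sum]
  simp

theorem bil_eq_sum (T : E3 →L[ℝ] E3 →L[ℝ] F) (u v : E3) :
    T u v = ∑ i, ∑ j, (u i * v j) • T (ee i) (ee j) := by
  rw [clm_eq_sum T u]
  simp only [FunLike.coe_sum, Finset.sum_apply, smul_apply]
  refine Finset.sum_congr rfl fun i _ => ?_
  rw [clm_eq_sum (T (ee i)) v, Finset.smul_sum]
  simp only [smul_smul]

theorem clm_ext_ee {T T' : E3 →L[ℝ] F} (h : ∀ i, T (ee i) = T' (ee i)) : T = T' := by
  ext v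
  rw [clm_eq_sum T, clm_eq_sum T']
  simp only [h]

theorem bil_ext_ee {T T' : E3 →L[ℝ] E3 →L[ℝ] F} (h : ∀ i j, T (ee i) (ee j) = T' (ee i) (ee j)) :
    T = T' :=
  clm_ext_ee fun i => clm_ext_ee fun j => h i j

/-- The linear map with given values on the standard basis. -/
def clmOf (c : Fin 3 → F) : E3 →L[ℝ] F :=
  ∑ i, (EuclideanSpace.proj i : E3 →L[ℝ] ℝ).smulRight (c i)

@[simp] theorem clmOf_apply (c : Fin 3 → F) (i : Fin 3) : clmOf c (ee i) = c i := by
  simp only [clmOf, FunLike.coe_sum, Finset.sum_apply, ContinuousLinearMap.smulRight_apply,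
    PiLp.proj_apply, PiLp.single_apply, ite_smul, one_smul, zero_smul, Finset.sum_ite_eq',
    Finset.mem_univ, if_true]

/-- The bilinear map with given values on the standard basis. -/
def bilOf (c : Fin 3 → Fin 3 → F) : E3 →L[ℝ] E3 →L[ℝ] F := clmOf fun i => clmOf (c i)

@[simp] theorem bilOf_apply (c : Fin 3 → Fin 3 → F) (i j : Fin 3) :
    bilOf c (ee i) (ee j) = c i j := by
  simp [bilOf]

variable {Ω : Set E3} {m : ℕ} {α : ℝ≥0}

theorem isCkAlphaOn_bil (hα : α ≤ 1) (hΩ : IsOpen Ω) {T : E3 → E3 →L[ℝ] E3 →L[ℝ] F}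
    (h : ∀ i j, IsCkAlphaOn m α (fun y => T y (ee i) (ee j)) Ω) : IsCkAlphaOn m α T Ω := by
  have hb : ∀ i, (EuclideanSpace.basisFun (Fin 3) ℝ).toBasis i = ee i := fun i => by simp
  refine isCkAlphaOn_clm_of_basis hα (EuclideanSpace.basisFun (Fin 3) ℝ).toBasis hΩ fun i =>
    isCkAlphaOn_clm_of_basis hα (EuclideanSpace.basisFun (Fin 3) ℝ).toBasis hΩ fun j => ?_
  simpa only [hb] using h i j

theorem isCkAlphaOn_euclidean (hα : α ≤ 1) (hΩ : IsOpen Ω) {f : E3 → E3}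
    (h : ∀ i, IsCkAlphaOn m α (fun y => f y i) Ω) : IsCkAlphaOn m α f Ω := by
  have : f = fun y => ∑ i, (ContinuousLinearMap.toSpanSingleton ℝ (ee i)) (f y i) := by
    funext y
    simpa using (sum_smul_ee (f y)).symm
  rw [this]
  exact IsCkAlphaOn.sum hα hΩ _ fun i _ => (h i).clm_comp hΩ _

theorem IsCkAlphaOn.pd (hΩ : IsOpen Ω) {f : E3 → ℝ} (h : IsCkAlphaOn (m + 1) α f Ω) (i : Fin 3) :
    IsCkAlphaOn m α (pd i f) Ω :=
  (h.fderiv hΩ).clm_apply_const hΩ _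

variable {G : E3 → Matrix (Fin 3) (Fin 3) ℝ}

theorem isCkAlphaOn_adjugate (hα : α ≤ 1) (hΩ : IsOpen Ω)
    (hG : ∀ i j, IsCkAlphaOn m α (fun y => G y i j) Ω) (i j : Fin 3) :
    IsCkAlphaOn m α (fun y => (G y).adjugate i j) Ω := by
  have h2 : ∀ a b c d e f g h, IsCkAlphaOn m α (fun y => G y a b * G y c d - G y e f * G y g h) Ω :=
    fun a b c d e f g h => ((hG _ _).mul hα hΩ (hG _ _)).sub hΩ ((hG _ _).mul hα hΩ (hG _ _))
  have h3 : ∀ a b c d e f g h,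
      IsCkAlphaOn m α (fun y => -(G y a b * G y c d) + G y e f * G y g h) Ω :=
    fun a b c d e f g h => (h2 e f g h a b c d).congr hΩ fun y _ => by ring
  fin_cases i <;> fin_cases j <;> simp [Matrix.adjugate_fin_three] <;>
    first | exact h2 _ _ _ _ _ _ _ _ | exact h3 _ _ _ _ _ _ _ _

theorem isCkAlphaOn_det (hα : α ≤ 1) (hΩ : IsOpen Ω)
    (hG : ∀ i j, IsCkAlphaOn m α (fun y => G y i j) Ω) :
    IsCkAlphaOn m α (fun y => (G y).det) Ω := by
  have : ∀ y, (G y).det = ∑ j, G y 0 j * (G y).adjugate j 0 := fun y => by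
    have := congrFun (congrFun (Matrix.mul_adjugate (G y)) 0) 0
    rw [Matrix.mul_apply] at this
    simpa using this.symm
  simp only [this]
  exact IsCkAlphaOn.sum hα hΩ _ fun j _ => (hG _ _).mul hα hΩ (isCkAlphaOn_adjugate hα hΩ hG _ _)

theorem isCkAlphaOn_inv (hα : α ≤ 1) (hΩ : IsOpen Ω)
    (hG : ∀ i j, IsCkAlphaOn m α (fun y => G y i j) Ω) (hd : ∀ y ∈ Ω, (G y).det ≠ 0)
    (i j : Fin 3) : IsCkAlphaOn m α (fun y => (G y)⁻¹ i j) Ω := by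
  simp only [Matrix.inv_def, Matrix.smul_apply, smul_eq_mul, Ring.inverse_eq_inv']
  exact ((isCkAlphaOn_det hα hΩ hG).inv hα hΩ hd).mul hα hΩ (isCkAlphaOn_adjugate hα hΩ hG _ _)

theorem isCkAlphaOn_adjugateRoot (hα : α ≤ 1) (hΩ : IsOpen Ω)
    (hG : ∀ i j, IsCkAlphaOn m α (fun y => G y i j) Ω) (hd : ∀ y ∈ Ω, 0 < (G y).det)
    (i j : Fin 3) : IsCkAlphaOn m α (fun y => adjugateRoot (G y) i j) Ω := by
  simp only [adjugateRoot, Matrix.smul_apply, smul_eq_mul]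
  exact (((isCkAlphaOn_det hα hΩ hG).sqrt hα hΩ fun y hy => (hd y hy).ne').inv hα hΩ fun y hy =>
    (Real.sqrt_pos.2 (hd y hy)).ne').mul hα hΩ (isCkAlphaOn_adjugate hα hΩ hG _ _)

theorem isCkAlphaOn_christoffel (hα : α ≤ 1) (hΩ : IsOpen Ω)
    (hG : ∀ i j, IsCkAlphaOn (m + 1) α (fun y => G y i j) Ω) (hd : ∀ y ∈ Ω, (G y).det ≠ 0)
    (k i j : Fin 3) : IsCkAlphaOn m α (christoffel G k i j) Ω := by
  have hp : ∀ a b c, IsCkAlphaOn m α (pd a fun z => G z b c) Ω := fun a b c => (hG b c).pd hΩ a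
  refine (isCkAlphaOn_const hα hΩ (1 / 2 : ℝ)).mul hα hΩ (IsCkAlphaOn.sum hα hΩ _ fun l _ => ?_)
  exact (isCkAlphaOn_inv hα hΩ (fun i j => (hG i j).of_succ hα hΩ) hd _ _).mul hα hΩ
    (((hp _ _ _).add hΩ (hp _ _ _)).sub hΩ (hp _ _ _))

theorem isCkAlphaOn_riemann (hα : α ≤ 1) (hΩ : IsOpen Ω)
    (hG : ∀ i j, IsCkAlphaOn (m + 2) α (fun y => G y i j) Ω) (hd : ∀ y ∈ Ω, (G y).det ≠ 0)
    (i j k l : Fin 3) : IsCkAlphaOn m α (riemann G i j k l) Ω := by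
  have hc1 := isCkAlphaOn_christoffel hα hΩ hG hd
  have hc := fun k i j => (hc1 k i j).of_succ hα hΩ
  refine IsCkAlphaOn.sum hα hΩ _ fun a _ =>
    (((hG k a).of_succ hα hΩ).of_succ hα hΩ).mul hα hΩ ?_
  refine (((hc1 _ _ _).pd hΩ i).sub hΩ ((hc1 _ _ _).pd hΩ j)).add hΩ
    (IsCkAlphaOn.sum hα hΩ _ fun b _ => ?_)
  exact ((hc _ _ _).mul hα hΩ (hc _ _ _)).sub hΩ ((hc _ _ _).mul hα hΩ (hc _ _ _))

/-- The Christoffel symbols as a field of bilinear maps. -/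
def christoffelMap (G : E3 → Matrix (Fin 3) (Fin 3) ℝ) (y : E3) : E3 →L[ℝ] E3 →L[ℝ] E3 :=
  bilOf fun i j => WithLp.toLp 2 fun k => christoffel G k i j y

@[simp] theorem christoffelMap_apply (y : E3) (i j k : Fin 3) :
    christoffelMap G y (ee i) (ee j) k = christoffel G k i j y := by
  simp [christoffelMap]

/-- A metric of class `C^{m+2,α}` on a coordinate domain, with positive sectional curvature. -/
structure ChartMetric (m : ℕ) (α : ℝ≥0) (B : E3 → E3 →L[ℝ] E3 →L[ℝ] ℝ)
    (G : E3 → Matrix (Fin 3) (Fin 3) ℝ) (Ω : Set E3) : Prop where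
  isOpen : IsOpen Ω
  comp : ∀ y i j, B y (ee i) (ee j) = G y i j
  regular : ∀ i j, IsCkAlphaOn (m + 2) α (fun y => G y i j) Ω
  symm : ∀ y ∈ Ω, ∀ u v, B y u v = B y v u
  pos : ∀ y ∈ Ω, ∀ v, v ≠ 0 → 0 < B y v v
  curvature : ∀ y ∈ Ω, ∀ u v : Fin 3 → ℝ, LinearIndependent ℝ ![u, v] →
    0 < sectionalCurvature G y u v

open Matrix in
theorem posDef_of_form {b : E3 →L[ℝ] E3 →L[ℝ] ℝ} {g : Matrix (Fin 3) (Fin 3) ℝ}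
    (hc : ∀ i j, b (ee i) (ee j) = g i j) (hs : ∀ u v, b u v = b v u)
    (hp : ∀ v, v ≠ 0 → 0 < b v v) : g.PosDef := by
  refine Matrix.PosDef.of_dotProduct_mulVec_pos ?_ fun w hw => ?_
  · ext i j
    simp [← hc, hs (ee i)]
  · have h1 := hp (WithLp.toLp 2 w) (by simpa using hw)
    rw [bil_eq_sum] at h1
    refine h1.trans_eq ?_
    simp only [dotProduct, Matrix.mulVec, Finset.mul_sum, hc, smul_eq_mul, star_trivial]
    refine Finset.sum_congr rfl fun i _ => Finset.sum_congr rfl fun j _ => ?_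
    ring

open Matrix in
theorem form_of_posDef {g : Matrix (Fin 3) (Fin 3) ℝ} (hg : g.PosDef) :
    (∀ u v, bilOf (fun i j => g i j) u v = bilOf (fun i j => g i j) v u) ∧
      ∀ v, v ≠ 0 → 0 < bilOf (fun i j => g i j) v v := by
  have hs : ∀ i j, g i j = g j i := fun i j => by
    simpa using (hg.isHermitian.apply i j).symm
  constructor
  · intro u v
    rw [bil_eq_sum, bil_eq_sum, Finset.sum_comm]
    simp only [bilOf_apply, smul_eq_mul]
    refine Finset.sum_congr rfl fun i _ => Finset.sum_congr rfl fun j _ => ?_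
    rw [hs]; ring
  · intro v hv
    have h1 := hg.dotProduct_mulVec_pos (x := fun i => v i) (by
      intro h0
      apply hv
      ext i
      exact congrFun h0 i)
    refine h1.trans_eq ?_
    rw [bil_eq_sum]
    simp only [dotProduct, Matrix.mulVec, Finset.mul_sum, bilOf_apply, smul_eq_mul, star_trivial]
    refine Finset.sum_congr rfl fun i _ => Finset.sum_congr rfl fun j _ => ?_
    ring

namespace ChartMetric

variable {B : E3 → E3 →L[ℝ] E3 →L[ℝ] ℝ} (h : ChartMetric m α B G Ω)
include h

theorem posDef {y : E3} (hy : y ∈ Ω) : (G y).PosDef :=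
  posDef_of_form (h.comp y) (h.symm y hy) (h.pos y hy)

theorem det_ne_zero {y : E3} (hy : y ∈ Ω) : (G y).det ≠ 0 := (h.posDef hy).det_pos.ne'

theorem regularB (hα : α ≤ 1) : IsCkAlphaOn (m + 2) α B Ω :=
  isCkAlphaOn_bil hα h.isOpen fun i j => by simpa only [h.comp] using h.regular i j

theorem regularΓ (hα : α ≤ 1) : IsCkAlphaOn (m + 1) α (christoffelMap G) Ω :=
  isCkAlphaOn_bil hα h.isOpen fun i j => isCkAlphaOn_euclidean hα h.isOpen fun k => by
    simpa using isCkAlphaOn_christoffel hα h.isOpen h.regular (fun y hy => h.det_ne_zero hy) k i j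

theorem diffB (hα : α ≤ 1) {y : E3} (hy : y ∈ Ω) : DifferentiableAt ℝ B y :=
  ((h.regularB hα).contDiffOn.contDiffAt (h.isOpen.mem_nhds hy)).differentiableAt (by simp)

theorem fderivB (hα : α ≤ 1) {y : E3} (hy : y ∈ Ω) (k i j : Fin 3) :
    fderiv ℝ B y (ee k) (ee i) (ee j) = pd k (fun z => G z i j) y := by
  rw [← fderiv_field_apply₂_const (h.diffB hα hy)]
  simp only [h.comp]
  rfl

theorem symmG {y : E3} (hy : y ∈ Ω) (i j : Fin 3) : G y i j = G y j i := by
  rw [← h.comp, h.symm y hy, h.comp]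

theorem lower_christoffel {y : E3} (hy : y ∈ Ω) (i j l : Fin 3) :
    ∑ k, G y l k * christoffel G k i j y = (1 / 2) * (pd i (fun z => G z j l) y
      + pd j (fun z => G z i l) y - pd l (fun z => G z i j) y) := by
  have h1 : ∀ k, christoffel G k i j y = (1 / 2) * ((G y)⁻¹.mulVec (fun l =>
      pd i (fun z => G z j l) y + pd j (fun z => G z i l) y - pd l (fun z => G z i j) y)) k :=
    fun k => rfl
  have h2 := congrFun (Matrix.mulVec_mulVec (fun l =>
      pd i (fun z => G z j l) y + pd j (fun z => G z i l) y - pd l (fun z => G z i j) y)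
      (G y) (G y)⁻¹) l
  rw [Matrix.mul_nonsing_inv _ (isUnit_iff_ne_zero.2 (h.det_ne_zero hy)), Matrix.one_mulVec] at h2
  rw [← h2]
  simp only [h1]
  rw [Matrix.mulVec, dotProduct, Finset.mul_sum]
  refine Finset.sum_congr rfl fun k _ => ?_
  ring

theorem inner_christoffelMap {y : E3} (hy : y ∈ Ω) (i j l : Fin 3) :
    B y (ee l) (christoffelMap G y (ee i) (ee j)) = (1 / 2) * (pd i (fun z => G z j l) y
      + pd j (fun z => G z i l) y - pd l (fun z => G z i j) y) := by
  rw [← h.lower_christoffel hy, clm_eq_sum (B y (ee l))]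
  simp only [christoffelMap_apply, h.comp, smul_eq_mul]
  refine Finset.sum_congr rfl fun k _ => ?_
  ring

theorem pd_symm {y : E3} (hy : y ∈ Ω) (k i j : Fin 3) :
    pd k (fun z => G z i j) y = pd k (fun z => G z j i) y := by
  have : (fun z => G z i j) =ᶠ[𝓝 y] fun z => G z j i := by
    filter_upwards [h.isOpen.mem_nhds hy] with z hz using h.symmG hz i j
  simp only [pd, this.fderiv_eq]

theorem leviCivita (hα : α ≤ 1) : LeviCivita B (christoffelMap G) Ω where
  isOpen := h.isOpen
  contDiffB := (h.regularB hα).contDiffOn.of_le (by norm_cast; omega)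
  contDiffΓ := (h.regularΓ hα).contDiffOn.of_le (by norm_cast; omega)
  symm := h.symm
  pos := h.pos
  torsion := fun y hy u v => by
    have : christoffelMap G y = (christoffelMap G y).flip := bil_ext_ee fun i j => by
      ext k
      rw [ContinuousLinearMap.flip_apply, christoffelMap_apply, christoffelMap_apply, christoffel,
        christoffel]
      congr 1
      refine Finset.sum_congr rfl fun l _ => ?_
      rw [h.pd_symm hy l i j]
      ring
    conv_lhs => rw [this]
    rfl
  compat := fun y hy a u v => by
    -- T a u v = g(Γ(a,u), v), and T' is T with u and v exchanged. On basis vectors each is a Koszul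
    -- half-sum; in T + T' all but the derivative of the metric cancels.
    let T : E3 →L[ℝ] E3 →L[ℝ] E3 →L[ℝ] ℝ :=
      (ContinuousLinearMap.compL ℝ E3 E3 (E3 →L[ℝ] ℝ) (B y)).comp (christoffelMap G y)
    let T' : E3 →L[ℝ] E3 →L[ℝ] E3 →L[ℝ] ℝ :=
      ((ContinuousLinearMap.flipₗᵢ ℝ E3 E3 ℝ : (E3 →L[ℝ] E3 →L[ℝ] ℝ) ≃ₗᵢ[ℝ] _) :
        (E3 →L[ℝ] E3 →L[ℝ] ℝ) →L[ℝ] E3 →L[ℝ] E3 →L[ℝ] ℝ).comp T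
    have hT : ∀ a u v, T a u v = B y v (christoffelMap G y a u) := fun a u v => h.symm y hy _ _
    have hT' : ∀ a u v, T' a u v = B y u (christoffelMap G y a v) := fun a u v => hT a v u
    have key : fderiv ℝ B y = T + T' := by
      refine bil_ext_ee fun k i => clm_ext_ee fun j => ?_
      rw [add_apply, add_apply, add_apply, hT, hT', h.fderivB hα hy, h.inner_christoffelMap hy,
        h.inner_christoffelMap hy, h.pd_symm hy k j i]
      ring
    rw [key, add_apply, add_apply, add_apply, hT, hT', h.symm y hy v]

end ChartMetric

end Components

/-! ### Metrics of positive curvature on a coordinate domain -/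

section ChartMetric

variable {Ω : Set E3} {m : ℕ} {α : ℝ≥0} {G : E3 → Matrix (Fin 3) (Fin 3) ℝ}
  {B : E3 → E3 →L[ℝ] E3 →L[ℝ] ℝ}

theorem eq_zero_of_ee {f : E3 → ℝ} (hf : IsLinearMap ℝ f) (h : ∀ i, f (ee i) = 0) (v : E3) :
    f v = 0 := by
  have hT : hf.mk' f = 0 := by
    refine (EuclideanSpace.basisFun (Fin 3) ℝ).toBasis.ext fun i => ?_
    simpa using h i
  exact congrArg (fun T => T v) hT

theorem eq_zero_of_ee₃ {f : E3 → E3 → E3 → ℝ} (h₁ : ∀ b c, IsLinearMap ℝ fun a => f a b c)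
    (h₂ : ∀ a c, IsLinearMap ℝ fun b => f a b c) (h₃ : ∀ a b, IsLinearMap ℝ fun c => f a b c)
    (h : ∀ i j k, f (ee i) (ee j) (ee k) = 0) (a b c : E3) : f a b c = 0 :=
  eq_zero_of_ee (h₁ b c) (fun i => eq_zero_of_ee (h₂ (ee i) c) (fun j =>
    eq_zero_of_ee (h₃ (ee i) (ee j)) (h i j) c) b) a

/-- The solution of the Gauss equation on a coordinate domain. -/
def chartRoot (G : E3 → Matrix (Fin 3) (Fin 3) ℝ) (y : E3) : E3 →L[ℝ] E3 →L[ℝ] ℝ :=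
  bilOf fun i j => adjugateRoot (bivectorForm fun i j k l => riemann G i j k l y) i j

/-- The shape operator on a coordinate domain. -/
def chartShape (G : E3 → Matrix (Fin 3) (Fin 3) ℝ) (y : E3) : E3 →L[ℝ] E3 :=
  clmOf fun i => WithLp.toLp 2 fun k => ∑ l, (G y)⁻¹ k l * chartRoot G y (ee i) (ee l)

theorem chartShape_apply (y : E3) (i k : Fin 3) :
    chartShape G y (ee i) k = ∑ l, (G y)⁻¹ k l * chartRoot G y (ee i) (ee l) := by
  simp [chartShape]

namespace ChartMetric

variable (h : ChartMetric m α B G Ω)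
include h

theorem curv_apply (hα : α ≤ 1) {y : E3} (hy : y ∈ Ω) (i j k l : Fin 3) :
    curv (christoffelMap G) y (ee i) (ee j) (ee k) l = curvatureEnd G l i j k y := by
  have dΓ := (h.leviCivita hα).diffΓ hy
  have hd : ∀ a b c d, fderiv ℝ (christoffelMap G) y (ee a) (ee b) (ee c) d =
      pd a (christoffel G d b c) y := by
    intro a b c d
    rw [← fderiv_field_apply₂_const dΓ]
    have := ((EuclideanSpace.proj d : E3 →L[ℝ] ℝ).hasFDerivAt.comp y
      ((dΓ.clm_apply (differentiableAt_const (ee b))).clm_apply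
        (differentiableAt_const (ee c))).hasFDerivAt).fderiv
    have e : (EuclideanSpace.proj d : E3 →L[ℝ] ℝ) ∘
        (fun z => christoffelMap G z (ee b) (ee c)) = christoffel G d b c := by
      funext z
      exact christoffelMap_apply z b c d
    rw [e] at this
    rw [pd, this]
    rfl
  have hq : ∀ a (v : E3), christoffelMap G y (ee a) v l = ∑ b, v b * christoffel G l a b y := by
    intro a v
    rw [clm_eq_sum (christoffelMap G y (ee a)) v]
    simp
  simp only [curv, PiLp.add_apply, PiLp.sub_apply, hd, hq, christoffelMap_apply, curvatureEnd,
    Finset.sum_sub_distrib]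
  ring

theorem riemann_eq (hα : α ≤ 1) {y : E3} (hy : y ∈ Ω) (i j k l : Fin 3) :
    riemann G i j k l y = B y (curv (christoffelMap G) y (ee i) (ee j) (ee l)) (ee k) := by
  rw [h.symm y hy, clm_eq_sum (B y (ee k))]
  simp only [h.curv_apply hα hy, h.comp, riemann, smul_eq_mul]
  exact Finset.sum_congr rfl fun a _ => mul_comm _ _

theorem curvLike (hα : α ≤ 1) {y : E3} (hy : y ∈ Ω) :
    CurvLike fun i j k l => riemann G i j k l y := by
  have hL := h.leviCivita hα
  constructor
  · intro i j k l
    simp only [h.riemann_eq hα hy]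
    rw [LeviCivita.curv_swap]
    simp
  · intro i j k l
    simp only [h.riemann_eq hα hy]
    rw [hL.curv_antisymm hy, h.symm y hy]

theorem riemann_pair (hα : α ≤ 1) {y : E3} (hy : y ∈ Ω) (i j k l : Fin 3) :
    riemann G i j k l y = riemann G k l i j y := by
  have hL := h.leviCivita hα
  rw [h.riemann_eq hα hy, h.riemann_eq hα hy, hL.curv_pair hy]

theorem posDef_bivector (hα : α ≤ 1) {y : E3} (hy : y ∈ Ω) :
    (bivectorForm fun i j k l => riemann G i j k l y).PosDef :=
  (h.curvLike hα hy).posDef_bivectorForm (h.riemann_pair hα hy) (h.posDef hy) (h.curvature y hy)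

theorem posDef_root (hα : α ≤ 1) {y : E3} (hy : y ∈ Ω) :
    (adjugateRoot (bivectorForm fun i j k l => riemann G i j k l y)).PosDef :=
  posDef_adjugateRoot (h.posDef_bivector hα hy)

/-- The Gauss equation for the components of a form on a coordinate domain. -/
theorem gauss_components (hα : α ≤ 1) {y : E3} (hy : y ∈ Ω) (c : E3 →L[ℝ] E3 →L[ℝ] ℝ) :
    (∀ a b u v, B y (curv (christoffelMap G) y a b u) v = c b u * c a v - c a u * c b v) ↔
      ∀ i j k l, riemann G i j k l y =
        gaussTensor (Matrix.of fun i j => c (ee i) (ee j)) i j k l := by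
  constructor
  · intro hg i j k l
    rw [h.riemann_eq hα hy, hg, gaussTensor]
    simp only [Matrix.of_apply]
    ring
  · intro hg
    have h4 : ∀ i j k l, B y (curv (christoffelMap G) y (ee i) (ee j) (ee k)) (ee l) =
        c (ee j) (ee k) * c (ee i) (ee l) - c (ee i) (ee k) * c (ee j) (ee l) := fun i j k l => by
      rw [← h.riemann_eq hα hy, hg, gaussTensor]
      simp only [Matrix.of_apply]
      ring
    intro a b u v
    rw [← sub_eq_zero]
    refine eq_zero_of_ee₃ (f := fun a b u => B y (curv (christoffelMap G) y a b u) v -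
      (c b u * c a v - c a u * c b v)) (fun b u => ?_) (fun a u => ?_) (fun a b => ?_)
      (fun i j k => eq_zero_of_ee (f := fun v => B y (curv (christoffelMap G) y (ee i) (ee j)
        (ee k)) v - (c (ee j) (ee k) * c (ee i) v - c (ee i) (ee k) * c (ee j) v)) ?_
        (fun l => sub_eq_zero.2 (h4 i j k l)) v) a b u
    all_goals
      constructor <;> intros <;>
        simp only [curv, map_add, map_sub, map_smul, add_apply, sub_apply, smul_apply,
          smul_eq_mul] <;>
        ring

/-- The Gauss equation says that the adjugate of the matrix of c is the positive definite bivector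
matrix of the curvature; both signs occur because the adjugate is quadratic. -/
theorem gauss_iff_eq (hα : α ≤ 1) {y : E3} (hy : y ∈ Ω) {c : E3 →L[ℝ] E3 →L[ℝ] ℝ}
    (hc : ∀ u v, c u v = c v u) :
    (∀ a b u v, B y (curv (christoffelMap G) y a b u) v = c b u * c a v - c a u * c b v) ↔
      (c = chartRoot G y ∨ c = -chartRoot G y) := by
  have hP := h.posDef_bivector hα hy
  have hs : (Matrix.of fun i j => c (ee i) (ee j)).IsSymm := by
    ext i j
    exact hc _ _
  have hcr : c = chartRoot G y ↔ (Matrix.of fun i j => c (ee i) (ee j)) =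
      adjugateRoot (bivectorForm fun i j k l => riemann G i j k l y) := by
    constructor
    · rintro rfl
      ext i j
      simp [chartRoot]
    · intro h1
      refine bil_ext_ee fun i j => ?_
      rw [chartRoot, bilOf_apply, ← h1, Matrix.of_apply]
  have hcr' : c = -chartRoot G y ↔ (Matrix.of fun i j => c (ee i) (ee j)) =
      -adjugateRoot (bivectorForm fun i j k l => riemann G i j k l y) := by
    constructor
    · rintro rfl
      ext i j
      simp [chartRoot]
    · intro h1
      refine bil_ext_ee fun i j => ?_
      rw [neg_apply, neg_apply, chartRoot, bilOf_apply, ← Matrix.neg_apply, ← h1, Matrix.of_apply]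
  rw [h.gauss_components hα hy, (h.curvLike hα hy).gauss_iff hs, hcr, hcr']
  constructor
  · exact fun h1 => eq_adjugateRoot_or hP h1.symm
  · rintro (h1 | h1)
    · rw [h1, adjugate_adjugateRoot hP]
    · rw [h1, ← neg_one_smul ℝ, Matrix.adjugate_smul, adjugate_adjugateRoot hP]
      simp

theorem contractedGauss_iff (hα : α ≤ 1) {y : E3} (hy : y ∈ Ω) (c : E3 →L[ℝ] E3 →L[ℝ] ℝ) :
    (∀ i j : Fin 3, ricci G i j y =
      (∑ k, ∑ l, (G y)⁻¹ k l * c (ee k) (ee l)) * c (ee i) (ee j)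
        - ∑ k, ∑ l, (G y)⁻¹ k l * c (ee i) (ee l) * c (ee k) (ee j)) ↔
    (∀ a b u v, B y (curv (christoffelMap G) y a b u) v = c b u * c a v - c a u * c b v) := by
  have hH : (G y)⁻¹.PosDef := (h.posDef hy).inv
  have hs : (G y)⁻¹.IsSymm := by
    have := hH.isHermitian
    simpa [Matrix.IsHermitian, Matrix.IsSymm] using this
  rw [h.gauss_components hα hy, ← (h.curvLike hα hy).contracted_gauss_iff hs hH.det_pos.ne']
  -- With H = G⁻¹ the contraction of `riemann` is by definition `ricci`.
  rfl

theorem root_symm (hα : α ≤ 1) {y : E3} (hy : y ∈ Ω) (u v : E3) :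
    chartRoot G y u v = chartRoot G y v u :=
  (form_of_posDef (h.posDef_root hα hy)).1 u v

theorem root_pos (hα : α ≤ 1) {y : E3} (hy : y ∈ Ω) {v : E3} (hv : v ≠ 0) :
    0 < chartRoot G y v v :=
  (form_of_posDef (h.posDef_root hα hy)).2 v hv

theorem gaussEq (hα : α ≤ 1) : GaussEq B (christoffelMap G) (chartRoot G) Ω := fun y hy =>
  (h.gauss_iff_eq hα hy (h.root_symm hα hy)).2 (Or.inl rfl)

/-- A positive definite solution of the Gauss equation is unique. -/
theorem eq_root (hα : α ≤ 1) {y : E3} (hy : y ∈ Ω) {c : E3 →L[ℝ] E3 →L[ℝ] ℝ}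
    (hc : ∀ u v, c u v = c v u) (hp : ∀ v, v ≠ 0 → 0 < c v v)
    (hg : ∀ a b u v, B y (curv (christoffelMap G) y a b u) v = c b u * c a v - c a u * c b v) :
    c = chartRoot G y := by
  rcases (h.gauss_iff_eq hα hy hc).1 hg with h1 | h1
  · exact h1
  · have h2 : ee 0 ≠ 0 := by simp
    have h3 := hp _ h2
    have h4 := h.root_pos hα hy h2
    rw [h1, neg_apply, neg_apply] at h3
    linarith

theorem gaussRigid (hα : α ≤ 1) : GaussRigid B (christoffelMap G) (chartRoot G) Ω := by
  intro y hy c hs hl hg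
  have hz : ∀ w, c 0 w = 0 := fun w => by
    have := hl 1 0 0 w
    simp at this
    linarith
  have ha : ∀ u v w, c (u + v) w = c u w + c v w := fun u v w => by
    simpa using hl 1 u v w
  have hm : ∀ (r : ℝ) u w, c (r • u) w = r * c u w := fun r u w => by
    simpa [hz] using hl r u 0 w
  -- `GaussRigid` quantifies over bare functions; symmetry and linearity in the first slot make c
  -- bilinear, hence continuous in finite dimension.
  let b : E3 →ₗ[ℝ] E3 →ₗ[ℝ] ℝ := LinearMap.mk₂ ℝ c ha hm
    (fun u v w => by rw [hs, ha, hs v, hs w]) (fun r u v => by rw [hs, hm, hs v]; rfl)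
  let c' : E3 →L[ℝ] E3 →L[ℝ] ℝ := LinearMap.toContinuousLinearMap
    ((LinearMap.toContinuousLinearMap : (E3 →ₗ[ℝ] ℝ) ≃ₗ[ℝ] E3 →L[ℝ] ℝ).toLinearMap.comp b)
  have hc' : ∀ u v, c' u v = c u v := fun u v => rfl
  rcases (h.gauss_iff_eq hα hy (c := c') (fun u v => hs u v)).1 hg with h1 | h1
  · left
    intro u v
    rw [← hc', h1]
  · right
    intro u v
    rw [← hc', h1]
    rfl

/-- The curvature costs two derivatives of the metric; the passage to the root is smooth where the
determinant is positive and costs none. -/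
theorem regular_root (hα : α ≤ 1) (i j : Fin 3) :
    IsCkAlphaOn m α (fun y => chartRoot G y (ee i) (ee j)) Ω := by
  simp only [chartRoot, bilOf_apply]
  exact isCkAlphaOn_adjugateRoot hα h.isOpen (fun p q =>
    isCkAlphaOn_riemann hα h.isOpen h.regular (fun y hy => h.det_ne_zero hy) _ _ _ _)
    (fun y hy => (h.posDef_bivector hα hy).det_pos) i j

theorem regularχ (hα : α ≤ 1) : IsCkAlphaOn m α (chartRoot G) Ω :=
  isCkAlphaOn_bil hα h.isOpen (h.regular_root hα)

theorem regularS (hα : α ≤ 1) : IsCkAlphaOn m α (chartShape G) Ω := by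
  have hb : ∀ i, (EuclideanSpace.basisFun (Fin 3) ℝ).toBasis i = ee i := fun i => by simp
  refine isCkAlphaOn_clm_of_basis hα (EuclideanSpace.basisFun (Fin 3) ℝ).toBasis h.isOpen fun i =>
    isCkAlphaOn_euclidean hα h.isOpen fun k => ?_
  simp only [hb, chartShape_apply]
  exact IsCkAlphaOn.sum hα h.isOpen _ fun l _ => (isCkAlphaOn_inv hα h.isOpen
    (fun i j => ((h.regular i j).of_succ hα h.isOpen).of_succ hα h.isOpen)
    (fun y hy => h.det_ne_zero hy) _ _).mul hα h.isOpen (h.regular_root hα _ _)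

theorem shape (hα : α ≤ 1) {y : E3} (hy : y ∈ Ω) (a v : E3) :
    B y (chartShape G y a) v = chartRoot G y a v := by
  have : (B y).comp (chartShape G y) = chartRoot G y := bil_ext_ee fun i j => by
    have h2 := congrFun (Matrix.mulVec_mulVec (fun l => chartRoot G y (ee i) (ee l))
      (G y) (G y)⁻¹) j
    rw [Matrix.mul_nonsing_inv _ (isUnit_iff_ne_zero.2 (h.det_ne_zero hy)),
      Matrix.one_mulVec] at h2
    rw [← h2, ContinuousLinearMap.comp_apply, h.symm y hy, clm_eq_sum (B y (ee j))]
    simp only [chartShape_apply, h.comp, smul_eq_mul]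
    exact Finset.sum_congr rfl fun k _ => mul_comm _ _
  exact congrArg (fun T => T a v) this

theorem shapeData (hα : α ≤ 1) (hm : 1 ≤ m) :
    ShapeData B (christoffelMap G) (chartRoot G) (chartShape G) Ω where
  toLeviCivita := h.leviCivita hα
  contDiffχ := (h.regularχ hα).contDiffOn.of_le (by exact_mod_cast hm)
  contDiffS := (h.regularS hα).contDiffOn.of_le (by exact_mod_cast hm)
  symmχ := fun y hy => h.root_symm hα hy
  posχ := fun y hy v hv => h.root_pos hα hy hv
  shape := fun y hy => h.shape hα hy

/-- In χ_{ij;k} - χ_{ik;j} the terms with Γ^m_{kj} cancel since the torsion vanishes. What is left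
is `CodazziEq` on basis vectors, and multilinearity extends it to all vectors. -/
theorem codazziEq_iff (hα : α ≤ 1) (hm : 1 ≤ m) {T : E3 → Matrix (Fin 3) (Fin 3) ℝ}
    (hT : ∀ y ∈ Ω, ∀ i j, T y i j = chartRoot G y (ee i) (ee j)) :
    CodazziEq (christoffelMap G) (chartRoot G) Ω ↔
      ∀ y ∈ Ω, ∀ i j k, covDeriv G T i j k y - covDeriv G T i k j y = 0 := by
  have hS := h.shapeData hα hm
  have hd : ∀ y ∈ Ω, ∀ k i j, pd k (fun z => T z i j) y =
      fderiv ℝ (chartRoot G) y (ee k) (ee i) (ee j) := by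
    intro y hy k i j
    rw [← fderiv_field_apply₂_const (hS.diffχ hy)]
    have e : (fun z => T z i j) =ᶠ[𝓝 y] fun z => chartRoot G z (ee i) (ee j) := by
      filter_upwards [h.isOpen.mem_nhds hy] with z hz using hT z hz i j
    rw [pd, e.fderiv_eq]
  have hΓ : ∀ y ∈ Ω, ∀ i j k, chartRoot G y (ee i) (christoffelMap G y (ee k) (ee j)) =
      ∑ m, christoffel G m k j y * T y i m := by
    intro y hy i j k
    rw [clm_eq_sum (chartRoot G y (ee i))]
    simp [hT y hy]
  have hv : ∀ y ∈ Ω, ∀ i j k, covDeriv G T i j k y = fderiv ℝ (chartRoot G) y (ee k) (ee i) (ee j)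
      - chartRoot G y (ee j) (christoffelMap G y (ee k) (ee i))
      - chartRoot G y (ee i) (christoffelMap G y (ee k) (ee j)) := by
    intro y hy i j k
    rw [hΓ y hy, hΓ y hy, covDeriv, hd y hy]
    congr 2
    refine Finset.sum_congr rfl fun l _ => ?_
    rw [hT y hy, h.root_symm hα hy, hT y hy]
  have ht := (h.leviCivita hα).torsion
  have hsd : ∀ y ∈ Ω, ∀ a u v, fderiv ℝ (chartRoot G) y a u v = fderiv ℝ (chartRoot G) y a v u := by
    intro y hy a u v
    rw [← fderiv_field_apply₂_const (hS.diffχ hy), ← fderiv_field_apply₂_const (hS.diffχ hy)]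
    have e : (fun z => chartRoot G z u v) =ᶠ[𝓝 y] fun z => chartRoot G z v u := by
      filter_upwards [h.isOpen.mem_nhds hy] with z hz using h.root_symm hα hz u v
    rw [e.fderiv_eq]
  constructor
  · intro hC y hy i j k
    have := hC y hy (ee k) (ee j) (ee i)
    rw [hv y hy, hv y hy, ht y hy (ee k) (ee j), hsd y hy (ee k) (ee i), hsd y hy (ee j) (ee i)]
    linarith
  · intro hC y hy a b c
    have h3 : ∀ k j i, fderiv ℝ (chartRoot G) y (ee k) (ee j) (ee i)
        - chartRoot G y (ee j) (christoffelMap G y (ee k) (ee i)) =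
        fderiv ℝ (chartRoot G) y (ee j) (ee k) (ee i)
        - chartRoot G y (ee k) (christoffelMap G y (ee j) (ee i)) := fun k j i => by
      have := hC y hy i j k
      rw [hv y hy, hv y hy, ht y hy (ee k) (ee j), hsd y hy (ee k) (ee i),
        hsd y hy (ee j) (ee i)] at this
      linarith
    rw [← sub_eq_zero]
    refine eq_zero_of_ee₃ (f := fun a b c => fderiv ℝ (chartRoot G) y a b c
      - chartRoot G y b (christoffelMap G y a c) - (fderiv ℝ (chartRoot G) y b a c
      - chartRoot G y a (christoffelMap G y b c))) (fun b c => ?_) (fun a c => ?_) (fun a b => ?_)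
      (fun i j k => sub_eq_zero.2 (h3 i j k)) a b c
    all_goals
      constructor <;> intros <;>
        simp only [map_add, map_sub, map_smul, add_apply, sub_apply, smul_apply, smul_eq_mul] <;>
        ring

end ChartMetric

end ChartMetric

/-! ### Metrics of positive curvature on a three-manifold, in charts -/

section ThreeManifold

variable {M : Type} [TopologicalSpace M] [ChartedSpace E3 M]

/-- The value of a twice-covariant tensor, as a form on `ℝ³`. -/
def formAt (T : Tensor2 3 M) (x : M) : E3 →L[ℝ] E3 →L[ℝ] ℝ := T x

/-- The derivative of a chart, as a linear map of `ℝ³`. -/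
def dChart (e : OpenPartialHomeomorph M E3) (x : M) : E3 →L[ℝ] E3 := mfderiv (𝓡 3) (𝓡 3) e x

/-- The derivative of the inverse of a chart, as a linear map of `ℝ³`. -/
def dSymm (e : OpenPartialHomeomorph M E3) (y : E3) : E3 →L[ℝ] E3 :=
  mfderiv (𝓡 3) (𝓡 3) e.symm y

/-- The expression of a twice-covariant tensor in a chart. -/
def chartForm (T : Tensor2 3 M) (e : OpenPartialHomeomorph M E3) (y : E3) :
    E3 →L[ℝ] E3 →L[ℝ] ℝ :=
  (formAt T (e.symm y)).bilinearComp (dSymm e y) (dSymm e y)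

theorem chartForm_apply (T : Tensor2 3 M) (e : OpenPartialHomeomorph M E3) (y u v : E3) :
    chartForm T e y u v = formAt T (e.symm y) (dSymm e y u) (dSymm e y v) := rfl

theorem chartForm_ee (T : Tensor2 3 M) (e : OpenPartialHomeomorph M E3) (y : E3) (i j : Fin 3) :
    chartForm T e y (ee i) (ee j) = comp T e y i j := rfl

variable [IsManifold (𝓡 3) ∞ M] {e e' : OpenPartialHomeomorph M E3}

theorem mdifferentiable_atlas (he : e ∈ atlas E3 M) : e.MDifferentiable (𝓡 3) (𝓡 3) :=
  haveI : IsManifold (𝓡 3) 1 M := IsManifold.of_le (n := ∞) (by simp)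
  mdifferentiable_of_mem_atlas he

/-- The transition map between two charts. -/
def transition (e e' : OpenPartialHomeomorph M E3) (y : E3) : E3 := e' (e.symm y)

/-- The domain of the transition map between two charts. -/
def transitionDomain (e e' : OpenPartialHomeomorph M E3) : Set E3 :=
  e.target ∩ e.symm ⁻¹' e'.source

theorem isOpen_transitionDomain (e e' : OpenPartialHomeomorph M E3) :
    IsOpen (transitionDomain e e') :=
  e.isOpen_inter_preimage_symm e'.open_source

theorem contDiffOn_transition (he : e ∈ atlas E3 M) (he' : e' ∈ atlas E3 M) :
    ContDiffOn ℝ ∞ (transition e e') (transitionDomain e e') := by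
  have h1 := contMDiffOn_symm_of_mem_maximalAtlas (I := 𝓡 3) (n := ∞)
    (IsManifold.subset_maximalAtlas he)
  have h2 := contMDiffOn_of_mem_maximalAtlas (I := 𝓡 3) (n := ∞)
    (IsManifold.subset_maximalAtlas he')
  exact contMDiffOn_iff_contDiffOn.1
    (h2.comp (h1.mono Set.inter_subset_left) fun y hy => hy.2)

theorem symm_transition {y : E3} (hy : y ∈ transitionDomain e e') :
    e'.symm (transition e e' y) = e.symm y := e'.left_inv hy.2

theorem transition_mem {y : E3} (hy : y ∈ transitionDomain e e') :
    transition e e' y ∈ e'.target := e'.map_source hy.2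

theorem fderiv_transition (he : e ∈ atlas E3 M) (he' : e' ∈ atlas E3 M) {y : E3}
    (hy : y ∈ transitionDomain e e') (v : E3) :
    fderiv ℝ (transition e e') y v = dChart e' (e.symm y) (dSymm e y v) := by
  have h := mfderiv_comp_apply y ((mdifferentiable_atlas he').mdifferentiableAt hy.2)
    ((mdifferentiable_atlas he).mdifferentiableAt_symm hy.1) v
  rw [← mfderiv_eq_fderiv]
  exact h

theorem dSymm_dChart (he : e ∈ atlas E3 M) {x : M} (hx : x ∈ e.source) (v : E3) :
    dSymm e (e x) (dChart e x v) = v :=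
  congrArg (fun T => T v) ((mdifferentiable_atlas he).symm_comp_deriv hx)

theorem dSymm_transition (he : e ∈ atlas E3 M) (he' : e' ∈ atlas E3 M) {y : E3}
    (hy : y ∈ transitionDomain e e') (v : E3) :
    dSymm e' (transition e e' y) (fderiv ℝ (transition e e') y v) = dSymm e y v := by
  rw [fderiv_transition he he' hy]
  exact dSymm_dChart he' hy.2 _

theorem chartForm_transition (T : Tensor2 3 M) (he : e ∈ atlas E3 M) (he' : e' ∈ atlas E3 M)
    {y : E3} (hy : y ∈ transitionDomain e e') (u v : E3) :
    chartForm T e y u v = chartForm T e' (transition e e' y) (fderiv ℝ (transition e e') y u)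
      (fderiv ℝ (transition e e') y v) := by
  rw [chartForm_apply, chartForm_apply, dSymm_transition he he' hy, dSymm_transition he he' hy,
    symm_transition hy]

theorem dSymm_ne_zero (he : e ∈ atlas E3 M) {y : E3} (hy : y ∈ e.target) {v : E3} (hv : v ≠ 0) :
    dSymm e y v ≠ 0 := fun h0 =>
  hv ((mdifferentiable_atlas he).symm.mfderiv_injective hy (h0.trans (map_zero (dSymm e y)).symm))

theorem dChart_ne_zero (he : e ∈ atlas E3 M) {x : M} (hx : x ∈ e.source) {v : E3} (hv : v ≠ 0) :
    dChart e x v ≠ 0 := fun h0 =>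
  hv ((mdifferentiable_atlas he).mfderiv_injective hx (h0.trans (map_zero (dChart e x)).symm))

theorem formAt_eq_chartForm (T : Tensor2 3 M) (he : e ∈ atlas E3 M) {x : M} (hx : x ∈ e.source)
    (v w : E3) : formAt T x v w = chartForm T e (e x) (dChart e x v) (dChart e x w) := by
  rw [chartForm_apply, dSymm_dChart he hx, dSymm_dChart he hx, e.left_inv hx]

theorem tensor_ext {T T' : Tensor2 3 M}
    (h : ∀ e ∈ atlas E3 M, ∀ y ∈ e.target, chartForm T e y = chartForm T' e y) : T = T' := by
  have : formAt T = formAt T' := by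
    funext x
    have he := chart_mem_atlas E3 x
    ext v w
    rw [formAt_eq_chartForm T he (mem_chart_source E3 x), formAt_eq_chartForm T' he
      (mem_chart_source E3 x), h _ he _ (mem_chart_target E3 x)]
  exact this

variable {g : RiemMetric 3 M} {m : ℕ} {α : ℝ≥0}

theorem chartMetric (hg : IsCkAlphaTensor (m + 2) α g.inner) (hp : PositiveSectionalCurvature g)
    (he : e ∈ atlas E3 M) : ChartMetric m α (chartForm g.inner e) (comp g.inner e) e.target where
  isOpen := e.open_target
  comp := chartForm_ee g.inner e
  regular := hg e he
  symm := fun y hy u v => g.symm (e.symm y) _ _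
  pos := fun y hy v hv => g.pos (e.symm y) _ (dSymm_ne_zero he hy hv)
  curvature := hp e he

/-- Curvature is natural under the transition map, so the root of one chart pulls back to a
symmetric positive definite solution of the Gauss equation in the other. Uniqueness of that solution
gives equality; hence the local roots form a tensor field. -/
theorem chartRoot_transition (hα : α ≤ 1) (hg : IsCkAlphaTensor (m + 2) α g.inner)
    (hp : PositiveSectionalCurvature g) (he : e ∈ atlas E3 M) (he' : e' ∈ atlas E3 M)
    {y : E3} (hy : y ∈ transitionDomain e e') (u v : E3) :
    chartRoot (comp g.inner e) y u v =
      chartRoot (comp g.inner e') (transition e e' y) (fderiv ℝ (transition e e') y u)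
        (fderiv ℝ (transition e e') y v) := by
  have h := chartMetric hg hp he
  have h' := chartMetric hg hp he'
  have hL := (h.leviCivita hα).mono (isOpen_transitionDomain e e') Set.inter_subset_left
  have hB : ∀ y ∈ transitionDomain e e', ∀ u v, chartForm g.inner e y u v =
      chartForm g.inner e' (transition e e' y) (fderiv ℝ (transition e e') y u)
      (fderiv ℝ (transition e e') y v) := fun y hy => chartForm_transition g.inner he he' hy
  have hm : ∀ y ∈ transitionDomain e e', transition e e' y ∈ e'.target := fun y hy =>
    transition_mem hy
  have hinj := hL.fderiv_injective hB hy
  have hR := (h'.leviCivita hα).transform_curv hL (contDiffOn_infty.1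
    (contDiffOn_transition he he') 3) hm hB hy
  let c : E3 →L[ℝ] E3 →L[ℝ] ℝ := (chartRoot (comp g.inner e') (transition e e' y)).bilinearComp
    (fderiv ℝ (transition e e') y) (fderiv ℝ (transition e e') y)
  have hc : c = chartRoot (comp g.inner e) y := by
    refine h.eq_root hα hy.1 (fun u v => h'.root_symm hα (hm y hy) _ _)
      (fun v hv => h'.root_pos hα (hm y hy) fun h0 => hv (hinj (h0.trans (by simp)))) ?_
    intro a b u v
    rw [hB y hy, hR, h'.gaussEq hα _ (hm y hy)]
    rfl
  rw [← hc]
  rfl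

variable (g) in
/-- The positive definite solution of the contracted Gauss equation. -/
def gaussField : Tensor2 3 M := fun x =>
  (chartRoot (comp g.inner (chartAt E3 x)) (chartAt E3 x x)).bilinearComp
    (dChart (chartAt E3 x) x) (dChart (chartAt E3 x) x)

/-- Independence of `gaussField` from the preferred chart used at each point. -/
theorem chartForm_gaussField (hα : α ≤ 1) (hg : IsCkAlphaTensor (m + 2) α g.inner)
    (hp : PositiveSectionalCurvature g) (he : e ∈ atlas E3 M) {y : E3} (hy : y ∈ e.target) :
    chartForm (gaussField g) e y = chartRoot (comp g.inner e) y := by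
  have he' := chart_mem_atlas E3 (e.symm y)
  have hy' : y ∈ transitionDomain e (chartAt E3 (e.symm y)) := ⟨hy, mem_chart_source E3 _⟩
  ext u v
  rw [chartRoot_transition hα hg hp he he' hy', fderiv_transition he he' hy',
    fderiv_transition he he' hy']
  rfl

theorem isGaussSolution_gaussField (hα : α ≤ 1) (hg : IsCkAlphaTensor (m + 2) α g.inner)
    (hp : PositiveSectionalCurvature g) : IsGaussSolution g (gaussField g) where
  symm := fun x v w => (chartMetric hg hp (chart_mem_atlas E3 x)).root_symm hα
    (mem_chart_target E3 x) _ _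
  pos := fun x v hv => (chartMetric hg hp (chart_mem_atlas E3 x)).root_pos hα
    (mem_chart_target E3 x) (dChart_ne_zero (chart_mem_atlas E3 x) (mem_chart_source E3 x) hv)
  contractedGauss := fun e he y hy => by
    have h := chartMetric hg hp he
    have := (h.contractedGauss_iff hα hy (chartRoot (comp g.inner e) y)).2 (h.gaussEq hα y hy)
    rw [← chartForm_gaussField hα hg hp he hy] at this
    exact this

theorem IsGaussSolution.eq_gaussField (hα : α ≤ 1) (hg : IsCkAlphaTensor (m + 2) α g.inner)
    (hp : PositiveSectionalCurvature g) {χ : Tensor2 3 M} (hχ : IsGaussSolution g χ) :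
    χ = gaussField g := by
  refine tensor_ext fun e he y hy => ?_
  have h := chartMetric hg hp he
  rw [chartForm_gaussField hα hg hp he hy]
  exact h.eq_root hα hy (fun u v => hχ.symm (e.symm y) _ _)
    (fun v hv => hχ.pos (e.symm y) _ (dSymm_ne_zero he hy hv))
    ((h.contractedGauss_iff hα hy _).1 (hχ.contractedGauss e he y hy))

theorem isCkAlphaTensor_gaussField (hα : α ≤ 1) (hg : IsCkAlphaTensor (m + 2) α g.inner)
    (hp : PositiveSectionalCurvature g) : IsCkAlphaTensor m α (gaussField g) := by
  intro e he i j
  refine ((chartMetric hg hp he).regular_root hα i j).congr e.open_target fun y hy => ?_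
  rw [← chartForm_gaussField hα hg hp he hy]
  rfl

theorem codazzi_gaussField_iff (hα : α ≤ 1) (hm : 1 ≤ m)
    (hg : IsCkAlphaTensor (m + 2) α g.inner) (hp : PositiveSectionalCurvature g) :
    Codazzi g (gaussField g) ↔ ∀ e ∈ atlas E3 M,
      CodazziEq (christoffelMap (comp g.inner e)) (chartRoot (comp g.inner e)) e.target := by
  refine forall₂_congr fun e he => ?_
  refine ((chartMetric hg hp he).codazziEq_iff hα hm fun y hy i j => ?_).symm
  rw [← chartForm_gaussField hα hg hp he hy]
  rfl

end ThreeManifold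

/-! ### Local embeddings of three-manifolds -/

section Embedding

variable {M : Type} [TopologicalSpace M] [ChartedSpace E3 M] [IsManifold (𝓡 3) ∞ M]
  {e e' : OpenPartialHomeomorph M E3} {g : RiemMetric 3 M} {m : ℕ} {α : ℝ≥0}

/-- Euclidean four-space. -/
abbrev E4 : Type := EuclideanSpace ℝ (Fin 4)

/-- The part of a chart domain on which `U` lives, in coordinates. -/
def chartDomain (e : OpenPartialHomeomorph M E3) (U : Set M) : Set E3 := e.target ∩ e.symm ⁻¹' U

theorem isOpen_chartDomain (e : OpenPartialHomeomorph M E3) {U : Set M} (hU : IsOpen U) :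
    IsOpen (chartDomain e U) := e.isOpen_inter_preimage_symm hU

/-- The derivative of a map to `ℝ⁴`, as a linear map of vector spaces. -/
def dMap (X : M → E4) (x : M) : E3 →L[ℝ] E4 := mfderiv (𝓡 3) (𝓡 4) X x

theorem fderiv_comp_symm (he : e ∈ atlas E3 M) {X : M → E4} {y : E3} (hy : y ∈ e.target)
    (hX : MDifferentiableAt (𝓡 3) (𝓡 4) X (e.symm y)) (v : E3) :
    fderiv ℝ (fun z => X (e.symm z)) y v = dMap X (e.symm y) (dSymm e y v) := by
  have h := mfderiv_comp_apply y hX ((mdifferentiable_atlas he).mdifferentiableAt_symm hy) v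
  rw [← mfderiv_eq_fderiv]
  exact h

theorem mdifferentiableAt_of_comp_symm (he : e ∈ atlas E3 M) {X : M → E4} {x : M}
    (hx : x ∈ e.source) (hX : DifferentiableAt ℝ (fun z => X (e.symm z)) (e x)) :
    MDifferentiableAt (𝓡 3) (𝓡 4) X x := by
  have h := (mdifferentiableAt_iff_differentiableAt.2 hX).comp x
    ((mdifferentiable_atlas he).mdifferentiableAt hx)
  refine h.congr_of_eventuallyEq ?_
  filter_upwards [e.open_source.mem_nhds hx] with z hz
  simp [e.left_inv hz]

/-- The coordinate expression of a `C²` isometric embedding. -/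
theorem isometricImmersion_comp_symm (he : e ∈ atlas E3 M) {X : M → E4} {U : Set M}
    (hU : IsOpen U) (hX : ContDiffOn ℝ 2 (fun z => X (e.symm z)) (chartDomain e U))
    (hi : IsIsometricEmbeddingOn g X U) :
    IsometricImmersion (chartForm g.inner e) (fun z => X (e.symm z)) (chartDomain e U) where
  contDiff := hX
  isometric := fun y hy u v => by
    have hd : MDifferentiableAt (𝓡 3) (𝓡 4) X (e.symm y) := by
      refine mdifferentiableAt_of_comp_symm he (e.map_target hy.1) ?_
      rw [e.right_inv hy.1]
      exact (hX.contDiffAt ((isOpen_chartDomain e hU).mem_nhds hy)).differentiableAt (by simp)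
    rw [fderiv_comp_symm he hy.1 hd, fderiv_comp_symm he hy.1 hd]
    exact hi.isometric (e.symm y) hy.2 _ _

theorem ShapeData.mono {B : E3 → E3 →L[ℝ] E3 →L[ℝ] ℝ} {Γ : E3 → E3 →L[ℝ] E3 →L[ℝ] E3}
    {χ : E3 → E3 →L[ℝ] E3 →L[ℝ] ℝ} {S : E3 → E3 →L[ℝ] E3} {Ω Ω' : Set E3}
    (h : ShapeData B Γ χ S Ω) (ho : IsOpen Ω') (hs : Ω' ⊆ Ω) : ShapeData B Γ χ S Ω' :=
  ⟨h.toLeviCivita.mono ho hs, h.contDiffχ.mono hs, h.contDiffS.mono hs,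
    fun y hy => h.symmχ y (hs hy), fun y hy => h.posχ y (hs hy), fun y hy => h.shape y (hs hy)⟩

theorem exists_adaptedNormal_chart (hα : α ≤ 1) (hm : 1 ≤ m)
    (hg : IsCkAlphaTensor (m + 2) α g.inner) (hp : PositiveSectionalCurvature g)
    (he : e ∈ atlas E3 M) {X : M → E4} {U : Set M} (hU : IsOpen U)
    (hX : IsometricImmersion (chartForm g.inner e) (fun z => X (e.symm z)) (chartDomain e U)) :
    ∃ n, AdaptedNormal (christoffelMap (comp g.inner e)) (chartRoot (comp g.inner e))
      (fun z => X (e.symm z)) n (chartDomain e U) := by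
  have h := chartMetric hg hp he
  exact exists_adaptedNormal ((h.shapeData hα hm).mono (isOpen_chartDomain e hU)
    Set.inter_subset_left) (fun y hy => h.gaussRigid hα y hy.1) hX (by simp)

/-- The Codazzi equations are local, and near each point a C² embedding with its adapted normal
supplies them. -/
theorem codazzi_of_locallyEmbeddable (hα : α ≤ 1) (hm : 1 ≤ m)
    (hg : IsCkAlphaTensor (m + 2) α g.inner) (hp : PositiveSectionalCurvature g)
    (h : LocallyEmbeddable (m + 2) α g 4) : Codazzi g (gaussField g) := by
  rw [codazzi_gaussField_iff hα hm hg hp]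
  intro e he y hy
  obtain ⟨U, hU, hpU, X, hX, hi⟩ := h (e.symm y)
  have h1 := isometricImmersion_comp_symm he hU ((hX e he).contDiffOn.of_le
    (by exact_mod_cast Nat.le_add_left 2 m)) hi
  obtain ⟨n, hn⟩ := exists_adaptedNormal_chart hα hm hg hp he hU h1
  exact hn.codazziEq (((chartMetric hg hp he).shapeData hα hm).mono (isOpen_chartDomain e hU)
    Set.inter_subset_left) h1 y ⟨hy, hpU⟩

/-- Near each point, two isometric embeddings differ by an isometry, and the isometry is determined
by the embeddings near the point. -/
theorem exists_isometry_near (hα : α ≤ 1) (hm : 1 ≤ m)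
    (hg : IsCkAlphaTensor (m + 2) α g.inner) (hp : PositiveSectionalCurvature g)
    {U : Set M} (hU : IsOpen U) {X X' : M → E4}
    (hX : ContMDiffOn (𝓡 3) (𝓡 4) 2 X U) (hi : IsIsometricEmbeddingOn g X U)
    (hX' : ContMDiffOn (𝓡 3) (𝓡 4) 2 X' U) (hi' : IsIsometricEmbeddingOn g X' U)
    {x : M} (hx : x ∈ U) :
    (∃ Ψ : E4 ≃ᵃⁱ[ℝ] E4, ∀ᶠ z in 𝓝 x, X' z = Ψ (X z)) ∧
      ∀ Ψ Ψ' : E4 ≃ᵃⁱ[ℝ] E4, (∀ᶠ z in 𝓝 x, Ψ (X z) = Ψ' (X z)) → Ψ = Ψ' := by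
  have he := chart_mem_atlas E3 x
  set e := chartAt E3 x
  have hxe : x ∈ e.source := mem_chart_source E3 x
  have hy : e x ∈ chartDomain e U := ⟨e.map_source hxe, by simpa [e.left_inv hxe] using hx⟩
  have hs : ContMDiffOn (𝓡 3) (𝓡 3) 2 e.symm e.target :=
    contMDiffOn_infty.1 (contMDiffOn_symm_of_mem_maximalAtlas (I := 𝓡 3) (n := ∞)
      (IsManifold.subset_maximalAtlas he)) 2
  have hc : ∀ X : M → E4, ContMDiffOn (𝓡 3) (𝓡 4) 2 X U →
      ContDiffOn ℝ 2 (fun z => X (e.symm z)) (chartDomain e U) := fun X hX =>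
    contMDiffOn_iff_contDiffOn.1 (hX.comp (hs.mono Set.inter_subset_left) fun y hy => hy.2)
  have h1 := isometricImmersion_comp_symm he hU (hc X hX) hi
  have h1' := isometricImmersion_comp_symm he hU (hc X' hX') hi'
  obtain ⟨n, hn⟩ := exists_adaptedNormal_chart hα hm hg hp he hU h1
  obtain ⟨n', hn'⟩ := exists_adaptedNormal_chart hα hm hg hp he hU h1'
  have hS := ((chartMetric hg hp he).shapeData hα hm).mono (isOpen_chartDomain e hU)
    Set.inter_subset_left
  constructor
  · obtain ⟨Ψ, hΨ⟩ := hn.exists_isometry (by simp) hn' hS h1 h1' hy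
    refine ⟨Ψ, ?_⟩
    filter_upwards [(e.continuousAt hxe).eventually hΨ, e.open_source.mem_nhds hxe] with z hz hze
    rwa [e.left_inv hze] at hz
  · intro Ψ Ψ' h
    refine hn.isometry_unique hS h1 hy ?_
    have : Filter.Tendsto e.symm (𝓝 (e x)) (𝓝 x) := by
      have := e.continuousAt_symm (e.map_source hxe)
      rwa [ContinuousAt, e.left_inv hxe] at this
    exact this.eventually h

/-- The points near which Ψ works and those near which some other isometry works form two open sets
covering U. Local uniqueness of the isometry keeps them disjoint on U, so connectedness leaves only
the first. -/
theorem locallyRigid_of_positive (hα : α ≤ 1) (hm : 1 ≤ m)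
    (hg : IsCkAlphaTensor (m + 2) α g.inner) (hp : PositiveSectionalCurvature g) :
    LocallyRigid g 4 := by
  intro U hU hUc X X' hX hi hX' hi'
  have loc := fun x (hx : x ∈ U) => exists_isometry_near hα hm hg hp hU hX hi hX' hi' hx
  obtain ⟨x₀, hx₀⟩ := hUc.nonempty
  obtain ⟨Ψ, hΨ⟩ := (loc x₀ hx₀).1
  let A : Set M := {x | ∀ᶠ z in 𝓝 x, X' z = Ψ (X z)}
  let A' : Set M := {x | ∃ Ψ' : E4 ≃ᵃⁱ[ℝ] E4, Ψ' ≠ Ψ ∧ ∀ᶠ z in 𝓝 x, X' z = Ψ' (X z)}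
  have hA : IsOpen A := isOpen_setOfPred_eventually_nhds
  have hA' : IsOpen A' := by
    have : A' = ⋃ Ψ' ∈ {Ψ' : E4 ≃ᵃⁱ[ℝ] E4 | Ψ' ≠ Ψ}, {x | ∀ᶠ z in 𝓝 x, X' z = Ψ' (X z)} := by
      ext x
      simp [A']
    rw [this]
    exact isOpen_biUnion fun _ _ => isOpen_setOfPred_eventually_nhds
  have hcov : U ⊆ A ∪ A' := fun x hx => by
    obtain ⟨Ψ', h'⟩ := (loc x hx).1
    by_cases hΨ' : Ψ' = Ψ
    · left
      rwa [hΨ'] at h'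
    · exact Or.inr ⟨Ψ', hΨ', h'⟩
  refine ⟨Ψ, fun x hx => ?_⟩
  by_contra hne
  have hxA' : x ∈ A' := (hcov hx).resolve_left fun h => hne h.self_of_nhds
  obtain ⟨z, hzU, hzA, Ψ', hΨ', hz⟩ := hUc.isPreconnected A A' hA hA' hcov ⟨x₀, hx₀, hΨ⟩
    ⟨x, hx, hxA'⟩
  refine hΨ' ((loc z hzU).2 Ψ' Ψ ?_)
  filter_upwards [hzA, hz] with w h1 h2
  rw [← h1, ← h2]

/-! ### Local embeddings from the Codazzi equations -/

open scoped MatrixOrder in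
/-- Euclidean four-space contains a copy of any inner product on `ℝ³`, together with a unit normal. -/
theorem exists_initial_frame {G : Matrix (Fin 3) (Fin 3) ℝ} (hG : G.PosDef) :
    ∃ (W : E3 →L[ℝ] E4) (n : E4), (∀ u v, inner ℝ (W u) (W v) = bilOf (fun i j => G i j) u v) ∧
      (∀ u, inner ℝ (W u) n = 0) ∧ inner ℝ n n = (1 : ℝ) := by
  -- G = C* C makes G the Gram matrix of the columns of C. Prefixing each column with 0 leaves the
  -- first coordinate vector of ℝ⁴ as unit normal.
  obtain ⟨C, hC⟩ := CStarAlgebra.nonneg_iff_eq_star_mul_self.mp hG.posSemidef.nonneg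
  let W : E3 →L[ℝ] E4 := clmOf fun i => WithLp.toLp 2 (Fin.cons 0 fun k => C k i)
  have hW : ∀ i, W (ee i) = WithLp.toLp 2 (Fin.cons 0 fun k => C k i) := fun i => clmOf_apply _ i
  have h1 : (innerSL ℝ).bilinearComp W W = bilOf fun i j => G i j := bil_ext_ee fun i j => by
    rw [bilOf_apply, ContinuousLinearMap.bilinearComp_apply, hW, hW, innerSL_apply_apply, hC,
      Matrix.mul_apply, PiLp.inner_apply, Fin.sum_univ_succ]
    simp [Matrix.star_apply, mul_comm]
  have h2 : ((innerSL ℝ).flip (EuclideanSpace.single (0 : Fin 4) (1 : ℝ))).comp W = 0 :=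
    clm_ext_ee fun i => by
      rw [ContinuousLinearMap.comp_apply, hW, ContinuousLinearMap.flip_apply, innerSL_apply_apply,
        EuclideanSpace.inner_single_right]
      simp
  exact ⟨W, EuclideanSpace.single (0 : Fin 4) 1, fun u v => congrArg (fun T => T u v) h1,
    fun u => congrArg (fun T => T u) h2, by simp⟩

theorem locallyEmbeddable_of_codazzi (hα : α ≤ 1) (hm : 1 ≤ m)
    (hg : IsCkAlphaTensor (m + 2) α g.inner) (hp : PositiveSectionalCurvature g)
    (h : Codazzi g (gaussField g)) : LocallyEmbeddable (m + 2) α g 4 := by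
  rw [codazzi_gaussField_iff hα hm hg hp] at h
  intro p
  have he := chart_mem_atlas E3 p
  have hpe : p ∈ (chartAt E3 p).source := mem_chart_source E3 p
  set e := chartAt E3 p
  have hG := chartMetric hg hp he
  have hS := hG.shapeData hα hm
  have hpt : e p ∈ e.target := e.map_source hpe
  obtain ⟨W, n, h1, h2, h3⟩ := exists_initial_frame (hG.posDef hpt)
  have hW : bilOf (fun i j => comp g.inner e (e p) i j) = chartForm g.inner e (e p) :=
    bil_ext_ee fun i j => by rw [bilOf_apply, chartForm_ee]
  rw [hW] at h1
  -- Γ is one order smoother than χ and S; the weaker class m for all three already yields X of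
  -- class m + 2.
  obtain ⟨X, Ω, hΩ, hΩo, hpΩ, hX, hiso⟩ := hS.exists_immersion (hG.gaussEq hα) (h e he) hpt h1 h2 h3
    hα ((hG.regularΓ hα).of_succ hα hG.isOpen) (hG.regularχ hα) (hG.regularS hα)
  have hXd : ∀ y ∈ Ω, ContDiffAt ℝ 1 X y := fun y hy =>
    (hX.contDiffOn.contDiffAt (hΩo.mem_nhds hy)).of_le (by norm_cast; omega)
  have hinj : Function.Injective (fderiv ℝ X (e p)) := by
    rw [injective_iff_map_eq_zero]
    intro v hv
    by_contra hne
    have := hG.pos _ hpt v hne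
    rw [← hiso _ hpΩ, hv] at this
    simp at this
  -- With L a left inverse of dX at the point, L ∘ X has the identity as derivative there, so it is
  -- a local homeomorphism by the inverse function theorem.
  obtain ⟨L, hL⟩ := LinearMap.exists_leftInverse_of_injective
    (fderiv ℝ X (e p) : E3 →ₗ[ℝ] E4) (LinearMap.ker_eq_bot.2 hinj)
  let L' : E4 →L[ℝ] E3 := LinearMap.toContinuousLinearMap L
  have hst : HasStrictFDerivAt (fun y => L' (X y))
      ((ContinuousLinearEquiv.refl ℝ E3 : E3 ≃L[ℝ] E3) : E3 →L[ℝ] E3) (e p) := by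
    have := L'.hasStrictFDerivAt.comp (e p) ((hXd _ hpΩ).hasStrictFDerivAt (by simp))
    refine this.congr_fderiv ?_
    ext1 v
    exact congrArg (fun T => T v) hL
  let f := hst.toOpenPartialHomeomorph _
  let f' := (e.trans (OpenPartialHomeomorph.ofSet Ω hΩo)).trans f
  have hf' : ∀ x, f' x = L' (X (e x)) := fun x => rfl
  have hU : ∀ x ∈ f'.source, x ∈ e.source ∧ e x ∈ Ω := fun x hx => by
    simp [f'] at hx
    tauto
  refine ⟨f'.source, f'.open_source, ?_, fun x => X (e x), fun e' he' => ?_, ?_, ?_⟩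
  · have := hst.mem_toOpenPartialHomeomorph_source
    simp [f', hpe, hpΩ]
    exact this
  -- In another chart the map is X after a smooth transition map, which preserves the class.
  · have ho := isOpen_chartDomain e' f'.open_source
    refine (hX.precomp hα hΩo (φ := transition e' e) ho
      ((contDiffOn_transition he' he).mono fun y hy => ⟨hy.1, (hU _ hy.2).1⟩)
      fun y hy => (hU _ hy.2).2)
  -- A continuous map that becomes an embedding after composition with the continuous L' is itself
  -- an embedding.
  · have hc : Topology.IsEmbedding (f'.source.domRestrict f') :=
      f'.isOpenEmbedding_restrict.isEmbedding
    refine Topology.IsEmbedding.of_comp (g := L') ?_ L'.continuous hc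
    refine continuousOn_iff_continuous_domRestrict.1 ?_
    exact ContinuousOn.comp (t := Ω) (fun y hy => (hXd y hy).continuousAt.continuousWithinAt)
      (e.continuousOn.mono fun x hx => (hU x hx).1) fun x hx => (hU x hx).2
  · intro x hx v w
    have hxe := (hU x hx).1
    have hd : ∀ v : E3, dMap (fun x => X (e x)) x v = fderiv ℝ X (e x) (dChart e x v) := by
      intro v
      have hXx : MDifferentiableAt (𝓡 3) (𝓡 4) X (e x) := mdifferentiableAt_iff_differentiableAt.2
        ((hXd _ (hU x hx).2).differentiableAt (by simp))
      have := mfderiv_comp_apply x hXx ((mdifferentiable_atlas he).mdifferentiableAt hxe) v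
      rw [← mfderiv_eq_fderiv]
      exact this
    have hi : ∀ v w : E3, inner ℝ (dMap (fun x => X (e x)) x v) (dMap (fun x => X (e x)) x w) =
        formAt g.inner x v w := fun v w => by
      rw [hd, hd, hiso _ (hU x hx).2, formAt_eq_chartForm g.inner he hxe]
    exact hi v w

end Embedding

end LocalEmbed

end

/-! ### The theorem on the three-sphere -/

theorem theorem5p6 (k : ℕ) (hk : 3 ≤ k) (α : ℝ≥0) (hα : α < 1)
    (g : LocalEmbed.RiemMetric 3 LocalEmbed.S3)
    (hg : LocalEmbed.IsCkAlphaTensor k α g.inner)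
    (hpos : LocalEmbed.PositiveSectionalCurvature g) :
    ∃ χ : LocalEmbed.Tensor2 3 LocalEmbed.S3,
      LocalEmbed.IsGaussSolution g χ ∧
      (∀ χ' : LocalEmbed.Tensor2 3 LocalEmbed.S3, LocalEmbed.IsGaussSolution g χ' → χ' = χ) ∧
      LocalEmbed.IsCkAlphaTensor (k - 2) α χ ∧
      (LocalEmbed.LocallyEmbeddable k α g 4 ↔ LocalEmbed.Codazzi g χ) ∧
      (LocalEmbed.LocallyEmbeddable k α g 4 → LocalEmbed.LocallyRigid g 4) := by
  -- m = k - 2 is the order of χ; k ≥ 3 gives m ≥ 1, so χ is C¹ and its Codazzi equations are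
  -- classical.
  obtain ⟨m, rfl⟩ : ∃ m, k = m + 2 := ⟨k - 2, by omega⟩
  have hm : 1 ≤ m := by omega
  have : IsManifold (𝓡 3) ∞ LocalEmbed.S3 := inferInstance
  exact ⟨LocalEmbed.gaussField g, LocalEmbed.isGaussSolution_gaussField hα.le hg hpos,
    fun χ' h => h.eq_gaussField hα.le hg hpos, LocalEmbed.isCkAlphaTensor_gaussField hα.le hg hpos,
    ⟨LocalEmbed.codazzi_of_locallyEmbeddable hα.le hm hg hpos,
      LocalEmbed.locallyEmbeddable_of_codazzi hα.le hm hg hpos⟩,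
    fun _ => LocalEmbed.locallyRigid_of_positive hα.le hm hg hpos⟩
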